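/- Let $\overline{M}$ be a smooth manifold of dimension $n+1\ge 2$ with boundary $\partial M$ and interior $M$. A local defining function for $\partial M$ is a smooth function $\rho:U\to[0,\infty)$ on an open set $U\subset\overline M$ with $\rho^{-1}(0)=U\cap\partial M$ and $d\rho\ne0$ on $U\cap\partial M$; write $\rho_a=d\rho$. For a torsion-free linear connection $\nabla$ and a one-form $\Upsilon$ let $(\nabla+\Upsilon)_\xi\eta=\nabla_\xi\eta+\Upsilon(\xi)\eta+\Upsilon(\eta)\xi$. Let $\nabla$ be a smooth torsion-free connection on $TM$ that is special (it preserves a volume density) and projectively compact of order $2$: each $x\in\partial M$ has a neighbourhood with a local defining function $\rho'$ such that $\nabla+\frac{d\rho'}{2\rho'}$ extends smoothly to the boundary. Assume that the boundary geometry is non-degenerate: for every local defining function $\rho'$ and every connection $\tilde\nabla$ in the (extended) projective class that is smooth up to the boundary, $\tilde\nabla d\rho'$ is non-degenerate on $T_x\partial M$, for each $x\in\partial M$ where both are defined. Let $\mathcal E(w)$ be the bundle of densities of projective weight $w$ (volume densities have weight $-n-2$), $\mathsf P_{ab}$ the projective Schouten tensor of $\nabla$ (so $R_{ca}{}^c{}_b=(n+1)\mathsf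 P_{ab}-\mathsf P_{ba}$), and $\tau\in\Gamma(\mathcal E(2)|_M)$ a nowhere vanishing $\nabla$-parallel section, extended by $0$ to $\partial M$. Let $\mathcal T$ be the standard tractor bundle of the projective structure on $\overline M$: a connection $\tilde\nabla$ in the class identifies $\mathcal T$ with $\mathcal E^a(-1)\oplus\mathcal E(-1)\ni(\nu^a,\sigma)$, and $\tilde\nabla+\Upsilon$ gives $(\nu^a,\sigma-\Upsilon_a\nu^a)$. Let $L(\tau)$ be the symmetric bilinear form on $\mathcal T$ which in the splitting of any $\tilde\nabla$ in the class has the slots $\tau$, $\frac12\tilde\nabla_a\tau$, $\frac12\tilde\nabla_a\tilde\nabla_b\tau+\tilde{\mathsf P}_{ab}\tau$; here slots $(\alpha,\mu_a,\phi_{ab})$ represent $\alpha\sigma_1\sigma_2+\sigma_1\mu_a\nu_2^a+\sigma_2\mu_a\nu_1^a+\phi_{ab}\nu_1^a\nu_2^b$. Dually, slots $(Z^{ab},\lambda^a,\kappa)$ of an element of $S^2\mathcal T$ represent the form $Z^{ab}\mu_a\mu'_b+\lambda^a(\beta'\mu_a+\beta\mu'_a)+\kappa\beta\beta'$ on cotractors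 $(\nu,\sigma)\mapsto\beta\sigma+\mu_a\nu^a$. Let $\rho:U\to[0,\infty)$ be a local defining function. Then $\hat\nabla=\nabla+\frac{d\rho}{2\rho}$ extends smoothly to $U$, $L(\tau)$ is well defined on $U$ (independent of $\tilde\nabla$), the set $V\subset U$ on which $L(\tau)$ is non-degenerate is open and contains $U\cap\partial M$, $\mathsf P_{ab}$ is non-degenerate on $V\cap M$ (with inverse $\mathsf P^{ab}$), and $\tau=\rho\hat\tau$ for a smooth nowhere vanishing $\hat\tau\in\Gamma(\mathcal E(2)|_U)$. In the splitting of $S^2\mathcal T$ over $V$ given by $\hat\nabla$, $$L(\tau)^{-1}=\begin{pmatrix}\hat\tau^{-1}\rho^{-1}\mathsf P^{ab}\\ 2\hat\tau^{-1}t^a\\ \hat\tau^{-1}\psi\end{pmatrix},\qquad t^a=-\tfrac1{4\rho^2}\mathsf P^{ab}\rho_b,$$ where $\psi$ is a smooth function on $V$, and where $\rho^{-1}\mathsf P^{ab}$ and $t^a$ stand for their smooth extensions from $V\cap M$ to $V$. Moreover $\rho\mathsf P_{ab}+\frac1{4\rho}\rho_a\rho_b$ extends smoothly to $V$, and on $V$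 $$t^a\rho_a=1-\rho\psi,\qquad t^a\bigl(\rho\mathsf P_{ab}+\tfrac1{4\rho}\rho_a\rho_b\bigr)=-\tfrac14\psi\rho_b,\qquad \rho^{-1}\mathsf P^{ac}\bigl(\rho\mathsf P_{cb}+\tfrac1{4\rho}\rho_c\rho_b\bigr)+t^a\rho_b=\delta^a_b.$$ In particular, $\rho^{-1}\mathsf P^{ab}$ and $\rho^{-2}\mathsf P^{ab}\rho_b$ extend smoothly from $V\cap M$ to $V$. -/

import Mathlib

open Set Bundle
open scoped Manifold ContDiff Topology

noncomputable section

namespace ProjCompact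

/-! ### Linear algebra: inverses of bilinear forms and slot descriptions -/

/-- The map `V* → V` inverse to `V → V*`, `v ↦ Φ(v, ·)` (junk value `0` if the latter is not
bijective). -/
def sharp {V : Type*} [AddCommGroup V] [Module ℝ V] (Φ : LinearMap.BilinForm ℝ V) :
    Module.Dual ℝ V →ₗ[ℝ] V :=
  open Classical in
  if h : Function.Bijective (Φ : V →ₗ[ℝ] Module.Dual ℝ V) then
    ((LinearEquiv.ofBijective (Φ : V →ₗ[ℝ] Module.Dual ℝ V) h).symm :
      Module.Dual ℝ V →ₗ[ℝ] V)
  else 0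

/-- The inverse of a non-degenerate bilinear form `Φ` on `V`, as a bilinear form on `V*`. -/
def inverseForm {V : Type*} [AddCommGroup V] [Module ℝ V] (Φ : LinearMap.BilinForm ℝ V) :
    LinearMap.BilinForm ℝ (Module.Dual ℝ V) :=
  LinearMap.mk₂ ℝ (fun α β => α (sharp Φ β))
    (fun _ _ _ => by simp) (fun _ _ _ => by simp) (fun _ _ _ => by simp) (fun _ _ _ => by simp)

/-- The bilinear form `a σ₁ σ₂ + σ₁ m(ν₂) + σ₂ m(ν₁) + p(ν₁, ν₂)` on pairs `(ν, σ)`. -/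
def slotForm {V : Type*} [AddCommGroup V] [Module ℝ V] (a : ℝ) (m : Module.Dual ℝ V)
    (p : LinearMap.BilinForm ℝ V) : LinearMap.BilinForm ℝ (V × ℝ) :=
  LinearMap.mk₂ ℝ
    (fun s t => a * s.2 * t.2 + s.2 * m t.1 + t.2 * m s.1 + p s.1 t.1)
    (fun _ _ _ => by simp; ring) (fun _ _ _ => by simp; ring)
    (fun _ _ _ => by simp; ring) (fun _ _ _ => by simp; ring)

section Manifold

/-! Throughout, `M` is a smooth manifold with boundary of dimension `n + 1` (the manifold `M̄`);
its interior is `(𝓡∂ (n + 1)).interior M` and its boundary is `(𝓡∂ (n + 1)).boundary M`. -/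

variable {n : ℕ} {M : Type*} [TopologicalSpace M] [ChartedSpace (EuclideanHalfSpace (n + 1)) M]

/-- The tangent space of `M` at `x`. -/
abbrev Tan (n : ℕ) {M : Type*} [TopologicalSpace M] [ChartedSpace (EuclideanHalfSpace (n + 1)) M]
    (x : M) : Type :=
  TangentSpace (𝓡∂ (n + 1)) x

/-- Bases of the tangent space at `x`. -/
abbrev Frame (n : ℕ) {M : Type*} [TopologicalSpace M]
    [ChartedSpace (EuclideanHalfSpace (n + 1)) M] (x : M) : Type :=
  Module.Basis (Fin (n + 1)) ℝ (Tan n x)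

/-- The differential of a function at `x`, as a covector. -/
def differential (f : M → ℝ) (x : M) : Module.Dual ℝ (Tan n x) :=
  (mvfderiv (𝓡∂ (n + 1)) f x : Tan n x →L[ℝ] ℝ).toLinearMap

/-- `b` is a smooth frame of the tangent bundle over `W`. -/
def IsSmoothFrameOn [IsManifold (𝓡∂ (n + 1)) ∞ M] (b : ∀ x : M, Frame n x) (W : Set M) : Prop :=
  ∀ i, ContMDiffOn (𝓡∂ (n + 1)) (𝓡∂ (n + 1)).tangent ∞
    (fun x => (⟨x, b x i⟩ : TangentBundle (𝓡∂ (n + 1)) M)) W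

/-- A vector field is smooth on `W`. -/
def SmoothVectorOn [IsManifold (𝓡∂ (n + 1)) ∞ M] (X : ∀ x : M, Tan n x) (W : Set M) : Prop :=
  ContMDiffOn (𝓡∂ (n + 1)) (𝓡∂ (n + 1)).tangent ∞
    (fun x => (⟨x, X x⟩ : TangentBundle (𝓡∂ (n + 1)) M)) W

/-- A field of bilinear forms on the tangent spaces is smooth on `W`: its components in smooth
local frames are smooth. -/
def SmoothBilinOn [IsManifold (𝓡∂ (n + 1)) ∞ M]
    (h : ∀ x : M, LinearMap.BilinForm ℝ (Tan n x)) (W : Set M) : Prop :=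
  ∀ W' ⊆ W, IsOpen W' → ∀ b : ∀ x : M, Frame n x, IsSmoothFrameOn b W' → ∀ i j,
    ContMDiffOn (𝓡∂ (n + 1)) 𝓘(ℝ, ℝ) ∞ (fun x => h x (b x i) (b x j)) W'

/-- A field of bilinear forms on the cotangent spaces, i.e. a tensor field `Z^{ab}`, is smooth on
`W`: its components in smooth local frames are smooth. -/
def SmoothBivectorOn [IsManifold (𝓡∂ (n + 1)) ∞ M]
    (Z : ∀ x : M, LinearMap.BilinForm ℝ (Module.Dual ℝ (Tan n x))) (W : Set M) : Prop :=
  ∀ W' ⊆ W, IsOpen W' → ∀ b : ∀ x : M, Frame n x, IsSmoothFrameOn b W' → ∀ i j,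
    ContMDiffOn (𝓡∂ (n + 1)) 𝓘(ℝ, ℝ) ∞ (fun x => Z x ((b x).coord i) ((b x).coord j)) W'

/-- The coordinate frame of the preferred chart at `x₀`, evaluated at `y` (an arbitrary basis if
`y` is not in the domain of that chart). -/
def coordFrame [IsManifold (𝓡∂ (n + 1)) ∞ M] (x₀ y : M) : Frame n y :=
  open Classical in
  if hy : y ∈ (trivializationAt (EuclideanSpace ℝ (Fin (n + 1)))
      (TangentSpace (𝓡∂ (n + 1)) : M → Type _) x₀).baseSet then
    (trivializationAt (EuclideanSpace ℝ (Fin (n + 1)))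
      (TangentSpace (𝓡∂ (n + 1)) : M → Type _) x₀).basisAt
      (EuclideanSpace.basisFun (Fin (n + 1)) ℝ).toBasis hy
  else ((EuclideanSpace.basisFun (Fin (n + 1)) ℝ).toBasis : Module.Basis (Fin (n + 1)) ℝ
    (EuclideanSpace ℝ (Fin (n + 1))))

/-! ### Densities -/

/-- The fibre at `x` of the bundle `E(w)` of densities of projective weight `w`: functions on
bases of the tangent space with `φ(b') = |det_b b'|^{-w/(n+2)} φ(b)`, so that volume densities
have weight `-(n+2)`. -/
def Dens (n : ℕ) {M : Type*} [TopologicalSpace M] [ChartedSpace (EuclideanHalfSpace (n + 1)) M]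
    (w : ℝ) (x : M) : Submodule ℝ (Frame n x → ℝ) where
  carrier := {φ | ∀ b b' : Frame n x, φ b' = |b.det b'| ^ (-w / (n + 2)) * φ b}
  add_mem' := by
    intro φ ψ h₁ h₂ b b'
    simp only [Pi.add_apply, h₁ b b', h₂ b b']
    ring
  zero_mem' := by
    intro b b'
    simp
  smul_mem' := by
    intro c φ h b b'
    simp only [Pi.smul_apply, smul_eq_mul, h b b']
    ring

theorem abs_det_mul {x : M} (b₀ b b' : Frame n x) :
    |b₀.det b'| = |b.det b'| * |b₀.det b| := by
  rw [← abs_mul]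
  congr 1
  rw [Module.Basis.det_apply, Module.Basis.det_apply, Module.Basis.det_apply,
    ← Module.Basis.toMatrix_mul_toMatrix b₀ b b', Matrix.det_mul, mul_comm]

/-- The density of weight `w` at `x` with value `c` on the basis `b₀`. -/
def Dens.mk {x : M} (w : ℝ) (b₀ : Frame n x) (c : ℝ) : Dens n w x :=
  ⟨fun b => |b₀.det b| ^ (-w / (n + 2)) * c, by
    intro b b'
    beta_reduce
    rw [abs_det_mul b₀ b b', Real.mul_rpow (abs_nonneg _) (abs_nonneg _)]
    ring⟩

/-- A section of `E(w)` is smooth on `W`: its values on smooth local frames are smooth. -/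
def SmoothDensOn [IsManifold (𝓡∂ (n + 1)) ∞ M] {w : ℝ} (τ : ∀ x : M, Dens n w x) (W : Set M) :
    Prop :=
  ∀ W' ⊆ W, IsOpen W' → ∀ b : ∀ x : M, Frame n x, IsSmoothFrameOn b W' →
    ContMDiffOn (𝓡∂ (n + 1)) 𝓘(ℝ, ℝ) ∞ (fun x => (τ x).1 (b x)) W'

/-! ### Affine connections, Schouten tensor, projective classes -/

/-- Operators on vector fields; `D Y x v` stands for `(∇_v Y)(x)`. -/
abbrev ConnOp (n : ℕ) (M : Type*) [TopologicalSpace M]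
    [ChartedSpace (EuclideanHalfSpace (n + 1)) M] : Type _ :=
  (∀ x : M, Tan n x) → ∀ x : M, Tan n x →L[ℝ] Tan n x

/-- `D` is a smooth torsion-free linear connection on the tangent bundle over the open set `W`. -/
structure IsAffineConnectionOn [IsManifold (𝓡∂ (n + 1)) ∞ M] (D : ConnOp n M) (W : Set M) :
    Prop where
  isCov : IsCovariantDerivativeOn (I := 𝓡∂ (n + 1))
    (V := (TangentSpace (𝓡∂ (n + 1)) : M → Type _)) (EuclideanSpace ℝ (Fin (n + 1))) D W
  smooth : ∀ W' ⊆ W, IsOpen W' → ContMDiffCovariantDerivativeOn (I := 𝓡∂ (n + 1))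
    (V := (TangentSpace (𝓡∂ (n + 1)) : M → Type _)) (EuclideanSpace ℝ (Fin (n + 1))) ∞ D W'
  torsionFree : ∀ x ∈ W, ∀ X Y : ∀ x : M, Tan n x,
    MDifferentiableAt (𝓡∂ (n + 1)) (𝓡∂ (n + 1)).tangent
      (fun y => (⟨y, X y⟩ : TangentBundle (𝓡∂ (n + 1)) M)) x →
    MDifferentiableAt (𝓡∂ (n + 1)) (𝓡∂ (n + 1)).tangent
      (fun y => (⟨y, Y y⟩ : TangentBundle (𝓡∂ (n + 1)) M)) x →
    D Y x (X x) - D X x (Y x) = VectorField.mlieBracket (𝓡∂ (n + 1)) X Y x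

/-- The relation `D' = D + Υ` at the point `x`:
`D'_v X = D_v X + Υ(v) X + Υ(X) v` for all vector fields `X` and `v` in the tangent space. -/
def ProjRelAt [IsManifold (𝓡∂ (n + 1)) ∞ M] (D D' : ConnOp n M) (x : M)
    (Υ : Module.Dual ℝ (Tan n x)) : Prop :=
  ∀ X : ∀ x : M, Tan n x,
    MDifferentiableAt (𝓡∂ (n + 1)) (𝓡∂ (n + 1)).tangent
      (fun y => (⟨y, X y⟩ : TangentBundle (𝓡∂ (n + 1)) M)) x →
    ∀ v : Tan n x, D' X x v = D X x v + Υ v • X x + Υ (X x) • v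

/-- The curvature `R(X, Y) Z = ∇_X ∇_Y Z - ∇_Y ∇_X Z - ∇_{[X,Y]} Z` at `x`. -/
def curvature (D : ConnOp n M) (X Y Z : ∀ x : M, Tan n x) (x : M) : Tan n x :=
  D (fun y => D Z y (Y y)) x (X x) - D (fun y => D Z y (X y)) x (Y x)
    - D Z x (VectorField.mlieBracket (𝓡∂ (n + 1)) X Y x)

/-- Components of the Ricci tensor `Ric(Y, Z) = tr (X ↦ R(X, Y) Z)` in coordinates around `x`. -/
def ricciComp [IsManifold (𝓡∂ (n + 1)) ∞ M] (D : ConnOp n M) (x : M) (j k : Fin (n + 1)) : ℝ :=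
  ∑ i, (coordFrame x x).repr
    (curvature D (fun y => coordFrame x y i) (fun y => coordFrame x y j)
      (fun y => coordFrame x y k) x) i

/-- The projective Schouten tensor `P` in dimension `n + 1`, determined by
`Ric_{ab} = (n + 1) P_{ab} - P_{ba}`, i.e. `n (n + 2) P_{ab} = (n + 1) Ric_{ab} + Ric_{ba}`. -/
def schouten [IsManifold (𝓡∂ (n + 1)) ∞ M] (D : ConnOp n M) (x : M) :
    LinearMap.BilinForm ℝ (Tan n x) :=
  Matrix.toLinearMap₂ (coordFrame x x) (coordFrame x x) (Matrix.of fun j k =>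
    ((n + 1) * ricciComp D x j k + ricciComp D x k j) / ((n : ℝ) * (n + 2)))

/-- The bilinear form `(∇ df)(u, v) = (∇_u df)(v)` for a function `f`. -/
def hessian [IsManifold (𝓡∂ (n + 1)) ∞ M] (D : ConnOp n M) (f : M → ℝ) (x : M) :
    LinearMap.BilinForm ℝ (Tan n x) :=
  Matrix.toLinearMap₂ (coordFrame x x) (coordFrame x x) (Matrix.of fun j k =>
    differential (fun y => differential f y (coordFrame x y k)) x (coordFrame x x j)
      - differential f x (D (fun y => coordFrame x y k) x (coordFrame x x j)))

/-- The covariant derivative `v ↦ ∇_v τ` of a density of weight `w`, evaluated on the coordinate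
basis at `x`. For the coordinate frame `e` around `x` one has
`(∇_v τ)(e) = v · τ(e) + w/(n+2) tr(ω(v)) τ(e)`, where `∇_v e_i = ∑_j ω(v)^j_i e_j`. -/
def covDens [IsManifold (𝓡∂ (n + 1)) ∞ M] (D : ConnOp n M) {w : ℝ} (τ : ∀ x : M, Dens n w x)
    (x : M) : Module.Dual ℝ (Tan n x) :=
  differential (fun y => (τ y).1 (coordFrame x y)) x
    + (w / (n + 2) * (τ x).1 (coordFrame x x)) •
      ∑ i, (coordFrame x x).coord i ∘ₗ (D (fun y => coordFrame x y i) x).toLinearMap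

/-- The density `y ↦ (∇_Y τ)(y)`. -/
def covDensField [IsManifold (𝓡∂ (n + 1)) ∞ M] (D : ConnOp n M) {w : ℝ}
    (τ : ∀ x : M, Dens n w x) (Y : ∀ x : M, Tan n x) (y : M) : Dens n w y :=
  Dens.mk w (coordFrame y y) (covDens D τ y (Y y))

/-- The second covariant derivative `∇_a ∇_b τ` of a density, evaluated on the coordinate basis
at `x`: `(u, v) ↦ ∇_u (∇_Y τ) - ∇_{∇_u Y} τ` for a vector field `Y` with value `v` at `x`. -/
def hessDens [IsManifold (𝓡∂ (n + 1)) ∞ M] (D : ConnOp n M) {w : ℝ} (τ : ∀ x : M, Dens n w x)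
    (x : M) : LinearMap.BilinForm ℝ (Tan n x) :=
  Matrix.toLinearMap₂ (coordFrame x x) (coordFrame x x) (Matrix.of fun j k =>
    covDens D (covDensField D τ (fun y => coordFrame x y k)) x (coordFrame x x j)
      - covDens D τ x (D (fun y => coordFrame x y k) x (coordFrame x x j)))

/-- `τ` is a smooth nowhere vanishing section of `E(w)` over `W` which is parallel for `D`. -/
def IsParallelScaleOn [IsManifold (𝓡∂ (n + 1)) ∞ M] (D : ConnOp n M) {w : ℝ}
    (τ : ∀ x : M, Dens n w x) (W : Set M) : Prop :=
  SmoothDensOn τ W ∧ ∀ x ∈ W, τ x ≠ 0 ∧ covDens D τ x = 0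

/-- A connection on the interior is special if it preserves a volume density. -/
def IsSpecial [IsManifold (𝓡∂ (n + 1)) ∞ M] (D : ConnOp n M) : Prop :=
  ∃ μ : ∀ x : M, Dens n (-(n + 2 : ℝ)) x, IsParallelScaleOn D μ ((𝓡∂ (n + 1)).interior M)

/-! ### Projective compactness -/

/-- `ρ : U → [0, ∞)` is a local defining function for the boundary. -/
structure IsLocalDefiningFunction (n : ℕ) {M : Type*} [TopologicalSpace M]
    [ChartedSpace (EuclideanHalfSpace (n + 1)) M] [IsManifold (𝓡∂ (n + 1)) ∞ M] (ρ : M → ℝ) (U : Set M) :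
    Prop where
  isOpen : IsOpen U
  smooth : ContMDiffOn (𝓡∂ (n + 1)) 𝓘(ℝ, ℝ) ∞ ρ U
  nonneg : ∀ x ∈ U, 0 ≤ ρ x
  zero_iff : ∀ x ∈ U, ρ x = 0 ↔ x ∈ (𝓡∂ (n + 1)).boundary M
  differential_ne : ∀ x ∈ U, x ∈ (𝓡∂ (n + 1)).boundary M → differential (n := n) ρ x ≠ 0

/-- `D` is a smooth connection on `U` which on the interior part of `U` coincides with
`∇ + dρ / (α ρ)`. -/
def IsExtension [IsManifold (𝓡∂ (n + 1)) ∞ M] (nabla : ConnOp n M) (α : ℝ) (ρ : M → ℝ)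
    (U : Set M) (D : ConnOp n M) : Prop :=
  IsAffineConnectionOn D U ∧ ∀ x ∈ U ∩ (𝓡∂ (n + 1)).interior M,
    ProjRelAt nabla D x ((α * ρ x)⁻¹ • differential ρ x)

/-- Projective compactness of order `α` of a connection on the interior. -/
def IsProjectivelyCompact [IsManifold (𝓡∂ (n + 1)) ∞ M] (nabla : ConnOp n M) (α : ℝ) : Prop :=
  ∀ x ∈ (𝓡∂ (n + 1)).boundary M, ∃ (U : Set M) (ρ : M → ℝ), x ∈ U ∧
    IsLocalDefiningFunction n ρ U ∧ ∃ D : ConnOp n M, IsExtension nabla α ρ U D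

/-- `D` is, near `x`, a connection which is smooth up to the boundary and belongs to the
projective class of `∇` (extended to the manifold with boundary). -/
def InProjClass [IsManifold (𝓡∂ (n + 1)) ∞ M] (nabla : ConnOp n M) (x : M) (D : ConnOp n M) :
    Prop :=
  ∃ W : Set M, IsOpen W ∧ x ∈ W ∧ IsAffineConnectionOn D W ∧
    ∀ y ∈ W ∩ (𝓡∂ (n + 1)).interior M, ∃ Υ, ProjRelAt nabla D y Υ

/-- The connections in the projective class near `x`; each determines a splitting of the tractor
bundles at `x`. -/
abbrev Splitting [IsManifold (𝓡∂ (n + 1)) ∞ M] (nabla : ConnOp n M) (x : M) : Type _ :=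
  {D : ConnOp n M // InProjClass nabla x D}

theorem IsExtension.inProjClass [IsManifold (𝓡∂ (n + 1)) ∞ M] {nabla D : ConnOp n M} {α : ℝ}
    {ρ : M → ℝ} {U : Set M} (h : IsExtension nabla α ρ U D) (hU : IsOpen U) {x : M}
    (hx : x ∈ U) : InProjClass nabla x D :=
  ⟨U, hU, hx, h.1, fun y hy => ⟨_, h.2 y hy⟩⟩

/-- The boundary geometry is non-degenerate: every representative `D dρ` of the projective second
fundamental form is non-degenerate on each tangent space `ker dρ` of the boundary. -/
def HasNondegenerateBoundary [IsManifold (𝓡∂ (n + 1)) ∞ M] (nabla : ConnOp n M) : Prop :=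
  ∀ x ∈ (𝓡∂ (n + 1)).boundary M, ∀ (U : Set M) (ρ : M → ℝ), x ∈ U →
    IsLocalDefiningFunction n ρ U → ∀ D : ConnOp n M, InProjClass nabla x D →
      ((hessian D ρ x).restrict (LinearMap.ker (differential ρ x))).Nondegenerate

/-! ### Tractors -/

/-- The fibre at `x` of the standard tractor bundle `T = E(-1) ⨭ E^a(-1)` of the projective class.
A tractor assigns to each connection in the class a pair `(ν, σ)` in `E^a(-1) ⊕ E(-1)` (given by
its values on bases of the tangent space), such that `ν` does not change and `σ` changes to
`σ - Υ(ν)` when the connection is changed by `Υ`. -/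
def Tractor [IsManifold (𝓡∂ (n + 1)) ∞ M] (nabla : ConnOp n M) (x : M) :
    Submodule ℝ (Splitting nabla x → Frame n x → Tan n x × ℝ) where
  carrier := {t |
    (∀ D b b', t D b' = |b.det b'| ^ (1 / ((n : ℝ) + 2)) • t D b) ∧
    (∀ D D' Υ, ProjRelAt D.1 D'.1 x Υ → ∀ b,
      t D' b = ((t D b).1, (t D b).2 - Υ (t D b).1))}
  add_mem' := by
    rintro s t ⟨hs₁, hs₂⟩ ⟨ht₁, ht₂⟩
    refine ⟨fun D b b' => ?_, fun D D' Υ h b => ?_⟩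
    · simp only [Pi.add_apply, hs₁ D b b', ht₁ D b b', smul_add]
    · simp only [Pi.add_apply, hs₂ D D' Υ h b, ht₂ D D' Υ h b]
      ext
      · simp
      · simp
        ring
  zero_mem' := by
    refine ⟨fun D b b' => ?_, fun D D' Υ h b => ?_⟩
    · simp
    · simp only [Pi.zero_apply]
      ext <;> simp
  smul_mem' := by
    rintro c t ⟨ht₁, ht₂⟩
    refine ⟨fun D b b' => ?_, fun D D' Υ h b => ?_⟩
    · simp only [Pi.smul_apply, ht₁ D b b']
      rw [smul_comm]
    · simp only [Pi.smul_apply, ht₂ D D' Υ h b]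
      ext
      · simp
      · simp
        ring

/-- The components `(ν, σ)` of a tractor in the splitting given by `D`, evaluated on `b`. -/
def Tractor.split [IsManifold (𝓡∂ (n + 1)) ∞ M] {nabla : ConnOp n M} {x : M}
    (D : Splitting nabla x) (b : Frame n x) : Tractor nabla x →ₗ[ℝ] Tan n x × ℝ where
  toFun t := t.1 D b
  map_add' _ _ := rfl
  map_smul' _ _ := rfl

/-- The cotractor `(ν, σ) ↦ β σ + μ(ν)` whose slots in the splitting given by `D`, evaluated on
`b`, are `β` in `E(1)` and `μ` in `E_a(1)`. -/
def cotractor [IsManifold (𝓡∂ (n + 1)) ∞ M] {nabla : ConnOp n M} {x : M}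
    (D : Splitting nabla x) (b : Frame n x) (β : ℝ) (μ : Module.Dual ℝ (Tan n x)) :
    Module.Dual ℝ (Tractor nabla x) :=
  (β • LinearMap.snd ℝ (Tan n x) ℝ + μ ∘ₗ LinearMap.fst ℝ (Tan n x) ℝ) ∘ₗ Tractor.split D b

/-- In the splitting given by `D`, the element `Ψ` of `S²T` (a bilinear form on cotractors) has
the slots `Z` in `E^{ab}(-2)`, `l` in `E^a(-2)` and `k` in `E(-2)` (evaluated on `b`). -/
def HasSlots [IsManifold (𝓡∂ (n + 1)) ∞ M] {nabla : ConnOp n M} {x : M}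
    (Ψ : LinearMap.BilinForm ℝ (Module.Dual ℝ (Tractor nabla x)))
    (D : Splitting nabla x) (b : Frame n x)
    (Z : LinearMap.BilinForm ℝ (Module.Dual ℝ (Tan n x))) (l : Tan n x) (k : ℝ) : Prop :=
  ∀ (β₁ β₂ : ℝ) (μ₁ μ₂ : Module.Dual ℝ (Tan n x)),
    Ψ (cotractor D b β₁ μ₁) (cotractor D b β₂ μ₂) =
      Z μ₁ μ₂ + (β₂ * μ₁ l + β₁ * μ₂ l) + k * β₁ * β₂

/-- The value at `x` of the splitting operator on a density `τ` of weight `2`, computed in the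
splitting given by `D`: the element of `S²T*` with slots
`τ`, `½ ∇_a τ`, `½ ∇_a ∇_b τ + P_{ab} τ`. -/
def splittingOp [IsManifold (𝓡∂ (n + 1)) ∞ M] {nabla : ConnOp n M} {x : M}
    (D : Splitting nabla x) (τ : ∀ x : M, Dens n 2 x) :
    LinearMap.BilinForm ℝ (Tractor nabla x) :=
  (slotForm ((τ x).1 (coordFrame x x)) ((1 / 2 : ℝ) • covDens D.1 τ x)
    ((1 / 2 : ℝ) • hessDens D.1 τ x + (τ x).1 (coordFrame x x) • schouten D.1 x)).compl₁₂
      (Tractor.split D (coordFrame x x)) (Tractor.split D (coordFrame x x))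

/-- The value `L(τ)` at `x` of the splitting operator, computed in the splitting given by some
connection in the projective class. -/
def tractorMetric [IsManifold (𝓡∂ (n + 1)) ∞ M] (nabla : ConnOp n M)
    (τ : ∀ x : M, Dens n 2 x) (x : M) : LinearMap.BilinForm ℝ (Tractor nabla x) :=
  open Classical in
  if h : Nonempty (Splitting nabla x) then splittingOp h.some τ else 0

/-- The points of `U` in which the tractor metric `L(τ)` is non-degenerate. -/
def nondegLocus [IsManifold (𝓡∂ (n + 1)) ∞ M] (nabla : ConnOp n M)
    (τ : ∀ x : M, Dens n 2 x) (U : Set M) : Set M :=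
  {x ∈ U | (tractorMetric nabla τ x).Nondegenerate}

end Manifold

end ProjCompact

end

open ProjCompact

namespace ProjCompact

set_option linter.unusedSectionVars false

/-! ### Calculus on compact convex sets -/

section ConvexCalculus

open MeasureTheory

variable {E F : Type} [NormedAddCommGroup E] [NormedSpace ℝ E] [NormedAddCommGroup F]
  [NormedSpace ℝ F]

/-! Let `D` be the smooth extension of ∇ + dρ/(2ρ). Order 2 and weight 2 match: since τ is
∇-parallel, τ̂ = τ/ρ is `D`-parallel in the interior. In a coordinate frame this is a linear
equation for τ̂ whose coefficients are traces of `D`, hence smooth up to the boundary, so τ̂ extends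
smoothly and without zeros (`exists_extended_density`). In the splitting of `D`, L(τ) is then τ̂
times a real-valued form F with slots ρ, ½dρ, ½ D dρ + ρ P^D (`metricForm`, `tractorMetric_eq`). F
is smooth on all of U, and the whole statement is read off from it.

In the interior the splitting of ∇ makes L(τ) diagonal, with slots τ, 0, τP. Comparing the two
splittings shows that the trailing slot of F is ρP + dρ⊗dρ/(4ρ) (`trailingSlot_interior`), so that F
is a completed square (`slotForm_complete_square`). Hence P is non-degenerate wherever F is, and F⁻¹
is explicit there (`slotZ_eq`, `slotT_eq`). On the boundary F has slots 0, ½dρ, ½ D dρ, and it is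
non-degenerate because D dρ is so on ker dρ (`metricForm_nondegenerate_of_boundary`). The matrix of
F is smooth in smooth frames, so V is open and the slots Z, 2t, ψ of F⁻¹ are smooth on V; they are
the required extensions. The three identities say that F and F⁻¹ are mutually inverse, written in
slots (`slotT_apply`, `slotT_contract`, `slotZ_contract`). They also use that F is symmetric, which
holds because `D` preserves τ̂ and so has symmetric Ricci tensor (`ricciComp_symm_of_parallel`).

Two inputs are analytic. By Hadamard's lemma on half balls two defining functions differ by a smooth
positive factor u, and changing ρ' to uρ' changes the connection by the smooth form du/(2u); this
gives `D` for the given ρ (`exists_isExtension`). A function whose logarithmic derivative is smooth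
up to the boundary extends smoothly (`exists_contDiffOn_extension_of_logDeriv`). The remaining input
is the classical behaviour of the Schouten tensor and of densities under projective change
(`schouten_of_projRelAt`, `hessDens_eq_of_projRelAt`), which makes L(τ) independent of the
splitting. Identities at the boundary come from the interior by density and continuity
(`eqOn_of_eqOn_interior`). -/

theorem closure_interior_eq_of_compact_convex {S : Set E} (hS : IsCompact S) (hc : Convex ℝ S)
    (hi : (interior S).Nonempty) : closure (interior S) = S := by
  rw [hc.closure_interior_eq_closure_of_nonempty_interior hi, hS.isClosed.closure_eq]

/-- Differentiation under the integral sign, up to the boundary of a compact convex set. -/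
theorem hasFDerivWithinAt_integral_Icc [CompleteSpace F] {S : Set E} (hS : IsCompact S)
    (hc : Convex ℝ S) {Φ : ℝ × E → F} {Φ' : ℝ × E → E →L[ℝ] F}
    (hΦ : ContinuousOn Φ (Icc 0 1 ×ˢ S)) (hΦ' : ContinuousOn Φ' (Icc 0 1 ×ˢ S))
    (h : ∀ t ∈ Icc (0 : ℝ) 1, ∀ x ∈ S, HasFDerivWithinAt (fun y => Φ (t, y)) (Φ' (t, x)) S x)
    {x : E} (hx : x ∈ S) :
    HasFDerivWithinAt (fun y => ∫ t in (0 : ℝ)..1, Φ (t, y)) (∫ t in (0 : ℝ)..1, Φ' (t, x)) S x := by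
  have hK : IsCompact (Icc (0 : ℝ) 1 ×ˢ S) := isCompact_Icc.prod hS
  have hu := hK.uniformContinuousOn_of_continuous hΦ'
  have sliceI : ∀ y ∈ S, IntervalIntegrable (fun t => Φ (t, y)) volume 0 1 := by
    intro y hy
    apply ContinuousOn.intervalIntegrable
    rw [uIcc_of_le zero_le_one]
    exact hΦ.comp (by fun_prop) (fun t ht => ⟨ht, hy⟩)
  have slice'I : IntervalIntegrable (fun t => Φ' (t, x)) volume 0 1 := by
    apply ContinuousOn.intervalIntegrable
    rw [uIcc_of_le zero_le_one]
    exact hΦ'.comp (by fun_prop) (fun t ht => ⟨ht, hx⟩)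
  rw [hasFDerivWithinAt_iff_isLittleO, Asymptotics.isLittleO_iff]
  intro ε hε
  -- Compactness makes `δ` independent of `t`, so the mean value inequality on the convex set `S ∩
  -- ball x δ` bounds the remainder uniformly and can be integrated.
  obtain ⟨δ, hδ, hδ'⟩ := Metric.uniformContinuousOn_iff.1 hu ε hε
  filter_upwards [self_mem_nhdsWithin, mem_nhdsWithin_of_mem_nhds (Metric.ball_mem_nhds x hδ)]
    with y hyS hyb
  have hkey : ∀ t ∈ Icc (0 : ℝ) 1, ‖Φ (t, y) - Φ (t, x) - Φ' (t, x) (y - x)‖ ≤ ε * ‖y - x‖ := by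
    intro t ht
    refine Convex.norm_image_sub_le_of_norm_hasFDerivWithin_le' (s := S ∩ Metric.ball x δ)
      (f := fun y => Φ (t, y)) (f' := fun z => Φ' (t, z)) ?_ ?_ (hc.inter (convex_ball x δ))
      ⟨hx, Metric.mem_ball_self hδ⟩ ⟨hyS, hyb⟩
    · intro z hz
      exact (h t ht z hz.1).mono inter_subset_left
    · intro z hz
      rw [← dist_eq_norm]
      refine (hδ' (t, z) ⟨ht, hz.1⟩ (t, x) ⟨ht, hx⟩ ?_).le
      rw [Prod.dist_eq]
      simpa [hδ] using hz.2
  have e : (∫ t in (0 : ℝ)..1, Φ (t, y)) - (∫ t in (0 : ℝ)..1, Φ (t, x))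
      - (∫ t in (0 : ℝ)..1, Φ' (t, x)) (y - x)
      = ∫ t in (0 : ℝ)..1, (Φ (t, y) - Φ (t, x) - Φ' (t, x) (y - x)) := by
    rw [ContinuousLinearMap.intervalIntegral_apply slice'I, intervalIntegral.integral_sub,
      intervalIntegral.integral_sub (sliceI y hyS) (sliceI x hx)]
    · exact (sliceI y hyS).sub (sliceI x hx)
    · apply ContinuousOn.intervalIntegrable
      rw [uIcc_of_le zero_le_one]
      exact (hΦ'.comp (by fun_prop) (fun t ht => ⟨ht, hx⟩)).clm_apply continuousOn_const
  rw [e]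
  have := intervalIntegral.norm_integral_le_of_norm_le_const (a := (0 : ℝ)) (b := 1)
    (f := fun t => Φ (t, y) - Φ (t, x) - Φ' (t, x) (y - x)) (C := ε * ‖y - x‖) (by
      intro t ht
      rw [uIoc_of_le zero_le_one] at ht
      exact hkey t ⟨ht.1.le, ht.2⟩)
  simpa using this

/-- Each derivative in `x` is again an integral of the same kind, with values in `E →L[ℝ] F`; hence
the target space is quantified inside the induction on `k`. Convexity with non-empty interior gives
unique derivatives on `S`, boundary included. -/
theorem contDiffOn_integral_Icc_nat {S : Set E} (hS : IsCompact S) (hc : Convex ℝ S)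
    (hi : (interior S).Nonempty) (k : ℕ) :
    ∀ {F : Type} [NormedAddCommGroup F] [NormedSpace ℝ F] [CompleteSpace F] {Φ : ℝ × E → F},
      ContDiffOn ℝ ∞ Φ (Icc 0 1 ×ˢ S) →
      ContDiffOn ℝ k (fun x => ∫ t in (0 : ℝ)..1, Φ (t, x)) S := by
  have hud : UniqueDiffOn ℝ S := uniqueDiffOn_convex hc hi
  have hud' : UniqueDiffOn ℝ (Icc (0 : ℝ) 1 ×ˢ S) := (uniqueDiffOn_Icc zero_lt_one).prod hud
  have key : ∀ {F : Type} [NormedAddCommGroup F] [NormedSpace ℝ F] [CompleteSpace F]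
      {Φ : ℝ × E → F}, ContDiffOn ℝ ∞ Φ (Icc 0 1 ×ˢ S) →
      ∃ Φ' : ℝ × E → E →L[ℝ] F, ContDiffOn ℝ ∞ Φ' (Icc 0 1 ×ˢ S) ∧ ∀ x ∈ S,
        HasFDerivWithinAt (fun y => ∫ t in (0 : ℝ)..1, Φ (t, y))
          (∫ t in (0 : ℝ)..1, Φ' (t, x)) S x := by
    intro F _ _ _ Φ hΦ
    refine ⟨fun p => (fderivWithin ℝ Φ (Icc 0 1 ×ˢ S) p).comp (ContinuousLinearMap.inr ℝ ℝ E),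
      ?_, ?_⟩
    · have := hΦ.fderivWithin hud' (m := ∞) (by simp)
      exact this.clm_comp contDiffOn_const
    · intro x hx
      refine hasFDerivWithinAt_integral_Icc (Φ' := fun p =>
        (fderivWithin ℝ Φ (Icc 0 1 ×ˢ S) p).comp (ContinuousLinearMap.inr ℝ ℝ E))
        hS hc hΦ.continuousOn ?_ ?_ hx
      · exact ((hΦ.fderivWithin hud' (m := ∞) (by simp)).clm_comp contDiffOn_const).continuousOn
      · intro t ht y hy
        have h1 := (hΦ.differentiableOn (by simp) (t, y) ⟨ht, hy⟩).hasFDerivWithinAt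
        have h2 : HasFDerivWithinAt (fun z : E => (t, z)) (ContinuousLinearMap.inr ℝ ℝ E) S y :=
          (hasFDerivWithinAt_const t y S).prodMk (hasFDerivWithinAt_id y S)
        exact h1.comp y h2 (fun z hz => ⟨ht, hz⟩)
  induction k with
  | zero =>
    intro F _ _ _ Φ hΦ
    obtain ⟨Φ', -, h⟩ := key hΦ
    exact contDiffOn_zero.2 (fun x hx => (h x hx).continuousWithinAt)
  | succ k ih =>
    intro F _ _ _ Φ hΦ
    obtain ⟨Φ', hΦ', h⟩ := key hΦ
    push_cast
    rw [contDiffOn_succ_iff_hasFDerivWithinAt_of_uniqueDiffOn hud]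
    refine ⟨by simp, _, ih hΦ', h⟩

theorem contDiffOn_integral_Icc [CompleteSpace F] {S : Set E} (hS : IsCompact S)
    (hc : Convex ℝ S) (hi : (interior S).Nonempty) {Φ : ℝ × E → F}
    (hΦ : ContDiffOn ℝ ∞ Φ (Icc 0 1 ×ˢ S)) :
    ContDiffOn ℝ ∞ (fun x => ∫ t in (0 : ℝ)..1, Φ (t, x)) S :=
  contDiffOn_infty.2 fun k => contDiffOn_integral_Icc_nat hS hc hi k hΦ

/-- A nowhere vanishing solution `F` of `dF = F A` on the interior of a compact convex set, where
`A` is smooth up to the boundary, extends to a smooth nowhere vanishing function. -/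
theorem exists_contDiffOn_extension_of_logDeriv {S : Set E} (hS : IsCompact S) (hc : Convex ℝ S)
    (hi : (interior S).Nonempty) {f : E → ℝ} {A : E → E →L[ℝ] ℝ} (hA : ContDiffOn ℝ ∞ A S)
    (hf0 : ∀ z ∈ interior S, f z ≠ 0)
    (hf : ∀ z ∈ interior S, HasFDerivAt f (f z • A z) z) :
    ∃ g : E → ℝ, ContDiffOn ℝ ∞ g S ∧ (∀ z ∈ S, g z ≠ 0) ∧ ∀ z ∈ interior S, g z = f z := by
  have hud : UniqueDiffOn ℝ S := uniqueDiffOn_convex hc hi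
  have hcl := closure_interior_eq_of_compact_convex hS hc hi
  have hlog : ∀ z ∈ interior S, HasFDerivAt (fun z => Real.log (f z)) (A z) z := by
    intro z hz
    have := (hf z hz).log (hf0 z hz)
    rwa [smul_smul, inv_mul_cancel₀ (hf0 z hz), one_smul] at this
  -- A bound on `A` makes `log f` Lipschitz on the convex interior, which yields a continuous
  -- extension `g`; its derivative then extends to `S` because `A` is continuous there.
  obtain ⟨C, hC⟩ := hS.exists_bound_of_continuousOn hA.continuousOn
  have hC0 : ∀ z ∈ S, ‖A z‖₊ ≤ C.toNNReal := fun z hz => by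
    rw [← NNReal.coe_le_coe, coe_nnnorm]
    exact (hC z hz).trans (Real.le_coe_toNNReal C)
  have hlip : LipschitzOnWith C.toNNReal (fun z => Real.log (f z)) (interior S) :=
    hc.interior.lipschitzOnWith_of_nnnorm_hasFDerivWithin_le
      (fun z hz => (hlog z hz).hasFDerivWithinAt) (fun z hz => hC0 z (interior_subset hz))
  obtain ⟨g, hg, hgeq⟩ := hlip.extend_real
  have hgd : ∀ z ∈ interior S, HasFDerivAt g (A z) z := fun z hz =>
    (hlog z hz).congr_of_eventuallyEq
      (Filter.eventuallyEq_of_mem (isOpen_interior.mem_nhds hz) (fun y hy => (hgeq hy).symm))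
  have hgS : ∀ z ∈ S, HasFDerivWithinAt g (A z) S z := by
    intro z hz
    have := hasFDerivWithinAt_closure_of_tendsto_fderiv (f := g) (s := interior S) (x := z)
      (f' := A z) (fun y hy => (hgd y hy).differentiableAt.differentiableWithinAt)
      hc.interior isOpen_interior (fun y _ => hg.continuous.continuousWithinAt) (by
        have h1 : Filter.Tendsto A (𝓝[interior S] z) (𝓝 (A z)) :=
          (hA.continuousOn z hz).mono_left (nhdsWithin_mono _ interior_subset)
        refine h1.congr' ?_
        filter_upwards [self_mem_nhdsWithin] with y hy
        exact (hgd y hy).fderiv.symm)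
    rwa [hcl] at this
  have hgsm : ContDiffOn ℝ ∞ g S := by
    rw [← ENat.coe_top_add_one, contDiffOn_succ_iff_hasFDerivWithinAt_of_uniqueDiffOn hud]
    exact ⟨by simp, A, hA, hgS⟩
  obtain ⟨z₁, hz₁⟩ := hi
  -- `exp (g z)` only recovers `|f z|`, since `Real.log` ignores signs. The constant `f z₁ * exp (-g
  -- z₁)` restores the sign, as `f * exp (-g)` has derivative zero on the connected interior.
  refine ⟨fun z => f z₁ * Real.exp (-g z₁) * Real.exp (g z),
    contDiffOn_const.mul hgsm.exp,
    fun z _ => mul_ne_zero (mul_ne_zero (hf0 z₁ hz₁) (Real.exp_pos _).ne') (Real.exp_pos _).ne',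
    fun z hz => ?_⟩
  have hq : ∀ y ∈ interior S, HasFDerivAt (fun y => f y * Real.exp (-g y)) (0 : E →L[ℝ] ℝ) y := by
    intro y hy
    have := (hf y hy).mul ((hgd y hy).neg.exp)
    convert! this using 1
    ext v
    simp
    ring
  have hconst : f z * Real.exp (-g z) = f z₁ * Real.exp (-g z₁) :=
    isOpen_interior.is_const_of_fderiv_eq_zero hc.interior.isPreconnected
      (fun y hy => (hq y hy).differentiableAt.differentiableWithinAt)
      (fun y hy => (hq y hy).fderiv) hz hz₁
  beta_reduce
  rw [← hconst, mul_assoc, ← Real.exp_add]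
  simp

end ConvexCalculus

/-! ### Half balls and Hadamard's lemma -/

section HalfBall

variable {n : ℕ}

/-- The intersection of a closed ball with the closed half space. -/
def halfBall (z₀ : EuclideanSpace ℝ (Fin (n + 1))) (r : ℝ) : Set (EuclideanSpace ℝ (Fin (n + 1))) :=
  Metric.closedBall z₀ r ∩ {z | 0 ≤ z 0}

theorem isCompact_halfBall (z₀ : EuclideanSpace ℝ (Fin (n + 1))) (r : ℝ) :
    IsCompact (halfBall z₀ r) :=
  (isCompact_closedBall z₀ r).inter_right (isClosed_le continuous_const (by fun_prop))

theorem convex_halfBall (z₀ : EuclideanSpace ℝ (Fin (n + 1))) (r : ℝ) :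
    Convex ℝ (halfBall z₀ r) := by
  refine (convex_closedBall z₀ r).inter ?_
  intro x hx y hy a b ha hb _
  simp only [mem_ofPred_eq, PiLp.add_apply, PiLp.smul_apply, smul_eq_mul] at *
  positivity

theorem ball_inter_subset_interior_halfBall (z₀ : EuclideanSpace ℝ (Fin (n + 1))) (r : ℝ) :
    Metric.ball z₀ r ∩ {z | 0 < z 0} ⊆ interior (halfBall z₀ r) := by
  refine interior_maximal ?_ (Metric.isOpen_ball.inter (isOpen_lt continuous_const (by fun_prop)))
  rintro z ⟨h1, h2⟩
  exact ⟨Metric.ball_subset_closedBall h1, by simpa using le_of_lt h2⟩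

theorem interior_halfBall_subset (z₀ : EuclideanSpace ℝ (Fin (n + 1))) (r : ℝ) :
    interior (halfBall z₀ r) ⊆ {z | 0 < z 0} := by
  refine (interior_mono inter_subset_right).trans ?_
  rw [interior_halfSpace]

theorem interior_halfBall_nonempty {z₀ : EuclideanSpace ℝ (Fin (n + 1))} (h0 : 0 ≤ z₀ 0) {r : ℝ}
    (hr : 0 < r) : (interior (halfBall z₀ r)).Nonempty := by
  refine ⟨z₀ + (r / 2) • EuclideanSpace.single 0 (1 : ℝ),
    ball_inter_subset_interior_halfBall _ _ ⟨?_, ?_⟩⟩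
  · simp [Metric.mem_ball, dist_eq_norm, norm_smul, abs_of_pos hr, hr]
  · simp
    linarith

/-- Hadamard's lemma: a smooth function on a half ball which vanishes on the flat part of the
boundary is divisible by the normal coordinate. -/
theorem exists_contDiffOn_eq_mul_of_vanishing {z₀ : EuclideanSpace ℝ (Fin (n + 1))}
    (h0 : z₀ 0 = 0) {r : ℝ} (hr : 0 < r) {f : EuclideanSpace ℝ (Fin (n + 1)) → ℝ}
    (hf : ContDiffOn ℝ ∞ f (halfBall z₀ r)) (hf0 : ∀ z ∈ halfBall z₀ r, z 0 = 0 → f z = 0) :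
    ∃ g : EuclideanSpace ℝ (Fin (n + 1)) → ℝ, ContDiffOn ℝ ∞ g (halfBall z₀ r) ∧
      ∀ z ∈ halfBall z₀ r, f z = z 0 * g z := by
  set S := halfBall z₀ r with hSdef
  have hS := isCompact_halfBall z₀ r
  have hc := convex_halfBall z₀ r
  have hi := interior_halfBall_nonempty (h0.symm.le) hr
  have hud : UniqueDiffOn ℝ S := uniqueDiffOn_convex hc hi
  let e : EuclideanSpace ℝ (Fin (n + 1)) := EuclideanSpace.single 0 1
  -- The map `q (t, ·)` multiplies the normal coordinate by `t`: it is the projection to the flat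
  -- face for `t = 0` and the identity for `t = 1`. Integrating the `t`-derivative of `f (q (t, z))`
  -- produces the factor `z 0`.
  let q : ℝ × EuclideanSpace ℝ (Fin (n + 1)) → EuclideanSpace ℝ (Fin (n + 1)) :=
    fun p => p.2 - ((1 - p.1) * p.2 0) • e
  have hq : ContDiff ℝ ∞ q := by
    have : ContDiff ℝ ∞ (fun p : ℝ × EuclideanSpace ℝ (Fin (n + 1)) => p.2 0) :=
      (EuclideanSpace.proj (𝕜 := ℝ) (0 : Fin (n + 1))).contDiff.comp contDiff_snd
    fun_prop
  have hq0 : ∀ t z, q (t, z) 0 = t * z 0 := by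
    intro t z
    simp [q, e]
    ring
  have hqi : ∀ t z i, i ≠ 0 → q (t, z) i = z i := by
    intro t z i hi
    simp [q, e, hi]
  -- The half ball is preserved because its centre lies on the flat face, so shrinking the normal
  -- coordinate does not increase the distance to the centre.
  have hmaps : MapsTo q (Icc 0 1 ×ˢ S) S := by
    rintro ⟨t, z⟩ ⟨ht, hz⟩
    have hz0 : 0 ≤ z 0 := hz.2
    refine ⟨?_, ?_⟩
    · have hz1 : dist z z₀ ≤ r := hz.1
      refine le_trans ?_ hz1
      rw [EuclideanSpace.dist_eq, EuclideanSpace.dist_eq]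
      apply Real.sqrt_le_sqrt
      apply Finset.sum_le_sum
      intro i _
      by_cases h : i = 0
      · subst h
        rw [hq0, h0, Real.dist_eq, Real.dist_eq, sub_zero, sub_zero, sq_abs, sq_abs]
        have : t * z 0 ≤ z 0 := mul_le_of_le_one_left hz0 ht.2
        exact pow_le_pow_left₀ (mul_nonneg ht.1 hz0) this 2
      · rw [hqi t z i h]
    · show 0 ≤ q (t, z) 0
      rw [hq0]
      exact mul_nonneg ht.1 hz0
  have hf' : ContDiffOn ℝ ∞ (fderivWithin ℝ f S) S := hf.fderivWithin hud (by simp)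
  have hΦ : ContDiffOn ℝ ∞ (fun p => fderivWithin ℝ f S (q p) e) (Icc 0 1 ×ˢ S) :=
    (hf'.comp hq.contDiffOn hmaps).clm_apply contDiffOn_const
  refine ⟨_, contDiffOn_integral_Icc hS hc hi hΦ, fun z hz => ?_⟩
  have hder : ∀ t ∈ Icc (0 : ℝ) 1, HasDerivWithinAt (fun t => f (q (t, z)))
      (z 0 * fderivWithin ℝ f S (q (t, z)) e) (Icc 0 1) t := by
    intro t ht
    have h1 := (hf.differentiableOn (by simp) (q (t, z)) (hmaps ⟨ht, hz⟩)).hasFDerivWithinAt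
    have h2 : HasDerivWithinAt (fun t => q (t, z)) (z 0 • e) (Icc 0 1) t := by
      have : HasDerivAt (fun t : ℝ => q (t, z)) (z 0 • e) t := by
        have h3 : HasDerivAt (fun t : ℝ => (1 - t) * z 0) (-1 * z 0) t :=
          ((hasDerivAt_id t).const_sub 1).mul_const (z 0)
        have h4 := (h3.smul_const e).const_sub z
        convert! h4 using 1
        simp
      exact this.hasDerivWithinAt
    have h3 := h1.comp_hasDerivWithinAt t h2 (fun s hs => hmaps ⟨hs, hz⟩)
    rw [map_smul, smul_eq_mul] at h3
    exact h3
  have hint : IntervalIntegrable (fun t => z 0 * fderivWithin ℝ f S (q (t, z)) e)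
      MeasureTheory.volume 0 1 := by
    apply ContinuousOn.intervalIntegrable
    rw [uIcc_of_le zero_le_one]
    exact continuousOn_const.mul (hΦ.continuousOn.comp (by fun_prop) (fun t ht => ⟨ht, hz⟩))
  have hftc := intervalIntegral.integral_eq_sub_of_hasDerivAt_of_le zero_le_one
    (fun t ht => (hder t ht).continuousWithinAt)
    (fun t ht => (hder t ⟨ht.1.le, ht.2.le⟩).hasDerivAt (Icc_mem_nhds ht.1 ht.2)) hint
  rw [intervalIntegral.integral_const_mul] at hftc
  beta_reduce
  rw [hftc, hf0 (q (0, z)) (hmaps ⟨by simp, hz⟩) (by rw [hq0]; simp)]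
  simp [q]

end HalfBall

/-! ### Smooth functions, vector fields and frames -/

section Fields

variable {n : ℕ} {M : Type*} [TopologicalSpace M] [ChartedSpace (EuclideanHalfSpace (n + 1)) M]

/-- A real-valued function is smooth on `W`. -/
abbrev SmoothFnOn (n : ℕ) {M : Type*} [TopologicalSpace M]
    [ChartedSpace (EuclideanHalfSpace (n + 1)) M] (f : M → ℝ) (W : Set M) : Prop :=
  ContMDiffOn (𝓡∂ (n + 1)) 𝓘(ℝ, ℝ) ∞ f W

/-- A real-valued function is differentiable at `x`. -/
abbrev DiffFnAt (n : ℕ) {M : Type*} [TopologicalSpace M]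
    [ChartedSpace (EuclideanHalfSpace (n + 1)) M] (f : M → ℝ) (x : M) : Prop :=
  MDifferentiableAt (𝓡∂ (n + 1)) 𝓘(ℝ, ℝ) f x

theorem SmoothFnOn.diffFnAt {f : M → ℝ} {W : Set M} (hf : SmoothFnOn n f W) (hW : IsOpen W)
    {x : M} (hx : x ∈ W) : DiffFnAt n f x :=
  (hf.contMDiffAt (hW.mem_nhds hx)).mdifferentiableAt (by simp)

theorem differential_mul {f g : M → ℝ} {x : M} (hf : DiffFnAt n f x) (hg : DiffFnAt n g x)
    (v : Tan n x) : differential (fun y => f y * g y) x v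
      = f x * differential g x v + g x * differential f x v := by
  have := mvfderiv_mul hf hg
  have h2 := congrArg (fun L : Tan n x →L[ℝ] ℝ => L v) this
  simpa using! h2

theorem differential_add {f g : M → ℝ} {x : M} (hf : DiffFnAt n f x) (hg : DiffFnAt n g x)
    (v : Tan n x) : differential (fun y => f y + g y) x v
      = differential f x v + differential g x v := by
  have := mvfderiv_add hf hg
  have h2 := congrArg (fun L : Tan n x →L[ℝ] ℝ => L v) this
  simpa using! h2

theorem differential_const (c : ℝ) (x : M) : differential (n := n) (fun _ => c) x = 0 := by
  have := mvfderiv_const (I := 𝓡∂ (n + 1)) (M := M) c (x := x)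
  simp only [differential, this]
  rfl

theorem differential_const_mul {f : M → ℝ} {x : M} (c : ℝ) (hf : DiffFnAt n f x) (v : Tan n x) :
    differential (fun y => c * f y) x v = c * differential f x v := by
  rw [differential_mul (mdifferentiableAt_const) hf, differential_const]
  simp

theorem differential_congr {f g : M → ℝ} {x : M} (h : f =ᶠ[𝓝 x] g) :
    differential (n := n) f x = differential g x := by
  simp only [differential, mvfderiv]
  rw [Filter.EventuallyEq.mfderiv_eq h]
  rfl

theorem differential_sum {ι : Type*} (s : Finset ι) {f : ι → M → ℝ} {x : M}
    (hf : ∀ i ∈ s, DiffFnAt n (f i) x) (v : Tan n x) :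
    DiffFnAt n (fun y => ∑ i ∈ s, f i y) x ∧
    differential (fun y => ∑ i ∈ s, f i y) x v = ∑ i ∈ s, differential (f i) x v := by
  classical
  induction s using Finset.induction_on with
  | empty => simpa [differential_const] using mdifferentiableAt_const
  | insert a s ha ih =>
    obtain ⟨h1, h2⟩ := ih (fun i hi => hf i (Finset.mem_insert_of_mem hi))
    have h3 := hf a (Finset.mem_insert_self a s)
    simp only [Finset.sum_insert ha]
    exact ⟨h3.add h1, by rw [differential_add h3 h1, h2]⟩

theorem differential_comp {f : M → ℝ} {x : M} {φ : ℝ → ℝ} {φ' : ℝ} (hφ : HasDerivAt φ φ' (f x))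
    (hf : DiffFnAt n f x) (v : Tan n x) :
    differential (fun y => φ (f y)) x v = φ' * differential f x v := by
  have h1 : HasMFDerivAt 𝓘(ℝ, ℝ) 𝓘(ℝ, ℝ) φ (f x) (ContinuousLinearMap.toSpanSingleton ℝ φ') :=
    hφ.hasFDerivAt.hasMFDerivAt
  have h2 := HasMFDerivAt.comp x h1 hf.hasMFDerivAt
  have h3 := h2.mfderiv
  simp only [differential, mvfderiv]
  change (NormedSpace.fromTangentSpace _) ((mfderiv (𝓡∂ (n + 1)) 𝓘(ℝ, ℝ) (φ ∘ f) x) v) = _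
  rw [h3]
  exact mul_comm (NormedSpace.fromTangentSpace (f x) (mfderiv (𝓡∂ (n + 1)) 𝓘(ℝ, ℝ) f x v)) φ'

theorem smoothFnOn_sum {ι : Type*} {s : Finset ι} {f : ι → M → ℝ} {W : Set M}
    (hf : ∀ i ∈ s, SmoothFnOn n (f i) W) : SmoothFnOn n (fun y => ∑ i ∈ s, f i y) W :=
  contMDiffOn_finsetSum hf

theorem smoothFnOn_prod {ι : Type*} {s : Finset ι} {f : ι → M → ℝ} {W : Set M}
    (hf : ∀ i ∈ s, SmoothFnOn n (f i) W) : SmoothFnOn n (fun y => ∏ i ∈ s, f i y) W :=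
  contMDiffOn_finsetProd hf

theorem SmoothFnOn.comp_contDiffOn {f : M → ℝ} {W : Set M} {φ : ℝ → ℝ} {t : Set ℝ}
    (hf : SmoothFnOn n f W) (hφ : ContDiffOn ℝ ∞ φ t) (hm : MapsTo f W t) :
    SmoothFnOn n (fun y => φ (f y)) W :=
  (contMDiffOn_iff_contDiffOn.2 hφ).comp hf hm

theorem SmoothFnOn.inv {f : M → ℝ} {W : Set M} (hf : SmoothFnOn n f W) (h0 : ∀ y ∈ W, f y ≠ 0) :
    SmoothFnOn n (fun y => (f y)⁻¹) W :=
  hf.comp_contDiffOn (t := {0}ᶜ) (contDiffOn_id.inv (fun _ hy => hy)) h0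

theorem smoothFnOn_det {ι : Type*} [Fintype ι] [DecidableEq ι] {A : M → Matrix ι ι ℝ} {W : Set M}
    (hA : ∀ i j, SmoothFnOn n (fun y => A y i j) W) : SmoothFnOn n (fun y => (A y).det) W := by
  simp only [Matrix.det_apply']
  exact smoothFnOn_sum fun σ _ => contMDiffOn_const.mul (smoothFnOn_prod fun i _ => hA _ _)

/-- The inverse of an invertible matrix depends smoothly on the matrix. -/
theorem smoothFnOn_matrix_inv {ι : Type*} [Fintype ι] [DecidableEq ι] {A : M → Matrix ι ι ℝ}
    {W : Set M} (hA : ∀ i j, SmoothFnOn n (fun y => A y i j) W) (h0 : ∀ y ∈ W, (A y).det ≠ 0)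
    (i j : ι) : SmoothFnOn n (fun y => (A y)⁻¹ i j) W := by
  simp only [Matrix.inv_def, Ring.inverse_eq_inv', Matrix.smul_apply, smul_eq_mul,
    Matrix.adjugate_apply]
  refine ((smoothFnOn_det hA).inv h0).mul (smoothFnOn_det fun k l => ?_)
  simp only [Matrix.updateRow_apply]
  split_ifs
  · exact contMDiffOn_const
  · exact hA k l

theorem extChartAt_zero_nonneg {x₀ y : M} : 0 ≤ (extChartAt (𝓡∂ (n + 1)) x₀ y) 0 := by
  exact (chartAt (EuclideanHalfSpace (n + 1)) x₀ y).2

variable [IsManifold (𝓡∂ (n + 1)) ∞ M]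

/-- A vector field is differentiable at `x`. -/
abbrev DiffVectorAt (X : ∀ x : M, Tan n x) (x : M) : Prop :=
  MDifferentiableAt (𝓡∂ (n + 1)) (𝓡∂ (n + 1)).tangent
      (fun y => (⟨y, X y⟩ : TangentBundle (𝓡∂ (n + 1)) M)) x

theorem SmoothVectorOn.diffAt {X : ∀ x : M, Tan n x} {W : Set M} (hX : SmoothVectorOn X W)
    (hW : IsOpen W) {x : M} (hx : x ∈ W) : DiffVectorAt X x :=
  (hX.contMDiffAt (hW.mem_nhds hx)).mdifferentiableAt (by simp)

theorem SmoothVectorOn.mono {X : ∀ x : M, Tan n x} {W W' : Set M} (hX : SmoothVectorOn X W)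
    (h : W' ⊆ W) : SmoothVectorOn X W' :=
  ContMDiffOn.mono hX h

theorem SmoothVectorOn.add {X Y : ∀ x : M, Tan n x} {W : Set M} (hX : SmoothVectorOn X W)
    (hY : SmoothVectorOn Y W) : SmoothVectorOn (fun y => X y + Y y) W :=
  ContMDiffOn.add_section hX hY

theorem SmoothVectorOn.smul {f : M → ℝ} {X : ∀ x : M, Tan n x} {W : Set M}
    (hf : SmoothFnOn n f W) (hX : SmoothVectorOn X W) : SmoothVectorOn (fun y => f y • X y) W :=
  ContMDiffOn.smul_section hf hX

theorem SmoothVectorOn.sub {X Y : ∀ x : M, Tan n x} {W : Set M} (hX : SmoothVectorOn X W)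
    (hY : SmoothVectorOn Y W) : SmoothVectorOn (fun y => X y - Y y) W :=
  ContMDiffOn.sub_section hX hY

theorem SmoothVectorOn.sum {ι : Type*} {s : Finset ι} {X : ι → ∀ x : M, Tan n x} {W : Set M}
    (hX : ∀ i ∈ s, SmoothVectorOn (X i) W) : SmoothVectorOn (fun y => ∑ i ∈ s, X i y) W :=
  ContMDiffOn.sum_section hX

theorem SmoothVectorOn.congr {X Y : ∀ x : M, Tan n x} {W : Set M} (hX : SmoothVectorOn X W)
    (h : ∀ y ∈ W, Y y = X y) : SmoothVectorOn Y W :=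
  ContMDiffOn.congr hX (fun y hy => by rw [h y hy])

theorem smoothVectorOn_of_locally {X : ∀ x : M, Tan n x} {W : Set M}
    (h : ∀ x ∈ W, ∃ u, IsOpen u ∧ x ∈ u ∧ SmoothVectorOn X (W ∩ u)) : SmoothVectorOn X W :=
  contMDiffOn_of_locally_contMDiffOn h

theorem IsSmoothFrameOn.mono {b : ∀ x : M, Frame n x} {W W' : Set M} (hb : IsSmoothFrameOn b W)
    (h : W' ⊆ W) : IsSmoothFrameOn b W' :=
  fun i => (hb i).mono h

/-- The derivative of a smooth function along a smooth vector field is smooth. -/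
theorem SmoothFnOn.differential {f : M → ℝ} {X : ∀ x : M, Tan n x} {W : Set M} (hW : IsOpen W)
    (hf : SmoothFnOn n f W) (hX : SmoothVectorOn X W) :
    SmoothFnOn n (fun y => differential f y (X y)) W := by
  have h1 := ContMDiffOn.contMDiffOn_tangentMapWithin (m := ∞) hf (by simp) hW.uniqueMDiffOn
  have h2 := h1.comp hX (fun y hy => hy)
  have h3 := (contMDiff_snd_tangentBundle_modelSpace (n := ∞) ℝ 𝓘(ℝ, ℝ)).comp_contMDiffOn h2
  refine h3.congr (fun y hy => ?_)
  simp only [ProjCompact.differential, mvfderiv, Function.comp, tangentMapWithin,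
    mfderivWithin_of_isOpen hW hy]
  rfl

theorem mem_chart_source_of_mem {x₀ y : M}
    (hy : y ∈ (chartAt (EuclideanHalfSpace (n + 1)) x₀).source) :
    y ∈ (trivializationAt (EuclideanSpace ℝ (Fin (n + 1)))
      (TangentSpace (𝓡∂ (n + 1)) : M → Type _) x₀).baseSet := by
  simpa using hy

theorem coordFrame_apply {x₀ y : M} (hy : y ∈ (chartAt (EuclideanHalfSpace (n + 1)) x₀).source) :
    coordFrame x₀ y = (trivializationAt (EuclideanSpace ℝ (Fin (n + 1)))
      (TangentSpace (𝓡∂ (n + 1)) : M → Type _) x₀).basisAt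
      (EuclideanSpace.basisFun (Fin (n + 1)) ℝ).toBasis (mem_chart_source_of_mem hy) := by
  classical
  exact dif_pos (mem_chart_source_of_mem hy)

theorem isSmoothFrameOn_coordFrame (x₀ : M) : IsSmoothFrameOn (n := n) (fun y => coordFrame x₀ y)
    (chartAt (EuclideanHalfSpace (n + 1)) x₀).source := by
  intro i
  have h := (trivializationAt (EuclideanSpace ℝ (Fin (n + 1)))
      (TangentSpace (𝓡∂ (n + 1)) : M → Type _) x₀).contMDiffOn_localFrame_baseSet
      (I := 𝓡∂ (n + 1)) ∞
      (EuclideanSpace.basisFun (Fin (n + 1)) ℝ).toBasis i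
  refine (h.mono (fun y hy => mem_chart_source_of_mem hy)).congr (fun y hy => ?_)
  rw [Trivialization.localFrame_apply_of_mem_baseSet _ _ (mem_chart_source_of_mem hy)]
  exact congrArg (fun b : Frame n y => (⟨y, b i⟩ : TangentBundle (𝓡∂ (n + 1)) M))
    (coordFrame_apply hy)

theorem coordFrame_repr {x₀ y : M} (hy : y ∈ (chartAt (EuclideanHalfSpace (n + 1)) x₀).source)
    (v : Tan n y) (i : Fin (n + 1)) :
    (coordFrame x₀ y).repr v i = ((trivializationAt (EuclideanSpace ℝ (Fin (n + 1)))
      (TangentSpace (𝓡∂ (n + 1)) : M → Type _) x₀ ⟨y, v⟩).2) i := by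
  rw [coordFrame_apply hy, Trivialization.basisAt]
  simp

/-- The constant vector fields on the model space. -/
noncomputable def constField (n : ℕ) (i : Fin (n + 1)) (z : EuclideanSpace ℝ (Fin (n + 1))) :
    TangentSpace 𝓘(ℝ, EuclideanSpace ℝ (Fin (n + 1))) z :=
  EuclideanSpace.basisFun (Fin (n + 1)) ℝ i

theorem mfderiv_extChartAt_coordFrame {x₀ y : M}
    (hy : y ∈ (chartAt (EuclideanHalfSpace (n + 1)) x₀).source) (i : Fin (n + 1)) :
    mfderiv (𝓡∂ (n + 1)) 𝓘(ℝ, EuclideanSpace ℝ (Fin (n + 1)))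
      (extChartAt (𝓡∂ (n + 1)) x₀) y (coordFrame x₀ y i)
      = constField n i (extChartAt (𝓡∂ (n + 1)) x₀ y) := by
  have h (j : Fin (n + 1)) : ((trivializationAt (EuclideanSpace ℝ (Fin (n + 1)))
      (TangentSpace (𝓡∂ (n + 1)) : M → Type _) x₀ ⟨y, coordFrame x₀ y i⟩).2) j
      = EuclideanSpace.basisFun (Fin (n + 1)) ℝ i j := by
    rw [← coordFrame_repr hy, Module.Basis.repr_self, EuclideanSpace.basisFun_apply,
      Finsupp.single_apply]
    simp [eq_comm]
  have h1 : (trivializationAt (EuclideanSpace ℝ (Fin (n + 1)))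
      (TangentSpace (𝓡∂ (n + 1)) : M → Type _) x₀).continuousLinearMapAt ℝ y (coordFrame x₀ y i)
      = EuclideanSpace.basisFun (Fin (n + 1)) ℝ i := by
    rw [Trivialization.continuousLinearMapAt_apply,
      Trivialization.coe_linearMapAt_of_mem _ (mem_chart_source_of_mem hy)]
    exact PiLp.ext h
  exact (DFunLike.congr_fun
    (TangentBundle.continuousLinearMapAt_trivializationAt (I := 𝓡∂ (n + 1)) hy) _).symm.trans h1

theorem coordFrame_eq_mpullback {x₀ y : M}
    (hy : y ∈ (chartAt (EuclideanHalfSpace (n + 1)) x₀).source) (i : Fin (n + 1)) :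
    coordFrame x₀ y i = VectorField.mpullback (𝓡∂ (n + 1)) 𝓘(ℝ, EuclideanSpace ℝ (Fin (n + 1)))
      (extChartAt (𝓡∂ (n + 1)) x₀) (constField n i) y := by
  rw [VectorField.mpullback_apply]
  have hinv := isInvertible_mfderiv_extChartAt (I := 𝓡∂ (n + 1)) (x := x₀) (y := y)
    (by simpa using hy)
  rw [← mfderiv_extChartAt_coordFrame hy i]
  exact (hinv.inverse_apply_eq.2 rfl).symm

theorem mlieBracket_constField (i j : Fin (n + 1)) (z : EuclideanSpace ℝ (Fin (n + 1))) :
    VectorField.mlieBracket 𝓘(ℝ, EuclideanSpace ℝ (Fin (n + 1))) (constField n i)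
      (constField n j) z = 0 := by
  rw [← VectorField.mlieBracketWithin_univ, VectorField.mlieBracketWithin_eq_lieBracketWithin]
  have : VectorField.lieBracket ℝ
      (fun _ : EuclideanSpace ℝ (Fin (n + 1)) => EuclideanSpace.basisFun (Fin (n + 1)) ℝ i)
      (fun _ => EuclideanSpace.basisFun (Fin (n + 1)) ℝ j) z = 0 := by
    rw [VectorField.lieBracket_eq]
    simp
  exact (congrFun VectorField.lieBracketWithin_univ z).trans this

/-- Coordinate fields are pullbacks of constant fields under the chart, and pullback commutes with
the Lie bracket. -/
theorem mlieBracket_coordFrame {x₀ y : M}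
    (hy : y ∈ (chartAt (EuclideanHalfSpace (n + 1)) x₀).source) (i j : Fin (n + 1)) :
    VectorField.mlieBracket (𝓡∂ (n + 1)) (fun z => coordFrame x₀ z i)
      (fun z => coordFrame x₀ z j) y = 0 := by
  have hs := (chartAt (EuclideanHalfSpace (n + 1)) x₀).open_source.mem_nhds hy
  rw [Filter.EventuallyEq.mlieBracket_vectorField_eq
    (Filter.eventuallyEq_of_mem hs (fun z hz => coordFrame_eq_mpullback hz i))
    (Filter.eventuallyEq_of_mem hs (fun z hz => coordFrame_eq_mpullback hz j))]
  have hmin : IsManifold (𝓡∂ (n + 1)) (minSmoothness ℝ 2) M := by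
    rw [minSmoothness_of_isRCLikeNormedField]; infer_instance
  have hmin' : IsManifold 𝓘(ℝ, EuclideanSpace ℝ (Fin (n + 1))) (minSmoothness ℝ 2)
      (EuclideanSpace ℝ (Fin (n + 1))) := by
    infer_instance
  have hconst : ∀ i : Fin (n + 1), MDifferentiableAt 𝓘(ℝ, EuclideanSpace ℝ (Fin (n + 1)))
      𝓘(ℝ, EuclideanSpace ℝ (Fin (n + 1))).tangent
      (fun z => (⟨z, constField n i z⟩ :
        TangentBundle 𝓘(ℝ, EuclideanSpace ℝ (Fin (n + 1))) (EuclideanSpace ℝ (Fin (n + 1)))))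
      (extChartAt (𝓡∂ (n + 1)) x₀ y) := fun i =>
    (contMDiffAt_vectorSpace_iff_contDiffAt.2 (contDiffAt_const (n := 1))).mdifferentiableAt
      (by simp)
  rw [← VectorField.mpullback_mlieBracket (n := 2) (hconst i) (hconst j)
    (contMDiffAt_extChartAt' hy) (by simp), VectorField.mpullback_apply, mlieBracket_constField,
    map_zero]

/-- The Lie bracket of vector fields is the commutator of the corresponding derivations. -/
theorem differential_mlieBracket {X Y : ∀ x : M, Tan n x} {f : M → ℝ} {W : Set M} (hW : IsOpen W)
    (hX : SmoothVectorOn X W) (hY : SmoothVectorOn Y W) (hf : SmoothFnOn n f W) {x : M}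
    (hx : x ∈ W) :
    differential f x (VectorField.mlieBracket (𝓡∂ (n + 1)) X Y x)
      = differential (fun y => differential f y (Y y)) x (X x)
        - differential (fun y => differential f y (X y)) x (Y x) := by
  have hmin : IsManifold (𝓡∂ (n + 1)) (minSmoothness ℝ 3) M := by
    rw [minSmoothness_of_isRCLikeNormedField]; infer_instance
  set W' := W ∩ (chartAt (EuclideanHalfSpace (n + 1)) x).source with hW'
  have hWo : IsOpen W' := hW.inter (chartAt _ x).open_source
  have hxW : x ∈ W' := ⟨hx, mem_chart_source _ x⟩
  -- The Jacobi identity for `X`, `Y`, `f • Z` minus `f` times that for `X`, `Y`, `Z` leaves the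
  -- claimed identity multiplied by `Z`; any non-vanishing `Z` will do.
  let Z : ∀ y : M, Tan n y := fun y => coordFrame x y 0
  have hZ : SmoothVectorOn Z W' := (isSmoothFrameOn_coordFrame x 0).mono inter_subset_right
  replace hX : SmoothVectorOn X W' := hX.mono inter_subset_left
  replace hY : SmoothVectorOn Y W' := hY.mono inter_subset_left
  replace hf : SmoothFnOn n f W' := ContMDiffOn.mono hf inter_subset_left
  have hman : IsManifold (𝓡∂ (n + 1)) (((⊤ : ℕ∞) : ℕ∞ω) + 1) M := by
    rw [ENat.coe_top_add_one]; infer_instance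
  have br : ∀ {A B : ∀ x : M, Tan n x}, SmoothVectorOn A W' → SmoothVectorOn B W' →
      SmoothVectorOn (VectorField.mlieBracket (𝓡∂ (n + 1)) A B) W' := by
    intro A B hA hB y hy
    have := ContMDiffAt.mlieBracket_vectorField (m := ⊤) (n := ⊤)
      (hA.contMDiffAt (hWo.mem_nhds hy)) (hB.contMDiffAt (hWo.mem_nhds hy)) (by simp)
    exact this.contMDiffWithinAt
  have leib : ∀ {A B : ∀ x : M, Tan n x} {g : M → ℝ} {y : M}, y ∈ W' → SmoothVectorOn B W' →
      SmoothFnOn n g W' →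
      VectorField.mlieBracket (𝓡∂ (n + 1)) A (fun z => g z • B z) y
        = differential g y (A y) • B y + g y • VectorField.mlieBracket (𝓡∂ (n + 1)) A B y := by
    intro A B g y hy hB hg
    exact VectorField.mlieBracket_smul_right (hg.diffFnAt hWo hy) (hB.diffAt hWo hy)
  have leib2 : ∀ {A B C : ∀ x : M, Tan n x} {g h : M → ℝ}, SmoothVectorOn A W' →
      SmoothVectorOn B W' → SmoothVectorOn C W' → SmoothFnOn n g W' → SmoothFnOn n h W' →
      ∀ {F : ∀ x : M, Tan n x}, (∀ y ∈ W', F y = g y • B y + h y • C y) →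
      VectorField.mlieBracket (𝓡∂ (n + 1)) A F x
        = (differential g x (A x) • B x + g x • VectorField.mlieBracket (𝓡∂ (n + 1)) A B x)
          + (differential h x (A x) • C x + h x • VectorField.mlieBracket (𝓡∂ (n + 1)) A C x) := by
    intro A B C g h hA hB hC hg hh F hF
    rw [Filter.EventuallyEq.mlieBracket_vectorField_eq (Filter.EventuallyEq.refl _ A)
      (Filter.eventuallyEq_of_mem (hWo.mem_nhds hxW) hF), ← leib hxW hB hg, ← leib hxW hC hh]
    exact VectorField.mlieBracket_add_right ((SmoothVectorOn.smul hg hB).diffAt hWo hxW)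
      ((SmoothVectorOn.smul hh hC).diffAt hWo hxW)
  have at2 : ∀ {A : ∀ x : M, Tan n x}, SmoothVectorOn A W' →
      ContMDiffAt (𝓡∂ (n + 1)) (𝓡∂ (n + 1)).tangent (minSmoothness ℝ 2)
        (fun y => (⟨y, A y⟩ : TangentBundle (𝓡∂ (n + 1)) M)) x := by
    intro A hA
    rw [minSmoothness_of_isRCLikeNormedField]
    exact (hA.contMDiffAt (hWo.mem_nhds hxW)).of_le ENat.LEInfty.out
  have J1 := VectorField.leibniz_identity_mlieBracket_apply (at2 hX) (at2 hY) (at2 hZ)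
  have J2 := VectorField.leibniz_identity_mlieBracket_apply (at2 hX) (at2 hY)
    (at2 (SmoothVectorOn.smul hf hZ))
  have e1 := leib2 (F := VectorField.mlieBracket (𝓡∂ (n + 1)) Y (fun z => f z • Z z))
    hX hZ (br hY hZ) (hf.differential hWo hY) hf (fun y hy => leib hy hZ hf)
  have e2 := leib2 (F := VectorField.mlieBracket (𝓡∂ (n + 1)) X (fun z => f z • Z z))
    hY hZ (br hX hZ) (hf.differential hWo hX) hf (fun y hy => leib hy hZ hf)
  rw [e1, e2, leib hxW hZ hf, J1] at J2
  have hZ0 : Z x ≠ 0 := (coordFrame x x).ne_zero 0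
  have J3 : (differential f x (VectorField.mlieBracket (𝓡∂ (n + 1)) X Y x)
      - (differential (fun y => differential f y (Y y)) x (X x)
        - differential (fun y => differential f y (X y)) x (Y x))) • Z x = 0 := by
    rw [← sub_eq_zero] at J2
    rw [← neg_eq_zero, ← J2]
    module
  exact sub_eq_zero.1 ((smul_eq_zero.1 J3).resolve_right hZ0)

/-! ### Components in smooth frames -/

theorem smoothFnOn_coordFrame_repr {x₀ : M} {X : ∀ x : M, Tan n x} {W : Set M}
    (hX : SmoothVectorOn X W) (hW : W ⊆ (chartAt (EuclideanHalfSpace (n + 1)) x₀).source)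
    (i : Fin (n + 1)) : SmoothFnOn n (fun y => (coordFrame x₀ y).repr (X y) i) W := by
  have h1 : ContMDiffOn (𝓡∂ (n + 1)) 𝓘(ℝ, EuclideanSpace ℝ (Fin (n + 1))) ∞
      (fun y => (trivializationAt (EuclideanSpace ℝ (Fin (n + 1)))
      (TangentSpace (𝓡∂ (n + 1)) : M → Type _) x₀ ⟨y, X y⟩).2) W := by
    have := (Trivialization.contMDiffOn (IB := 𝓡∂ (n + 1)) (n := ∞)
      (trivializationAt (EuclideanSpace ℝ (Fin (n + 1)))
      (TangentSpace (𝓡∂ (n + 1)) : M → Type _) x₀)).comp hX (fun y hy => by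
        rw [mem_preimage, Trivialization.mem_source]
        exact mem_chart_source_of_mem (hW hy))
    exact contMDiff_snd.comp_contMDiffOn this
  have h2 : ContMDiff 𝓘(ℝ, EuclideanSpace ℝ (Fin (n + 1))) 𝓘(ℝ, ℝ) ∞
      (fun z : EuclideanSpace ℝ (Fin (n + 1)) => z i) :=
    (EuclideanSpace.proj (𝕜 := ℝ) i).contDiff.contMDiff
  exact (h2.comp_contMDiffOn h1).congr (fun y hy => coordFrame_repr (hW hy) _ i)

/-- The components of a smooth vector field in a smooth frame are smooth. -/
theorem SmoothVectorOn.repr {X : ∀ x : M, Tan n x} {W : Set M}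
    (hX : SmoothVectorOn X W) {b : ∀ x : M, Frame n x} (hb : IsSmoothFrameOn b W)
    (i : Fin (n + 1)) : SmoothFnOn n (fun y => (b y).repr (X y) i) W := by
  refine contMDiffOn_of_locally_contMDiffOn fun x hx =>
    ⟨(chartAt (EuclideanHalfSpace (n + 1)) x).source, (chartAt _ x).open_source,
      mem_chart_source _ x, ?_⟩
  set W' := W ∩ (chartAt (EuclideanHalfSpace (n + 1)) x).source
  -- Components in `b` are components in the coordinate frame multiplied by the inverse of `A`,
  -- which is smooth by Cramer's rule.
  let A : M → Matrix (Fin (n + 1)) (Fin (n + 1)) ℝ := fun y => (coordFrame x y).toMatrix (b y)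
  have hA : ∀ i j, SmoothFnOn n (fun y => A y i j) W' := fun i j =>
    smoothFnOn_coordFrame_repr ((hb j).mono inter_subset_left) inter_subset_right i
  have hinv : ∀ y, A y * (b y).toMatrix (coordFrame x y) = 1 := fun y =>
    Module.Basis.toMatrix_mul_toMatrix_flip _ _
  have hdet : ∀ y ∈ W', (A y).det ≠ 0 := fun y _ h => by
    have := congrArg Matrix.det (hinv y)
    simp [h] at this
  have hA' := smoothFnOn_matrix_inv hA hdet
  have : SmoothFnOn n (fun y => ∑ j, (A y)⁻¹ i j * (coordFrame x y).repr (X y) j) W' :=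
    smoothFnOn_sum fun j _ => (hA' i j).mul
      (smoothFnOn_coordFrame_repr (hX.mono inter_subset_left) inter_subset_right j)
  refine this.congr (fun y _ => ?_)
  rw [Matrix.inv_eq_right_inv (hinv y)]
  exact (congrFun ((coordFrame x y).toMatrix_mulVec_repr (b y) (X y)) i).symm

theorem smoothVectorOn_of_repr {X : ∀ x : M, Tan n x} {W : Set M}
    {b : ∀ x : M, Frame n x} (hb : IsSmoothFrameOn b W)
    (h : ∀ i, SmoothFnOn n (fun y => (b y).repr (X y) i) W) : SmoothVectorOn X W := by
  refine (SmoothVectorOn.sum (s := Finset.univ) fun i _ => SmoothVectorOn.smul (h i) (hb i)).congr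
    (fun y _ => ((b y).sum_repr (X y)).symm)

/-! ### The boundary in a chart -/

theorem mem_interior_iff_chart {x₀ y : M}
    (hy : y ∈ (chartAt (EuclideanHalfSpace (n + 1)) x₀).source) :
    y ∈ (𝓡∂ (n + 1)).interior M ↔ 0 < (extChartAt (𝓡∂ (n + 1)) x₀ y) 0 := by
  have h := ModelWithCorners.isInteriorPoint_iff_of_mem_atlas (I := 𝓡∂ (n + 1)) (M := M)
    (n := ∞) (by simp) (chart_mem_atlas _ x₀) hy
  have h2 : y ∈ (𝓡∂ (n + 1)).interior M ↔ (𝓡∂ (n + 1)).IsInteriorPoint y := Iff.rfl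
  rw [h2, h, OpenPartialHomeomorph.extend_target, interior_inter,
    ((𝓡∂ (n + 1)).continuous_symm.isOpen_preimage _ (chartAt _ x₀).open_target).interior_eq,
    interior_range_modelWithCornersEuclideanHalfSpace]
  constructor
  · intro h
    exact h.2
  · intro h
    refine ⟨?_, h⟩
    rw [mem_preimage, OpenPartialHomeomorph.extend_coe, Function.comp_apply,
      ModelWithCorners.left_inv]
    exact (chartAt _ x₀).map_source hy

theorem isOpen_interiorPoints : IsOpen ((𝓡∂ (n + 1)).interior M) :=
  ModelWithCorners.isOpen_interior (n := ∞) (by simp)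

/-- Interior points are dense. -/
theorem mem_closure_inter_interior {W : Set M} (hW : IsOpen W) {x : M} (hx : x ∈ W) :
    x ∈ closure (W ∩ (𝓡∂ (n + 1)).interior M) := by
  set φ := extChartAt (𝓡∂ (n + 1)) x with hφ
  -- Moving inward along the normal coordinate axis gives a curve of interior points that tends to
  -- `x`.
  let z : ℝ → EuclideanSpace ℝ (Fin (n + 1)) := fun t => φ x + t • EuclideanSpace.single 0 1
  have hz0 : ∀ t, z t 0 = φ x 0 + t := fun t => by simp [z]
  have hzr : ∀ t, 0 < t → z t ∈ range (𝓡∂ (n + 1)) := by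
    intro t ht
    rw [range_modelWithCornersEuclideanHalfSpace]
    have : 0 ≤ φ x 0 := extChartAt_zero_nonneg
    change 0 ≤ z t 0
    rw [hz0]
    linarith
  have hzt : Filter.Tendsto z (𝓝[>] 0) (𝓝[range (𝓡∂ (n + 1))] (φ x)) := by
    refine tendsto_nhdsWithin_iff.2 ⟨?_, ?_⟩
    · have : Continuous z := by fun_prop
      have h := this.tendsto 0
      simp only [z, zero_smul, add_zero] at h
      exact h.mono_left nhdsWithin_le_nhds
    · filter_upwards [self_mem_nhdsWithin] with t ht using hzr t ht
  have hcont : Filter.Tendsto (fun t => φ.symm (z t)) (𝓝[>] 0) (𝓝 x) := by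
    have h := continuousAt_extChartAt_symm (I := 𝓡∂ (n + 1)) x
    have h2 := (h.tendsto.mono_left nhdsWithin_le_nhds).comp hzt
    rwa [extChartAt_to_inv] at h2
  refine mem_closure_of_tendsto hcont ?_
  filter_upwards [hcont (hW.mem_nhds hx),
    hzt (extChartAt_target_mem_nhdsWithin (I := 𝓡∂ (n + 1)) x), self_mem_nhdsWithin] with t h1 h2 h3
  refine ⟨h1, ?_⟩
  have hs : φ.symm (z t) ∈ (chartAt (EuclideanHalfSpace (n + 1)) x).source := by
    have := φ.map_target h2
    simpa [φ] using this
  rw [mem_interior_iff_chart hs, φ.right_inv h2, hz0]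
  have h4 : 0 ≤ φ x 0 := extChartAt_zero_nonneg
  have h5 : (0 : ℝ) < t := h3
  linarith

/-- Interior points are dense. This is how identities known only where ρ is invertible are carried
over to the boundary. -/
theorem eqOn_of_eqOn_interior {W : Set M} (hW : IsOpen W) {f g : M → ℝ}
    (hf : ContinuousOn f W) (hg : ContinuousOn g W)
    (h : ∀ y ∈ W ∩ (𝓡∂ (n + 1)).interior M, f y = g y) {x : M} (hx : x ∈ W) : f x = g x := by
  have hcl := mem_closure_inter_interior (n := n) hW hx
  have hne : (𝓝[W ∩ (𝓡∂ (n + 1)).interior M] x).NeBot := mem_closure_iff_nhdsWithin_neBot.1 hcl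
  refine tendsto_nhds_unique_of_eventuallyEq (l := 𝓝[W ∩ (𝓡∂ (n + 1)).interior M] x)
    ((hf x hx).mono_left (nhdsWithin_mono x inter_subset_left))
    ((hg x hx).mono_left (nhdsWithin_mono x inter_subset_left)) ?_
  filter_upwards [self_mem_nhdsWithin] with y hy using h y hy

end Fields

/-! ### Extension and division at the boundary -/

section BoundaryExtension

variable {n : ℕ} {M : Type*} [TopologicalSpace M] [ChartedSpace (EuclideanHalfSpace (n + 1)) M]
  [IsManifold (𝓡∂ (n + 1)) ∞ M]

theorem extChartAt_zero_of_boundary {x : M} (hx : x ∈ (𝓡∂ (n + 1)).boundary M) {x₀ : M}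
    (hs : x ∈ (chartAt (EuclideanHalfSpace (n + 1)) x₀).source) :
    extChartAt (𝓡∂ (n + 1)) x₀ x 0 = 0 := by
  have h1 : x ∉ (𝓡∂ (n + 1)).interior M := by
    rw [← ModelWithCorners.compl_interior] at hx
    exact hx
  rw [mem_interior_iff_chart hs, not_lt] at h1
  exact le_antisymm h1 extChartAt_zero_nonneg

theorem mem_boundary_of_not_interior {x : M} (hx : x ∉ (𝓡∂ (n + 1)).interior M) :
    x ∈ (𝓡∂ (n + 1)).boundary M := by
  rw [← ModelWithCorners.compl_interior]
  exact hx

/-- Small half balls in a chart. -/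
theorem exists_halfBall_subset {x₀ : M} {W : Set M} (hW : IsOpen W) (hx : x₀ ∈ W) :
    ∃ r > 0, halfBall (extChartAt (𝓡∂ (n + 1)) x₀ x₀) r ⊆
      (extChartAt (𝓡∂ (n + 1)) x₀).target ∩ (extChartAt (𝓡∂ (n + 1)) x₀).symm ⁻¹' W := by
  have h1 := extChartAt_target_mem_nhdsWithin (I := 𝓡∂ (n + 1)) x₀
  have h2 : (extChartAt (𝓡∂ (n + 1)) x₀).symm ⁻¹' W ∈ 𝓝 (extChartAt (𝓡∂ (n + 1)) x₀ x₀) := by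
    refine (continuousAt_extChartAt_symm (I := 𝓡∂ (n + 1)) x₀).preimage_mem_nhds ?_
    rw [extChartAt_to_inv]
    exact hW.mem_nhds hx
  obtain ⟨ε, hε, h3⟩ := Metric.mem_nhdsWithin_iff.1
    (Filter.inter_mem h1 (mem_nhdsWithin_of_mem_nhds h2))
  refine ⟨ε / 2, by positivity, ?_⟩
  rintro z ⟨hz1, hz2⟩
  refine h3 ⟨Metric.closedBall_subset_ball (by linarith) hz1, ?_⟩
  rw [range_modelWithCornersEuclideanHalfSpace]
  exact hz2

theorem extChartAt_symm_mem_source {x₀ : M} {z : EuclideanSpace ℝ (Fin (n + 1))}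
    (hz : z ∈ (extChartAt (𝓡∂ (n + 1)) x₀).target) :
    (extChartAt (𝓡∂ (n + 1)) x₀).symm z ∈ (chartAt (EuclideanHalfSpace (n + 1)) x₀).source := by
  have := (extChartAt (𝓡∂ (n + 1)) x₀).map_target hz
  rwa [extChartAt_source] at this

theorem SmoothFnOn.contDiffOn_chart {x₀ : M} {W : Set M} {f : M → ℝ} (hf : SmoothFnOn n f W)
    {S : Set (EuclideanSpace ℝ (Fin (n + 1)))}
    (hS : S ⊆ (extChartAt (𝓡∂ (n + 1)) x₀).target ∩ (extChartAt (𝓡∂ (n + 1)) x₀).symm ⁻¹' W) :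
    ContDiffOn ℝ ∞ (fun z => f ((extChartAt (𝓡∂ (n + 1)) x₀).symm z)) S :=
  contMDiffOn_iff_contDiffOn.1 (ContMDiffOn.comp hf
    ((contMDiffOn_extChartAt_symm x₀).mono (fun _ hz => (hS hz).1)) (fun _ hz => (hS hz).2))

/-- The part of a chart domain which is mapped to a given open ball. -/
def chartBall (n : ℕ) {M : Type*} [TopologicalSpace M]
    [ChartedSpace (EuclideanHalfSpace (n + 1)) M] (x₀ : M) (r : ℝ) : Set M :=
  (chartAt (EuclideanHalfSpace (n + 1)) x₀).source ∩
    extChartAt (𝓡∂ (n + 1)) x₀ ⁻¹' Metric.ball (extChartAt (𝓡∂ (n + 1)) x₀ x₀) r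

theorem isOpen_chartBall (x₀ : M) (r : ℝ) : IsOpen (chartBall n x₀ r) :=
  isOpen_extChartAt_preimage (I := 𝓡∂ (n + 1)) x₀ Metric.isOpen_ball

theorem mem_chartBall (x₀ : M) {r : ℝ} (hr : 0 < r) : x₀ ∈ chartBall n x₀ r :=
  ⟨mem_chart_source _ x₀, Metric.mem_ball_self hr⟩

theorem extChartAt_mem_halfBall {x₀ y : M} {r : ℝ} (hy : y ∈ chartBall n x₀ r) :
    extChartAt (𝓡∂ (n + 1)) x₀ y ∈ halfBall (extChartAt (𝓡∂ (n + 1)) x₀ x₀) r :=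
  ⟨Metric.ball_subset_closedBall hy.2, extChartAt_zero_nonneg⟩

theorem smoothFnOn_chartBall {x₀ : M} {r : ℝ} {g : EuclideanSpace ℝ (Fin (n + 1)) → ℝ}
    (hg : ContDiffOn ℝ ∞ g (halfBall (extChartAt (𝓡∂ (n + 1)) x₀ x₀) r)) :
    SmoothFnOn n (fun y => g (extChartAt (𝓡∂ (n + 1)) x₀ y)) (chartBall n x₀ r) :=
  ContMDiffOn.comp (contMDiffOn_iff_contDiffOn.2 hg)
    ((contMDiffOn_extChartAt (I := 𝓡∂ (n + 1)) (x := x₀)).mono inter_subset_left)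
    (fun _ hy => extChartAt_mem_halfBall hy)

theorem extChartAt_left_inv {x₀ y : M}
    (hy : y ∈ (chartAt (EuclideanHalfSpace (n + 1)) x₀).source) :
    (extChartAt (𝓡∂ (n + 1)) x₀).symm (extChartAt (𝓡∂ (n + 1)) x₀ y) = y :=
  (extChartAt (𝓡∂ (n + 1)) x₀).left_inv (by rwa [extChartAt_source])

/-- The chart sends the coordinate frame to the standard basis, so the differential on the manifold
determines the Fréchet derivative of the coordinate expression. The point must be interior in the
chart target for a full derivative to make sense. -/
theorem hasFDerivAt_chart {x₀ : M} {f : M → ℝ} {z : EuclideanSpace ℝ (Fin (n + 1))}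
    (hz : z ∈ interior (extChartAt (𝓡∂ (n + 1)) x₀).target)
    (hf : DiffFnAt n f ((extChartAt (𝓡∂ (n + 1)) x₀).symm z))
    {L : EuclideanSpace ℝ (Fin (n + 1)) →L[ℝ] ℝ}
    (hL : ∀ i, L (EuclideanSpace.basisFun (Fin (n + 1)) ℝ i)
      = differential f ((extChartAt (𝓡∂ (n + 1)) x₀).symm z)
        (coordFrame x₀ ((extChartAt (𝓡∂ (n + 1)) x₀).symm z) i)) :
    HasFDerivAt (fun z => f ((extChartAt (𝓡∂ (n + 1)) x₀).symm z)) L z := by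
  set φ := extChartAt (𝓡∂ (n + 1)) x₀ with hφ
  set y := φ.symm z with hy
  have hzt : z ∈ φ.target := interior_subset hz
  have hys := extChartAt_symm_mem_source hzt
  have hz' : φ y = z := φ.right_inv hzt
  have hsymm : MDifferentiableAt 𝓘(ℝ, EuclideanSpace ℝ (Fin (n + 1))) (𝓡∂ (n + 1)) φ.symm z :=
    ((contMDiffOn_extChartAt_symm (I := 𝓡∂ (n + 1)) (n := ∞) x₀).contMDiffAt
      (mem_interior_iff_mem_nhds.1 hz)).mdifferentiableAt (by simp)
  have hF : MDifferentiableAt 𝓘(ℝ, EuclideanSpace ℝ (Fin (n + 1))) 𝓘(ℝ, ℝ)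
      (fun z => f (φ.symm z)) z := MDifferentiableAt.comp z hf hsymm
  have hFd := mdifferentiableAt_iff_differentiableAt.1 hF
  have hφd : MDifferentiableAt (𝓡∂ (n + 1)) 𝓘(ℝ, EuclideanSpace ℝ (Fin (n + 1))) φ y :=
    mdifferentiableAt_extChartAt hys
  have hcomp : f =ᶠ[𝓝 y] (fun z => f (φ.symm z)) ∘ φ := by
    filter_upwards [(chartAt _ x₀).open_source.mem_nhds hys] with w hw
    rw [Function.comp_apply, hφ, extChartAt_left_inv hw]
  have hL' : fderiv ℝ (fun z => f (φ.symm z)) z = L := by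
    refine ContinuousLinearMap.coe_injective
      ((EuclideanSpace.basisFun (Fin (n + 1)) ℝ).toBasis.ext fun i => ?_)
    simp only [ContinuousLinearMap.coe_coe, OrthonormalBasis.coe_toBasis]
    rw [hL i]
    have h1 : mfderiv (𝓡∂ (n + 1)) 𝓘(ℝ, ℝ) ((fun z => f (φ.symm z)) ∘ φ) y
        = (mfderiv 𝓘(ℝ, EuclideanSpace ℝ (Fin (n + 1))) 𝓘(ℝ, ℝ) (fun z => f (φ.symm z)) (φ y)).comp
          (mfderiv (𝓡∂ (n + 1)) 𝓘(ℝ, EuclideanSpace ℝ (Fin (n + 1))) φ y) :=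
      mfderiv_comp y (by rw [hz']; exact hF) hφd
    rw [differential_congr hcomp]
    have h2 := congrArg (fun A => NormedSpace.fromTangentSpace _ (A (coordFrame x₀ y i))) h1
    refine Eq.symm (Eq.trans h2 ?_)
    rw [ContinuousLinearMap.comp_apply, mfderiv_extChartAt_coordFrame hys, mfderiv_eq_fderiv]
    rw [← hφ, hz']
    rfl
  rw [← hL']
  exact hFd.hasFDerivAt

theorem chartBall_subset {x₀ : M} {W : Set M} {r : ℝ}
    (h : halfBall (extChartAt (𝓡∂ (n + 1)) x₀ x₀) r ⊆
      (extChartAt (𝓡∂ (n + 1)) x₀).target ∩ (extChartAt (𝓡∂ (n + 1)) x₀).symm ⁻¹' W) :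
    chartBall n x₀ r ⊆ W := by
  intro y hy
  have := (h (extChartAt_mem_halfBall hy)).2
  rwa [mem_preimage, extChartAt_left_inv hy.1] at this

/-- A nowhere vanishing function on the interior whose logarithmic derivative is smooth up to the
boundary extends smoothly to the boundary. -/
theorem exists_smooth_extension_of_logDeriv {x₀ : M} {W : Set M} (hW : IsOpen W) (hx : x₀ ∈ W)
    {f : M → ℝ} (hf : SmoothFnOn n f (W ∩ (𝓡∂ (n + 1)).interior M))
    (hf0 : ∀ y ∈ W ∩ (𝓡∂ (n + 1)).interior M, f y ≠ 0)
    {α : Fin (n + 1) → M → ℝ} (hα : ∀ i, SmoothFnOn n (α i) W)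
    (hd : ∀ y ∈ W ∩ (𝓡∂ (n + 1)).interior M, ∀ i,
      differential f y (coordFrame x₀ y i) = f y * α i y) :
    ∃ W₁ : Set M, IsOpen W₁ ∧ x₀ ∈ W₁ ∧ W₁ ⊆ W ∩ (chartAt (EuclideanHalfSpace (n + 1)) x₀).source ∧
      ∃ g : M → ℝ, SmoothFnOn n g W₁ ∧ (∀ y ∈ W₁, g y ≠ 0) ∧
        ∀ y ∈ W₁ ∩ (𝓡∂ (n + 1)).interior M, g y = f y := by
  obtain ⟨r, hr, hS⟩ := exists_halfBall_subset (n := n) hW hx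
  set φ := extChartAt (𝓡∂ (n + 1)) x₀ with hφ
  have hi := interior_halfBall_nonempty (extChartAt_zero_nonneg (n := n) (x₀ := x₀) (y := x₀)) hr
  -- The logarithmic derivative as a one-form in coordinates, reducing the claim to the half ball.
  let A : EuclideanSpace ℝ (Fin (n + 1)) → EuclideanSpace ℝ (Fin (n + 1)) →L[ℝ] ℝ :=
    fun z => ∑ i, α i (φ.symm z) • EuclideanSpace.proj (𝕜 := ℝ) i
  have hA : ContDiffOn ℝ ∞ A (halfBall (φ x₀) r) := by
    refine ContDiffOn.sum fun i _ => ?_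
    exact ((hα i).contDiffOn_chart hS).smul contDiffOn_const
  have hmem : ∀ z ∈ interior (halfBall (φ x₀) r), φ.symm z ∈ W ∩ (𝓡∂ (n + 1)).interior M := by
    intro z hz
    have h1 := hS (interior_subset hz)
    refine ⟨h1.2, ?_⟩
    rw [mem_interior_iff_chart (extChartAt_symm_mem_source h1.1), φ.right_inv h1.1]
    exact interior_halfBall_subset _ _ hz
  obtain ⟨g, hg, hg0, hgf⟩ := exists_contDiffOn_extension_of_logDeriv
    (f := fun z => f (φ.symm z)) (isCompact_halfBall _ _) (convex_halfBall _ _) hi hA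
    (fun z hz => hf0 _ (hmem z hz)) (by
      intro z hz
      refine hasFDerivAt_chart ?_ (hf.diffFnAt (hW.inter isOpen_interiorPoints) (hmem z hz)) ?_
      · exact interior_mono (fun w hw => (hS hw).1) hz
      · intro i
        rw [hd _ (hmem z hz)]
        simp [A])
  refine ⟨chartBall n x₀ r, isOpen_chartBall _ _, mem_chartBall _ hr,
    fun y hy => ⟨chartBall_subset hS hy, hy.1⟩, fun y => g (φ y), smoothFnOn_chartBall hg,
    fun y hy => hg0 _ (extChartAt_mem_halfBall hy), fun y hy => ?_⟩
  have h1 := hgf (φ y) (ball_inter_subset_interior_halfBall _ _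
    ⟨hy.1.2, (mem_interior_iff_chart hy.1.1).1 hy.2⟩)
  exact h1.trans (congrArg f (extChartAt_left_inv hy.1.1))

/-- A local defining function is a smooth positive multiple of the normal coordinate. -/
theorem IsLocalDefiningFunction.exists_eq_mul {ρ : M → ℝ} {U : Set M}
    (hρ : IsLocalDefiningFunction n ρ U) {x₀ : M} (hx : x₀ ∈ U)
    (hb : x₀ ∈ (𝓡∂ (n + 1)).boundary M) :
    ∃ W : Set M, IsOpen W ∧ x₀ ∈ W ∧ W ⊆ U ∧ ∃ g : M → ℝ, SmoothFnOn n g W ∧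
      (∀ y ∈ W, 0 < g y) ∧ ∀ y ∈ W, ρ y = extChartAt (𝓡∂ (n + 1)) x₀ y 0 * g y := by
  obtain ⟨r, hr, hS⟩ := exists_halfBall_subset (n := n) hρ.isOpen hx
  set φ := extChartAt (𝓡∂ (n + 1)) x₀ with hφ
  have hz0 : φ x₀ 0 = 0 := extChartAt_zero_of_boundary hb (mem_chart_source _ x₀)
  obtain ⟨g, hg, hgf⟩ := exists_contDiffOn_eq_mul_of_vanishing hz0 hr
    (SmoothFnOn.contDiffOn_chart hρ.smooth hS) (by
      intro z hz h0
      have h1 := hS hz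
      rw [hρ.zero_iff _ h1.2]
      refine mem_boundary_of_not_interior ?_
      rw [mem_interior_iff_chart (extChartAt_symm_mem_source h1.1), φ.right_inv h1.1, h0]
      exact lt_irrefl 0)
  have hWo := isOpen_chartBall (n := n) x₀ r
  have hgs := smoothFnOn_chartBall hg
  have heq : ∀ y ∈ chartBall n x₀ r, ρ y = φ y 0 * g (φ y) := by
    intro y hy
    have := hgf _ (extChartAt_mem_halfBall hy)
    rwa [extChartAt_left_inv hy.1] at this
  have hpos : ∀ y ∈ chartBall n x₀ r ∩ (𝓡∂ (n + 1)).interior M, 0 < g (φ y) := by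
    intro y hy
    have h1 : 0 < φ y 0 := (mem_interior_iff_chart hy.1.1).1 hy.2
    have h2 := hρ.nonneg y (chartBall_subset hS hy.1)
    have h3 : ρ y ≠ 0 := by
      rw [Ne, hρ.zero_iff y (chartBall_subset hS hy.1)]
      intro h4
      exact Set.disjoint_left.1 (ModelWithCorners.disjoint_interior_boundary) hy.2 h4
    rw [heq y hy.1] at h2 h3
    exact lt_of_le_of_ne (nonneg_of_mul_nonneg_right h2 h1) (fun h => h3 (by rw [← h, mul_zero]))
  refine ⟨chartBall n x₀ r, hWo, mem_chartBall _ hr, chartBall_subset hS,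
    fun y => g (φ y), hgs, fun y hy => ?_, heq⟩
  by_cases hyi : y ∈ (𝓡∂ (n + 1)).interior M
  · exact hpos y ⟨hy, hyi⟩
  have hyb := mem_boundary_of_not_interior hyi
  have hnonneg : 0 ≤ g (φ y) := by
    have hcl := mem_closure_inter_interior (n := n) hWo hy
    have hne : (𝓝[chartBall n x₀ r ∩ (𝓡∂ (n + 1)).interior M] y).NeBot :=
      mem_closure_iff_nhdsWithin_neBot.1 hcl
    refine ge_of_tendsto (x := 𝓝[chartBall n x₀ r ∩ (𝓡∂ (n + 1)).interior M] y)
      ((hgs.continuousOn y hy).mono_left (nhdsWithin_mono y inter_subset_left))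
      (f := fun y => g (φ y)) ?_
    filter_upwards [self_mem_nhdsWithin] with w hw using (hpos w hw).le
  -- At a boundary point the normal coordinate vanishes. If the cofactor vanished too, the product
  -- rule would give `dρ = 0` there.
  refine lt_of_le_of_ne hnonneg (fun h0 => ?_)
  refine hρ.differential_ne y (chartBall_subset hS hy) hyb ?_
  have hφ0 : SmoothFnOn n (fun y => φ y 0) (chartBall n x₀ r) :=
    smoothFnOn_chartBall (g := fun z => z 0)
      (EuclideanSpace.proj (𝕜 := ℝ) (0 : Fin (n + 1))).contDiff.contDiffOn
  rw [differential_congr (Filter.eventuallyEq_of_mem (hWo.mem_nhds hy) heq)]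
  ext v
  rw [differential_mul (hφ0.diffFnAt hWo hy) (hgs.diffFnAt hWo hy),
    show g (extChartAt (𝓡∂ (n + 1)) x₀ y) = 0 from h0.symm,
    show φ y 0 = 0 from extChartAt_zero_of_boundary hyb hy.1]
  simp

/-- Two local defining functions differ by a smooth positive factor. -/
theorem IsLocalDefiningFunction.exists_ratio {ρ ρ' : M → ℝ} {U U' : Set M}
    (hρ : IsLocalDefiningFunction n ρ U) (hρ' : IsLocalDefiningFunction n ρ' U') {x₀ : M}
    (hx : x₀ ∈ U) (hx' : x₀ ∈ U') (hb : x₀ ∈ (𝓡∂ (n + 1)).boundary M) :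
    ∃ W : Set M, IsOpen W ∧ x₀ ∈ W ∧ W ⊆ U ∩ U' ∧ ∃ u : M → ℝ, SmoothFnOn n u W ∧
      (∀ y ∈ W, 0 < u y) ∧ ∀ y ∈ W, ρ y = u y * ρ' y := by
  obtain ⟨W, hW, hxW, hWU, g, hg, hg0, hgρ⟩ := hρ.exists_eq_mul hx hb
  obtain ⟨W', hW', hxW', hWU', g', hg', hg0', hgρ'⟩ := hρ'.exists_eq_mul hx' hb
  have hg'W : SmoothFnOn n g' (W ∩ W') := ContMDiffOn.mono hg' inter_subset_right
  refine ⟨W ∩ W', hW.inter hW', ⟨hxW, hxW'⟩, fun y hy => ⟨hWU hy.1, hWU' hy.2⟩,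
    fun y => g y * (g' y)⁻¹, (ContMDiffOn.mono hg inter_subset_left).mul
      (hg'W.inv fun y hy => (hg0' y hy.2).ne'), fun y hy => ?_, fun y hy => ?_⟩
  · have := hg0 y hy.1
    have := hg0' y hy.2
    positivity
  · rw [hgρ y hy.1, hgρ' y hy.2]
    have := (hg0' y hy.2).ne'
    field_simp

end BoundaryExtension

/-! ### Calculus of affine connections -/

section Connections

variable {n : ℕ} {M : Type*} [TopologicalSpace M] [ChartedSpace (EuclideanHalfSpace (n + 1)) M]
  [IsManifold (𝓡∂ (n + 1)) ∞ M]

namespace IsAffineConnectionOn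

variable {D : ConnOp n M} {W : Set M}

theorem mono (hD : IsAffineConnectionOn D W) {W' : Set M} (h : W' ⊆ W) :
    IsAffineConnectionOn D W' where
  isCov := hD.isCov.mono h
  smooth := fun V hV => hD.smooth V (hV.trans h)
  torsionFree := fun x hx => hD.torsionFree x (h hx)

theorem add_apply (hD : IsAffineConnectionOn D W) {X Y : ∀ x : M, Tan n x} {x : M} (hx : x ∈ W)
    (hX : DiffVectorAt X x) (hY : DiffVectorAt Y x) (v : Tan n x) :
    D (fun y => X y + Y y) x v = D X x v + D Y x v := by
  have := hD.isCov.add hX hY hx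
  exact congrArg (fun L : Tan n x →L[ℝ] Tan n x => L v) this

theorem smul_apply (hD : IsAffineConnectionOn D W) {X : ∀ x : M, Tan n x} {f : M → ℝ} {x : M}
    (hx : x ∈ W) (hf : DiffFnAt n f x) (hX : DiffVectorAt X x) (v : Tan n x) :
    D (fun y => f y • X y) x v = f x • D X x v + differential f x v • X x := by
  have := hD.isCov.leibniz hX hf hx
  exact congrArg (fun L : Tan n x →L[ℝ] Tan n x => L v) this

theorem congr (hD : IsAffineConnectionOn D W) (hW : IsOpen W) {X Y : ∀ x : M, Tan n x} {x : M}
    (hx : x ∈ W) (hX : DiffVectorAt X x) (h : ∀ᶠ y in 𝓝 x, X y = Y y) : D X x = D Y x :=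
  hD.isCov.congr_of_eventuallyEq hX
    (hX.congr_of_eventuallyEq (by filter_upwards [h] with y hy; rw [hy])) (hW.mem_nhds hx) h

theorem sum_apply (hD : IsAffineConnectionOn D W) {ι : Type*} (s : Finset ι)
    {X : ι → ∀ x : M, Tan n x} {x : M} (hx : x ∈ W) (hX : ∀ i ∈ s, DiffVectorAt (X i) x)
    (v : Tan n x) :
    DiffVectorAt (fun y => ∑ i ∈ s, X i y) x ∧
      D (fun y => ∑ i ∈ s, X i y) x v = ∑ i ∈ s, D (X i) x v := by
  classical
  induction s using Finset.induction_on with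
  | empty =>
    refine ⟨?_, ?_⟩
    · simp only [Finset.sum_empty]
      exact mdifferentiableAt_zeroSection ..
    · simp only [Finset.sum_empty]
      have := hD.isCov.zero hx
      exact congrArg (fun L : Tan n x →L[ℝ] Tan n x => L v) this
  | insert a s ha ih =>
    obtain ⟨h1, h2⟩ := ih (fun i hi => hX i (Finset.mem_insert_of_mem hi))
    have h3 := hX a (Finset.mem_insert_self a s)
    simp only [Finset.sum_insert ha]
    exact ⟨mdifferentiableAt_add_section h3 h1, by rw [hD.add_apply hx h3 h1, h2]⟩

/-- The covariant derivative of a smooth field along a smooth field is smooth. -/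
theorem smooth_apply (hD : IsAffineConnectionOn D W) {W' : Set M} (hW' : IsOpen W') (h : W' ⊆ W)
    {X Y : ∀ x : M, Tan n x} (hX : SmoothVectorOn X W') (hY : SmoothVectorOn Y W') :
    SmoothVectorOn (fun y => D Y y (X y)) W' := by
  have h1 := (hD.smooth W' h hW').contMDiff (σ := Y) (by
    rw [ENat.coe_top_add_one]; exact hY)
  exact ContMDiffOn.clm_bundle_apply h1 hX

theorem torsion (hD : IsAffineConnectionOn D W) {W' : Set M} (hW' : IsOpen W') (h : W' ⊆ W)
    {X Y : ∀ x : M, Tan n x} (hX : SmoothVectorOn X W') (hY : SmoothVectorOn Y W') {x : M}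
    (hx : x ∈ W') : D Y x (X x) - D X x (Y x) = VectorField.mlieBracket (𝓡∂ (n + 1)) X Y x :=
  hD.torsionFree x (h hx) X Y (hX.diffAt hW' hx) (hY.diffAt hW' hx)

end IsAffineConnectionOn

theorem mem_source_inter_open {W : Set M} (hW : IsOpen W) (x : M) :
    IsOpen (W ∩ (chartAt (EuclideanHalfSpace (n + 1)) x).source) :=
  hW.inter (chartAt _ x).open_source

theorem diffVectorAt_coordFrame {x₀ x : M}
    (hx : x ∈ (chartAt (EuclideanHalfSpace (n + 1)) x₀).source) (i : Fin (n + 1)) :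
    DiffVectorAt (n := n) (fun y => coordFrame x₀ y i) x :=
  SmoothVectorOn.diffAt (isSmoothFrameOn_coordFrame x₀ i) (chartAt _ x₀).open_source hx

/-! ### Projective changes of connections -/

/-- The Leibniz terms cancel, so the difference of two connections depends only on the value of the
field at the point. -/
theorem sub_apply_congr {D D' : ConnOp n M} {W : Set M} (hD : IsAffineConnectionOn D W)
    (hD' : IsAffineConnectionOn D' W) {x : M} (hx : x ∈ W) {X Y : ∀ x : M, Tan n x}
    (hX : DiffVectorAt X x) (hY : DiffVectorAt Y x) (h : X x = Y x) (v : Tan n x) :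
    D' X x v - D X x v = D' Y x v - D Y x v := by
  have h1 := IsCovariantDerivativeOn.difference_apply hD'.isCov hD.isCov hx hX
  have h2 := IsCovariantDerivativeOn.difference_apply hD'.isCov hD.isCov hx hY
  rw [h, h2] at h1
  exact (congrArg (fun L : Tan n x →L[ℝ] Tan n x => L v) h1).symm

/-- The relation `D' = D + Υ` may be checked on a frame. -/
theorem projRelAt_of_frame {D D' : ConnOp n M} {W : Set M} (hD : IsAffineConnectionOn D W)
    (hD' : IsAffineConnectionOn D' W) {x : M} (hx : x ∈ W) {Υ : Module.Dual ℝ (Tan n x)}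
    {b : ∀ x : M, Frame n x} (hb : ∀ k, DiffVectorAt (fun y => b y k) x)
    (h : ∀ k i, D' (fun y => b y k) x (b x i)
      = D (fun y => b y k) x (b x i) + Υ (b x i) • b x k + Υ (b x k) • b x i) :
    ProjRelAt D D' x Υ := by
  intro X hX v
  -- By tensoriality of the difference, `X` may be replaced by the combination of frame fields with
  -- its components at `x` frozen; no derivatives of coefficients appear.
  let c : Fin (n + 1) → ℝ := fun k => (b x).repr (X x) k
  have hcb : ∀ k ∈ Finset.univ, DiffVectorAt (fun y => c k • b y k) x := fun k _ =>
    MDifferentiableAt.smul_section (mdifferentiableAt_const (c := c k)) (hb k)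
  have h1 : X x = ∑ k, c k • b x k := ((b x).sum_repr (X x)).symm
  have hv : ∀ k, D' (fun y => b y k) x v
      = D (fun y => b y k) x v + Υ v • b x k + Υ (b x k) • v := by
    intro k
    have : (D' (fun y => b y k) x : Tan n x →ₗ[ℝ] Tan n x)
        = (D (fun y => b y k) x : Tan n x →ₗ[ℝ] Tan n x) + Υ.smulRight (b x k)
          + Υ (b x k) • LinearMap.id := by
      refine (b x).ext fun i => ?_
      simpa using h k i
    simpa using congrArg (fun L : Tan n x →ₗ[ℝ] Tan n x => L v) this
  have key := sub_apply_congr hD hD' hx hX (hD.sum_apply Finset.univ hx hcb v).1 h1 v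
  rw [(hD.sum_apply Finset.univ hx hcb v).2, (hD'.sum_apply Finset.univ hx hcb v).2,
    ← Finset.sum_sub_distrib] at key
  have e : ∀ k, D' (fun y => c k • b y k) x v - D (fun y => c k • b y k) x v
      = c k • (Υ v • b x k + Υ (b x k) • v) := by
    intro k
    rw [hD.smul_apply hx (f := fun _ => c k) mdifferentiableAt_const (hb k),
      hD'.smul_apply hx (f := fun _ => c k) mdifferentiableAt_const (hb k), hv k]
    simp only [differential_const, LinearMap.zero_apply]
    module
  simp only [e] at key
  have e2 : ∑ k, c k • (Υ v • b x k + Υ (b x k) • v) = Υ v • X x + Υ (X x) • v := by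
    conv_rhs => rw [h1]
    simp only [map_sum, map_smul, smul_add, Finset.sum_add_distrib, Finset.smul_sum,
      Finset.sum_smul, smul_eq_mul, mul_smul]
    congr 1
    exact Finset.sum_congr rfl fun k _ => smul_comm _ _ _
  rw [e2, sub_eq_iff_eq_add] at key
  rw [key]
  abel

/-- The one-form `Υ` in `D' = D + Υ` is determined by a trace. -/
theorem ProjRelAt.trace {D D' : ConnOp n M} {x : M} {Υ : Module.Dual ℝ (Tan n x)}
    (h : ProjRelAt D D' x Υ) {b : ∀ x : M, Frame n x}
    (hb : ∀ k, DiffVectorAt (fun y => b y k) x) (v : Tan n x) :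
    ∑ k, (b x).repr (D' (fun y => b y k) x v - D (fun y => b y k) x v) k = (n + 2) * Υ v := by
  have e : ∀ k, (b x).repr (D' (fun y => b y k) x v - D (fun y => b y k) x v) k
      = Υ v + Υ ((b x).repr v k • b x k) := by
    intro k
    rw [h _ (hb k) v, add_assoc, add_sub_cancel_left]
    simp only [map_add, map_smul, Finsupp.add_apply, Finsupp.smul_apply, Module.Basis.repr_self,
      Finsupp.single_eq_same, smul_eq_mul, mul_one]
    ring
  -- The first term contributes `(n + 1) Υ v`, one for each basis vector, and the second contributes
  -- `Υ v` once.
  simp only [e, Finset.sum_add_distrib, ← map_sum, (b x).sum_repr v]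
  simp
  ring

theorem ProjRelAt.unique {D D' : ConnOp n M} {x : M} {Υ Υ' : Module.Dual ℝ (Tan n x)}
    (h : ProjRelAt D D' x Υ) (h' : ProjRelAt D D' x Υ') : Υ = Υ' := by
  ext v
  have hb := fun k => diffVectorAt_coordFrame (n := n) (mem_chart_source _ x) k
  have h1 := h.trace hb v
  rw [h'.trace hb v] at h1
  have : ((n : ℝ) + 2) ≠ 0 := by positivity
  exact (mul_left_cancel₀ this h1).symm

theorem ProjRelAt.refl (D : ConnOp n M) (x : M) : ProjRelAt D D x 0 := by
  intro X _ v
  simp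

theorem ProjRelAt.symm {D D' : ConnOp n M} {x : M} {Υ : Module.Dual ℝ (Tan n x)}
    (h : ProjRelAt D D' x Υ) : ProjRelAt D' D x (-Υ) := by
  intro X hX v
  rw [h X hX v]
  simp only [LinearMap.neg_apply]
  module

theorem ProjRelAt.trans {D D' D'' : ConnOp n M} {x : M} {Υ Υ' : Module.Dual ℝ (Tan n x)}
    (h : ProjRelAt D D' x Υ) (h' : ProjRelAt D' D'' x Υ') : ProjRelAt D D'' x (Υ + Υ') := by
  intro X hX v
  rw [h' X hX v, h X hX v]
  simp only [LinearMap.add_apply]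
  module

/-- A field of covectors is smooth on `W`: it is smooth on smooth vector fields. -/
def SmoothFormOn (Υ : ∀ x : M, Module.Dual ℝ (Tan n x)) (W : Set M) : Prop :=
  ∀ W' ⊆ W, IsOpen W' → ∀ X : ∀ x : M, Tan n x, SmoothVectorOn X W' →
    SmoothFnOn n (fun y => Υ y (X y)) W'

/-- Two smooth connections which are projectively related in the interior are projectively related
up to the boundary, by a smooth one-form. -/
theorem exists_smoothForm_projRelAt {D D' : ConnOp n M} {W : Set M} (hW : IsOpen W)
    (hD : IsAffineConnectionOn D W) (hD' : IsAffineConnectionOn D' W)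
    (h : ∀ y ∈ W ∩ (𝓡∂ (n + 1)).interior M, ∃ Υ, ProjRelAt D D' y Υ) :
    ∃ Υ : ∀ x : M, Module.Dual ℝ (Tan n x), SmoothFormOn Υ W ∧
      ∀ x ∈ W, ProjRelAt D D' x (Υ x) := by
  have hn : ((n : ℝ) + 2) ≠ 0 := by positivity
  -- The trace formula recovers the one-form from the two connections. It makes sense and is smooth
  -- at boundary points as well, where no relation is known yet.
  let θ : M → ∀ y : M, Module.Dual ℝ (Tan n y) := fun x₀ y =>
    ((n : ℝ) + 2)⁻¹ • ∑ k, (coordFrame x₀ y).coord k ∘ₗ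
      (D' (fun z => coordFrame x₀ z k) y - D (fun z => coordFrame x₀ z k) y).toLinearMap
  have hθ : ∀ x₀ y (v : Tan n y), θ x₀ y v = ((n : ℝ) + 2)⁻¹ * ∑ k, (coordFrame x₀ y).repr
      (D' (fun z => coordFrame x₀ z k) y v - D (fun z => coordFrame x₀ z k) y v) k := by
    intro x₀ y v
    simp [θ]
  have hθsm : ∀ x₀ W', IsOpen W' → W' ⊆ W ∩ (chartAt (EuclideanHalfSpace (n + 1)) x₀).source →
      ∀ X : ∀ x : M, Tan n x, SmoothVectorOn X W' → SmoothFnOn n (fun y => θ x₀ y (X y)) W' := by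
    intro x₀ W' hW' hsub X hX
    have hb := (isSmoothFrameOn_coordFrame (n := n) x₀).mono (fun y hy => (hsub hy).2)
    have hs : W' ⊆ W := fun y hy => (hsub hy).1
    have : SmoothFnOn n (fun y => ((n : ℝ) + 2)⁻¹ * ∑ k, (coordFrame x₀ y).repr
        (D' (fun z => coordFrame x₀ z k) y (X y) - D (fun z => coordFrame x₀ z k) y (X y)) k) W' :=
      contMDiffOn_const.mul (smoothFnOn_sum fun k _ => SmoothVectorOn.repr
        ((hD'.smooth_apply hW' hs hX (hb k)).sub (hD.smooth_apply hW' hs hX (hb k))) hb k)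
    exact this.congr fun y _ => hθ x₀ y (X y)
  have hrel : ∀ x₀, ∀ y ∈ W ∩ (chartAt (EuclideanHalfSpace (n + 1)) x₀).source,
      ProjRelAt D D' y (θ x₀ y) := by
    intro x₀ y hy
    set W' := W ∩ (chartAt (EuclideanHalfSpace (n + 1)) x₀).source with hWdef
    have hW' : IsOpen W' := hW.inter (chartAt _ x₀).open_source
    have hb := (isSmoothFrameOn_coordFrame (n := n) x₀).mono (W' := W') inter_subset_right
    have hs : W' ⊆ W := inter_subset_left
    refine projRelAt_of_frame (b := fun y => coordFrame x₀ y) hD hD' hy.1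
      (fun k => diffVectorAt_coordFrame hy.2 k) (fun k i => ?_)
    refine (coordFrame x₀ y).repr.injective (Finsupp.ext fun l => ?_)
    refine eqOn_of_eqOn_interior (n := n) hW'
      (f := fun y => (coordFrame x₀ y).repr
        (D' (fun y => coordFrame x₀ y k) y (coordFrame x₀ y i)) l)
      (g := fun y => (coordFrame x₀ y).repr (D (fun y => coordFrame x₀ y k) y (coordFrame x₀ y i)
        + θ x₀ y (coordFrame x₀ y i) • coordFrame x₀ y k
        + θ x₀ y (coordFrame x₀ y k) • coordFrame x₀ y i) l) ?_ ?_ ?_ hy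
    · exact (SmoothVectorOn.repr (hD'.smooth_apply hW' hs (hb i) (hb k)) hb l).continuousOn
    · refine ContMDiffOn.continuousOn (SmoothVectorOn.repr (((hD.smooth_apply hW' hs (hb i)
        (hb k)).add (SmoothVectorOn.smul (hθsm x₀ W' hW' subset_rfl _ (hb i)) (hb k))).add
        (SmoothVectorOn.smul (hθsm x₀ W' hW' subset_rfl _ (hb k)) (hb i))) hb l)
    · intro z hz
      obtain ⟨Υ, hΥ⟩ := h z ⟨hz.1.1, hz.2⟩
      have hbz := fun k => diffVectorAt_coordFrame (n := n) hz.1.2 k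
      have hΥθ : θ x₀ z = Υ := by
        ext v
        rw [hθ, hΥ.trace hbz v, inv_mul_cancel_left₀ hn]
      rw [hΥθ, hΥ _ (hbz k)]
  -- Here the chart changes with the point. Smoothness near `x₀` follows since, by uniqueness of the
  -- one-form, `θ x x` agrees with `θ x₀ x` there.
  refine ⟨fun x => θ x x, ?_, fun x hx => hrel x x ⟨hx, mem_chart_source _ x⟩⟩
  intro W' hW'W hW' X hX
  refine contMDiffOn_of_locally_contMDiffOn fun x₀ hx₀ =>
    ⟨(chartAt (EuclideanHalfSpace (n + 1)) x₀).source, (chartAt _ x₀).open_source,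
      mem_chart_source _ x₀, ?_⟩
  refine (hθsm x₀ _ (mem_source_inter_open hW' x₀) (fun y hy => ⟨hW'W hy.1, hy.2⟩) X
    (hX.mono inter_subset_left)).congr (fun y hy => ?_)
  exact congrArg (fun L : Module.Dual ℝ (Tan n y) => L (X y))
    ((hrel y y ⟨hW'W hy.1, mem_chart_source _ y⟩).unique (hrel x₀ y ⟨hW'W hy.1, hy.2⟩))

end Connections

/-! ### Curvature, Ricci and Schouten tensors -/

section Curvature

variable {n : ℕ} {M : Type*} [TopologicalSpace M] [ChartedSpace (EuclideanHalfSpace (n + 1)) M]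
  [IsManifold (𝓡∂ (n + 1)) ∞ M]

/-- Both sides are the trace of the endomorphism `e a ↦ L a`, computed in `b` and in `e`. -/
theorem sum_repr_trace {ι V : Type*} [Fintype ι] [AddCommGroup V] [Module ℝ V]
    (e b : Module.Basis ι ℝ V) (L : ι → V) :
    ∑ i, b.repr (∑ a, e.repr (b i) a • L a) i = ∑ a, e.repr (L a) a := by
  have h : ∀ a, e.repr (L a) a = ∑ i, b.repr (L a) i * e.repr (b i) a := by
    intro a
    conv_lhs => rw [← b.sum_repr (L a)]
    simp only [map_sum, map_smul, Finsupp.coe_finsetSum, Finset.sum_apply, Finsupp.smul_apply,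
      smul_eq_mul]
  simp only [h, map_sum, map_smul, Finsupp.coe_finsetSum, Finset.sum_apply, Finsupp.smul_apply,
    smul_eq_mul]
  rw [Finset.sum_comm]
  exact Finset.sum_congr rfl fun a _ => Finset.sum_congr rfl fun i _ => mul_comm _ _

namespace IsAffineConnectionOn

variable {D : ConnOp n M} {W W' : Set M}

theorem sum_smul_apply (hD : IsAffineConnectionOn D W) {ι : Type*} [Fintype ι]
    {X : ι → ∀ x : M, Tan n x} {f : ι → M → ℝ} {x : M} (hx : x ∈ W)
    (hf : ∀ i, DiffFnAt n (f i) x) (hX : ∀ i, DiffVectorAt (X i) x) (v : Tan n x) :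
    D (fun y => ∑ i, f i y • X i y) x v
      = ∑ i, (f i x • D (X i) x v + differential (f i) x v • X i x) := by
  rw [(hD.sum_apply Finset.univ hx (X := fun i y => f i y • X i y)
    (fun i _ => MDifferentiableAt.smul_section (hf i) (hX i)) v).2]
  exact Finset.sum_congr rfl fun i _ => hD.smul_apply hx (hf i) (hX i) v

/-- Once the bracket is rewritten by torsion-freeness, the two terms containing derivatives of the
coefficients cancel, and no derivation property of the bracket is needed. -/
theorem curvature_sum_left (hD : IsAffineConnectionOn D W) (hW' : IsOpen W') (hs : W' ⊆ W)
    {ι : Type*} [Fintype ι] {X : ι → ∀ x : M, Tan n x} {f : ι → M → ℝ} {Y Z : ∀ x : M, Tan n x}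
    (hf : ∀ i, SmoothFnOn n (f i) W') (hX : ∀ i, SmoothVectorOn (X i) W')
    (hY : SmoothVectorOn Y W') (hZ : SmoothVectorOn Z W') {x : M} (hx : x ∈ W') :
    curvature D (fun y => ∑ i, f i y • X i y) Y Z x = ∑ i, f i x • curvature D (X i) Y Z x := by
  have hS : SmoothVectorOn (fun y => ∑ i, f i y • X i y) W' :=
    SmoothVectorOn.sum fun i _ => SmoothVectorOn.smul (hf i) (hX i)
  have hfd := fun i => (hf i).diffFnAt hW' hx
  have hXd := fun i => (hX i).diffAt hW' hx
  have e2 : (fun y => D Z y (∑ i, f i y • X i y)) = fun y => ∑ i, f i y • D Z y (X i y) := by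
    funext y
    simp
  have e3 : ∀ i, VectorField.mlieBracket (𝓡∂ (n + 1)) (X i) Y x
      = D Y x (X i x) - D (X i) x (Y x) := fun i => (hD.torsion hW' hs (hX i) hY hx).symm
  simp only [curvature]
  rw [e2, ← hD.torsion hW' hs hS hY hx, hD.sum_smul_apply (hs hx) hfd hXd,
    hD.sum_smul_apply (hs hx) hfd (fun i => (hD.smooth_apply hW' hs (hX i) hZ).diffAt hW' hx)]
  simp only [e3, map_sum, map_smul, map_sub, map_add, smul_sub, Finset.sum_sub_distrib,
    Finset.sum_add_distrib]
  abel

theorem curvature_swap (X Y Z : ∀ x : M, Tan n x) (x : M) :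
    curvature D X Y Z x = - curvature D Y X Z x := by
  simp only [curvature]
  rw [VectorField.mlieBracket_swap_apply (V := X)]
  simp only [map_neg]
  abel

/-- First derivatives of the coefficients cancel by symmetry. The second derivatives form a
commutator, which the bracket term removes through `differential_mlieBracket`. -/
theorem curvature_sum_right (hD : IsAffineConnectionOn D W) (hW : IsOpen W) (hW' : IsOpen W')
    (hs : W' ⊆ W) {ι : Type*} [Fintype ι] {Z : ι → ∀ x : M, Tan n x} {f : ι → M → ℝ}
    {X Y : ∀ x : M, Tan n x} (hf : ∀ i, SmoothFnOn n (f i) W') (hX : SmoothVectorOn X W')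
    (hY : SmoothVectorOn Y W') (hZ : ∀ i, SmoothVectorOn (Z i) W') {x : M} (hx : x ∈ W') :
    curvature D X Y (fun y => ∑ i, f i y • Z i y) x = ∑ i, f i x • curvature D X Y (Z i) x := by
  have hS : SmoothVectorOn (fun y => ∑ i, f i y • Z i y) W' :=
    SmoothVectorOn.sum fun i _ => SmoothVectorOn.smul (hf i) (hZ i)
  have key : ∀ {A B : ∀ x : M, Tan n x}, SmoothVectorOn A W' → SmoothVectorOn B W' →
      D (fun y => D (fun y => ∑ i, f i y • Z i y) y (A y)) x (B x)
        = ∑ i, ((f i x • D (fun y => D (Z i) y (A y)) x (B x)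
            + differential (f i) x (B x) • D (Z i) x (A x))
          + (differential (f i) x (A x) • D (Z i) x (B x)
            + differential (fun y => differential (f i) y (A y)) x (B x) • Z i x)) := by
    intro A B hA hB
    have h1 : ∀ᶠ y in 𝓝 x, D (fun y => ∑ i, f i y • Z i y) y (A y)
        = (∑ i, f i y • D (Z i) y (A y)) + ∑ i, differential (f i) y (A y) • Z i y := by
      filter_upwards [hW'.mem_nhds hx] with y hy
      rw [hD.sum_smul_apply (hs hy) (fun i => (hf i).diffFnAt hW' hy)
        (fun i => (hZ i).diffAt hW' hy), Finset.sum_add_distrib]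
    have s1 : ∀ i, SmoothVectorOn (fun y => D (Z i) y (A y)) W' := fun i =>
      hD.smooth_apply hW' hs hA (hZ i)
    have s2 : ∀ i, SmoothFnOn n (fun y => differential (f i) y (A y)) W' := fun i =>
      (hf i).differential hW' hA
    have d1 : DiffVectorAt (fun y => ∑ i, f i y • D (Z i) y (A y)) x :=
      (SmoothVectorOn.sum fun i _ => SmoothVectorOn.smul (hf i) (s1 i)).diffAt hW' hx
    have d2 : DiffVectorAt (fun y => ∑ i, differential (f i) y (A y) • Z i y) x :=
      (SmoothVectorOn.sum fun i _ => SmoothVectorOn.smul (s2 i) (hZ i)).diffAt hW' hx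
    rw [hD.congr hW (hs hx) ((hD.smooth_apply hW' hs hA hS).diffAt hW' hx) h1,
      hD.add_apply (hs hx) d1 d2,
      hD.sum_smul_apply (hs hx) (fun i => (hf i).diffFnAt hW' hx) (fun i => (s1 i).diffAt hW' hx),
      hD.sum_smul_apply (hs hx) (fun i => (s2 i).diffFnAt hW' hx)
        (fun i => (hZ i).diffAt hW' hx), ← Finset.sum_add_distrib]
  simp only [curvature]
  rw [key hY hX, key hX hY, hD.sum_smul_apply (hs hx) (fun i => (hf i).diffFnAt hW' hx)
    (fun i => (hZ i).diffAt hW' hx), ← Finset.sum_sub_distrib, ← Finset.sum_sub_distrib]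
  refine Finset.sum_congr rfl fun i _ => ?_
  rw [differential_mlieBracket hW' hX hY (hf i) hx]
  module

/-- The curvature is tensorial. -/
theorem curvature_expand (hD : IsAffineConnectionOn D W) (hW : IsOpen W) (hW' : IsOpen W')
    (hs : W' ⊆ W) {X Y Z : ∀ x : M, Tan n x} (hX : SmoothVectorOn X W')
    (hY : SmoothVectorOn Y W') (hZ : SmoothVectorOn Z W') {e : ∀ x : M, Frame n x}
    (he : IsSmoothFrameOn e W') {x : M} (hx : x ∈ W') :
    curvature D X Y Z x = ∑ a, (e x).repr (X x) a • ∑ c, (e x).repr (Y x) c •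
      ∑ d, (e x).repr (Z x) d • curvature D (fun y => e y a) (fun y => e y c)
        (fun y => e y d) x := by
  have hexp : ∀ X : ∀ x : M, Tan n x, X = fun y => ∑ a, (e y).repr (X y) a • e y a := fun X =>
    funext fun y => ((e y).sum_repr (X y)).symm
  have h1 : curvature D X Y Z x
      = ∑ a, (e x).repr (X x) a • curvature D (fun y => e y a) Y Z x := by
    conv_lhs => rw [hexp X]
    exact hD.curvature_sum_left hW' hs (fun a => hX.repr he a) he hY hZ hx
  rw [h1]
  refine Finset.sum_congr rfl fun a _ => ?_
  have h2 : curvature D (fun y => e y a) Y Z x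
      = ∑ c, (e x).repr (Y x) c • curvature D (fun y => e y a) (fun y => e y c) Z x := by
    rw [curvature_swap]
    conv_lhs => rw [hexp Y]
    rw [hD.curvature_sum_left hW' hs (fun a => hY.repr he a) he (he a) hZ hx,
      ← Finset.sum_neg_distrib]
    refine Finset.sum_congr rfl fun c _ => ?_
    rw [← smul_neg, ← curvature_swap]
  rw [h2]
  congr 1
  refine Finset.sum_congr rfl fun c _ => ?_
  congr 1
  conv_lhs => rw [hexp Z]
  exact hD.curvature_sum_right hW hW' hs (fun d => hZ.repr he d) (he a) (he c) he hx

theorem smooth_curvature (hD : IsAffineConnectionOn D W) (hW' : IsOpen W')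
    (hs : W' ⊆ W) {X Y Z : ∀ x : M, Tan n x} (hX : SmoothVectorOn X W')
    (hY : SmoothVectorOn Y W') (hZ : SmoothVectorOn Z W') :
    SmoothVectorOn (fun y => curvature D X Y Z y) W' := by
  -- Replacing the bracket by `D_X Y - D_Y X` leaves only covariant derivatives of smooth fields.
  refine SmoothVectorOn.congr (X := fun y => D (fun y => D Z y (Y y)) y (X y)
    - D (fun y => D Z y (X y)) y (Y y) - D Z y (D Y y (X y) - D X y (Y y))) ?_ (fun y hy => ?_)
  · exact ((hD.smooth_apply hW' hs hX (hD.smooth_apply hW' hs hY hZ)).sub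
      (hD.smooth_apply hW' hs hY (hD.smooth_apply hW' hs hX hZ))).sub
      (hD.smooth_apply hW' hs ((hD.smooth_apply hW' hs hX hY).sub
        (hD.smooth_apply hW' hs hY hX)) hZ)
  · rw [hD.torsion hW' hs hX hY hy]
    rfl

end IsAffineConnectionOn

/-- The Ricci tensor as a bilinear form. -/
noncomputable def ricciForm (D : ConnOp n M) (x : M) : LinearMap.BilinForm ℝ (Tan n x) :=
  Matrix.toLinearMap₂ (coordFrame x x) (coordFrame x x) (Matrix.of (ricciComp D x))

theorem ricciForm_coordFrame (D : ConnOp n M) (x : M) (j k : Fin (n + 1)) :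
    ricciForm D x (coordFrame x x j) (coordFrame x x k) = ricciComp D x j k := by
  rw [ricciForm, Matrix.toLinearMap₂_apply_basis]
  rfl

theorem schouten_apply (D : ConnOp n M) (x : M) (u v : Tan n x) :
    schouten D x u v
      = ((n + 1) * ricciForm D x u v + ricciForm D x v u) / ((n : ℝ) * (n + 2)) := by
  have : schouten D x = ((n : ℝ) * (n + 2))⁻¹ •
      (((n : ℝ) + 1) • ricciForm D x + (ricciForm D x).flip) := by
    refine LinearMap.ext_basis (coordFrame x x) (coordFrame x x) fun j k => ?_
    simp only [schouten, Matrix.toLinearMap₂_apply_basis, Matrix.of_apply, LinearMap.smul_apply,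
      LinearMap.add_apply, LinearMap.BilinForm.flip_apply, ricciForm_coordFrame, smul_eq_mul]
    rw [div_eq_inv_mul]
  rw [this]
  simp only [LinearMap.smul_apply, LinearMap.add_apply, LinearMap.BilinForm.flip_apply, smul_eq_mul]
  rw [div_eq_inv_mul]

/-- The components in `ricciComp` use the preferred chart at each point, which need not vary
continuously. Since the curvature is tensorial and a trace is basis independent, any smooth frame
computes the same form; smoothness of Ricci and Schouten depends on this. -/
theorem ricciForm_frame {D : ConnOp n M} {W W' : Set M} (hD : IsAffineConnectionOn D W)
    (hW : IsOpen W) (hW' : IsOpen W') (hs : W' ⊆ W) {b : ∀ x : M, Frame n x}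
    (hb : IsSmoothFrameOn b W') {x : M} (hx : x ∈ W') (j k : Fin (n + 1)) :
    ricciForm D x (b x j) (b x k) = ∑ i, (b x).repr
      (curvature D (fun y => b y i) (fun y => b y j) (fun y => b y k) x) i := by
  have hW'' := mem_source_inter_open (n := n) hW' x
  set W'' := W' ∩ (chartAt (EuclideanHalfSpace (n + 1)) x).source with hdef
  have hx'' : x ∈ W'' := ⟨hx, mem_chart_source _ x⟩
  have hb' := hb.mono (W' := W'') inter_subset_left
  have he := (isSmoothFrameOn_coordFrame (n := n) x).mono (W' := W'') inter_subset_right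
  have hexp := fun i => hD.curvature_expand hW hW'' (inter_subset_left.trans hs) (hb' i) (hb' j)
    (hb' k) he hx''
  simp only [hexp]
  rw [sum_repr_trace (coordFrame x x) (b x)]
  conv_lhs => rw [← (coordFrame x x).sum_repr (b x j), ← (coordFrame x x).sum_repr (b x k)]
  simp only [map_sum, map_smul, LinearMap.coe_sum, Finset.sum_apply, LinearMap.smul_apply,
    ricciForm_coordFrame, ricciComp, smul_eq_mul, Finsupp.coe_finsetSum, Finsupp.smul_apply]
  simp only [Finset.mul_sum]
  rw [Finset.sum_comm]
  refine (Finset.sum_congr rfl fun c _ => Finset.sum_comm).trans ?_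
  rw [Finset.sum_comm]
  refine Finset.sum_congr rfl fun a _ => ?_
  refine Finset.sum_congr rfl fun c _ => Finset.sum_congr rfl fun d _ => ?_
  ring

end Curvature

/-! ### Smoothness and projective change of the Ricci and Schouten tensors -/

section SchoutenHessian

variable {n : ℕ} {M : Type*} [TopologicalSpace M] [ChartedSpace (EuclideanHalfSpace (n + 1)) M]
  [IsManifold (𝓡∂ (n + 1)) ∞ M]

theorem IsAffineConnectionOn.smoothBilinOn_ricciForm {D : ConnOp n M} {W : Set M}
    (hD : IsAffineConnectionOn D W) (hW : IsOpen W) : SmoothBilinOn (ricciForm D) W := by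
  intro W' hs hW' b hb i j
  refine ContMDiffOn.congr (f := fun x => ∑ k, (b x).repr
    (curvature D (fun y => b y k) (fun y => b y i) (fun y => b y j) x) k) ?_
    (fun x hx => ricciForm_frame hD hW hW' hs hb hx i j)
  exact smoothFnOn_sum fun k _ =>
    SmoothVectorOn.repr (hD.smooth_curvature hW' hs (hb k) (hb i) (hb j)) hb k

theorem IsAffineConnectionOn.smoothBilinOn_schouten {D : ConnOp n M} {W : Set M}
    (hD : IsAffineConnectionOn D W) (hW : IsOpen W) : SmoothBilinOn (schouten D) W := by
  intro W' hs hW' b hb i j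
  have h := hD.smoothBilinOn_ricciForm hW W' hs hW' b hb
  refine ContMDiffOn.congr (f := fun x => (((n : ℝ) + 1) * ricciForm D x (b x i) (b x j)
    + ricciForm D x (b x j) (b x i)) * ((n : ℝ) * (n + 2))⁻¹) ?_
    (fun x hx => by rw [schouten_apply, div_eq_mul_inv])
  exact ((contMDiffOn_const.mul (h i j)).add (h j i)).mul contMDiffOn_const

/-- The tensor `(D_X Υ)(Z) - Υ(X) Υ(Z)` at `x`. -/
noncomputable def rhoForm (D : ConnOp n M) (Υ : ∀ x : M, Module.Dual ℝ (Tan n x))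
    (X Z : ∀ x : M, Tan n x) (x : M) : ℝ :=
  differential (fun y => Υ y (Z y)) x (X x) - Υ x (D Z x (X x)) - Υ x (X x) * Υ x (Z x)

/-- Expand both covariant derivatives by `D' = D + Υ`. Torsion-freeness turns the bracket into `D_X
Y - D_Y X`, which cancels the derivatives of `X` and `Y`; what remains is grouped into `rhoForm`. -/
theorem curvature_of_projRelAt {D D' : ConnOp n M} {W : Set M} (hW : IsOpen W)
    (hD : IsAffineConnectionOn D W) (hD' : IsAffineConnectionOn D' W)
    {Υ : ∀ x : M, Module.Dual ℝ (Tan n x)} (hΥ : SmoothFormOn Υ W)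
    (h : ∀ y ∈ W, ProjRelAt D D' y (Υ y)) {X Y Z : ∀ x : M, Tan n x} (hX : SmoothVectorOn X W)
    (hY : SmoothVectorOn Y W) (hZ : SmoothVectorOn Z W) {x : M} (hx : x ∈ W) :
    curvature D' X Y Z x = curvature D X Y Z x
      + (rhoForm D Υ X Y x - rhoForm D Υ Y X x) • Z x + rhoForm D Υ X Z x • Y x
      - rhoForm D Υ Y Z x • X x := by
  have hsm : ∀ {X : ∀ x : M, Tan n x}, SmoothVectorOn X W → SmoothFnOn n (fun y => Υ y (X y)) W :=
    fun hX => hΥ W subset_rfl hW _ hX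
  have key : ∀ {A B : ∀ x : M, Tan n x}, SmoothVectorOn A W → SmoothVectorOn B W →
      D' (fun y => D' Z y (A y)) x (B x) = D (fun y => D Z y (A y)) x (B x)
        + (Υ x (A x) • D Z x (B x) + differential (fun y => Υ y (A y)) x (B x) • Z x)
        + (Υ x (Z x) • D A x (B x) + differential (fun y => Υ y (Z y)) x (B x) • A x)
        + Υ x (B x) • (D Z x (A x) + Υ x (A x) • Z x + Υ x (Z x) • A x)
        + Υ x (D Z x (A x) + Υ x (A x) • Z x + Υ x (Z x) • A x) • B x := by
    intro A B hA hB
    have s1 := hD.smooth_apply hW subset_rfl hA hZ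
    have s2 := SmoothVectorOn.smul (hsm hA) hZ
    have s3 := SmoothVectorOn.smul (hsm hZ) hA
    have e : ∀ y ∈ W, D' Z y (A y) = D Z y (A y) + Υ y (A y) • Z y + Υ y (Z y) • A y :=
      fun y hy => h y hy Z (hZ.diffAt hW hy) (A y)
    have d0 := (hD'.smooth_apply hW subset_rfl hA hZ).diffAt hW hx
    rw [h x hx _ d0, e x hx,
      hD.congr hW hx d0 (by filter_upwards [hW.mem_nhds hx] with y hy using e y hy),
      hD.add_apply hx ((s1.add s2).diffAt hW hx) (s3.diffAt hW hx),
      hD.add_apply hx (s1.diffAt hW hx) (s2.diffAt hW hx),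
      hD.smul_apply hx ((hsm hA).diffFnAt hW hx) (hZ.diffAt hW hx),
      hD.smul_apply hx ((hsm hZ).diffFnAt hW hx) (hA.diffAt hW hx)]
  have ht := hD.torsion hW subset_rfl hX hY hx
  simp only [curvature]
  rw [key hY hX, key hX hY, h x hx _ (hZ.diffAt hW hx), ← ht]
  simp only [rhoForm, map_add, map_sub, map_smul, smul_eq_mul]
  module

theorem ricciComp_of_projRelAt {D D' : ConnOp n M} {W : Set M} (hW : IsOpen W)
    (hD : IsAffineConnectionOn D W) (hD' : IsAffineConnectionOn D' W)
    {Υ : ∀ x : M, Module.Dual ℝ (Tan n x)} (hΥ : SmoothFormOn Υ W)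
    (h : ∀ y ∈ W, ProjRelAt D D' y (Υ y)) {x : M} (hx : x ∈ W) (j k : Fin (n + 1)) :
    ricciComp D' x j k = ricciComp D x j k
      + rhoForm D Υ (fun y => coordFrame x y k) (fun y => coordFrame x y j) x
      - (n + 1) * rhoForm D Υ (fun y => coordFrame x y j) (fun y => coordFrame x y k) x := by
  have hW' := mem_source_inter_open (n := n) hW x
  set W' := W ∩ (chartAt (EuclideanHalfSpace (n + 1)) x).source with hdef
  have hx' : x ∈ W' := ⟨hx, mem_chart_source _ x⟩
  have hs : W' ⊆ W := inter_subset_left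
  have he := (isSmoothFrameOn_coordFrame (n := n) x).mono (W' := W') inter_subset_right
  have hΥ' : SmoothFormOn Υ W' := fun V hV => hΥ V (hV.trans hs)
  simp only [ricciComp]
  rw [Finset.sum_congr rfl fun i _ => by
    rw [curvature_of_projRelAt hW' (hD.mono hs) (hD'.mono hs) hΥ' (fun y hy => h y (hs hy))
      (he i) (he j) (he k) hx']]
  simp only [map_add, map_sub, map_smul, Finsupp.add_apply, Finsupp.sub_apply, Finsupp.smul_apply,
    Module.Basis.repr_self, smul_eq_mul, Finset.sum_add_distrib, Finset.sum_sub_distrib,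
    Finsupp.single_apply, mul_ite, mul_one, mul_zero, Finset.sum_ite_eq, Finset.mem_univ, if_true]
  simp
  ring

/-- The combination `(n + 1) Ric_{jk} + Ric_{kj}` eliminates the transposed `rhoForm` term and
leaves `-n (n + 2)` times the other one. Division by `n (n + 2)` is where `n ≠ 0` enters. -/
theorem schouten_of_projRelAt (hn : 1 ≤ n) {D D' : ConnOp n M} {W : Set M} (hW : IsOpen W)
    (hD : IsAffineConnectionOn D W) (hD' : IsAffineConnectionOn D' W)
    {Υ : ∀ x : M, Module.Dual ℝ (Tan n x)} (hΥ : SmoothFormOn Υ W)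
    (h : ∀ y ∈ W, ProjRelAt D D' y (Υ y)) {x : M} (hx : x ∈ W) (j k : Fin (n + 1)) :
    schouten D' x (coordFrame x x j) (coordFrame x x k)
      = schouten D x (coordFrame x x j) (coordFrame x x k)
        - rhoForm D Υ (fun y => coordFrame x y j) (fun y => coordFrame x y k) x := by
  have hn' : (n : ℝ) ≠ 0 := by positivity
  have hn2 : (n : ℝ) + 2 ≠ 0 := by positivity
  simp only [schouten_apply, ricciForm_coordFrame]
  rw [ricciComp_of_projRelAt hW hD hD' hΥ h hx j k, ricciComp_of_projRelAt hW hD hD' hΥ h hx k j]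
  field_simp
  ring

/-! ### The Hessian of a function -/

theorem hessian_coordFrame (D : ConnOp n M) (f : M → ℝ) (x : M) (j k : Fin (n + 1)) :
    hessian D f x (coordFrame x x j) (coordFrame x x k)
      = differential (fun y => differential f y (coordFrame x y k)) x (coordFrame x x j)
      - differential f x (D (fun y => coordFrame x y k) x (coordFrame x x j)) := by
  rw [hessian, Matrix.toLinearMap₂_apply_basis]
  rfl

/-- The definition only knows coordinate fields at the base point. Expanding `Y` in the coordinate
frame, the derivatives of its components cancel between the two terms. -/
theorem hessian_apply {D : ConnOp n M} {W W' : Set M} (hD : IsAffineConnectionOn D W)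
    (hW' : IsOpen W') (hs : W' ⊆ W) {f : M → ℝ} (hf : SmoothFnOn n f W')
    {Y : ∀ x : M, Tan n x} (hY : SmoothVectorOn Y W') {x : M} (hx : x ∈ W') (u : Tan n x) :
    hessian D f x u (Y x)
      = differential (fun y => differential f y (Y y)) x u - differential f x (D Y x u) := by
  have hW'' := mem_source_inter_open (n := n) hW' x
  set W'' := W' ∩ (chartAt (EuclideanHalfSpace (n + 1)) x).source with hdef
  have hx'' : x ∈ W'' := ⟨hx, mem_chart_source _ x⟩
  have hs' : W'' ⊆ W' := inter_subset_left
  have he := (isSmoothFrameOn_coordFrame (n := n) x).mono (W' := W'') inter_subset_right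
  have hc := fun k => (hY.mono hs').repr he k
  have hfe : ∀ k, SmoothFnOn n (fun y => differential f y (coordFrame x y k)) W'' :=
    fun k => SmoothFnOn.differential hW'' (hf.mono hs') (he k)
  have hk : ∀ k, hessian D f x u (coordFrame x x k)
      = differential (fun y => differential f y (coordFrame x y k)) x u
        - differential f x (D (fun y => coordFrame x y k) x u) := by
    intro k
    have : (hessian D f x).flip (coordFrame x x k)
        = differential (fun y => differential f y (coordFrame x y k)) x
        - differential f x ∘ₗ (D (fun y => coordFrame x y k) x).toLinearMap := by
      refine (coordFrame x x).ext fun j => ?_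
      exact hessian_coordFrame D f x j k
    exact congrArg (fun L : Module.Dual ℝ (Tan n x) => L u) this
  have hexp : Y = fun y => ∑ k, (coordFrame x y).repr (Y y) k • coordFrame x y k :=
    funext fun y => ((coordFrame x y).sum_repr (Y y)).symm
  have e1 : D Y x u = ∑ k, ((coordFrame x x).repr (Y x) k • D (fun y => coordFrame x y k) x u
      + differential (fun y => (coordFrame x y).repr (Y y) k) x u • coordFrame x x k) := by
    conv_lhs => rw [hexp]
    exact hD.sum_smul_apply (hs hx) (fun k => SmoothFnOn.diffFnAt (hc k) hW'' hx'')
      (fun k => SmoothVectorOn.diffAt (he k) hW'' hx'') u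
  have e2 : (fun y => differential f y (Y y))
      = fun y => ∑ k, (coordFrame x y).repr (Y y) k * differential f y (coordFrame x y k) := by
    funext y
    conv_lhs => rw [← (coordFrame x y).sum_repr (Y y)]
    simp only [map_sum, map_smul, smul_eq_mul]
  rw [e1, e2, (differential_sum (n := n) Finset.univ (f := fun k y => (coordFrame x y).repr (Y y) k *
    differential f y (coordFrame x y k)) (fun k _ => SmoothFnOn.diffFnAt
    (ContMDiffOn.mul (hc k) (hfe k)) hW'' hx'') u).2]
  conv_lhs => rw [← (coordFrame x x).sum_repr (Y x)]
  simp only [map_sum, map_smul, map_add, smul_eq_mul, hk]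
  rw [← Finset.sum_sub_distrib]
  refine Finset.sum_congr rfl fun k _ => ?_
  rw [differential_mul (SmoothFnOn.diffFnAt (hc k) hW'' hx'')
    (SmoothFnOn.diffFnAt (hfe k) hW'' hx'')]
  ring

theorem smoothBilinOn_hessian {D : ConnOp n M} {W : Set M} (hD : IsAffineConnectionOn D W)
    {f : M → ℝ} (hf : SmoothFnOn n f W) : SmoothBilinOn (hessian D f) W := by
  intro W' hs hW' b hb i j
  refine ContMDiffOn.congr (f := fun x => differential (fun y => differential f y (b y j)) x (b x i)
    - differential f x (D (fun y => b y j) x (b x i))) ?_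
    (fun x hx => hessian_apply hD hW' hs (hf.mono hs) (hb j) hx (b x i))
  exact ContMDiffOn.sub (SmoothFnOn.differential hW' (SmoothFnOn.differential hW' (hf.mono hs)
    (hb j)) (hb i)) (SmoothFnOn.differential hW' (hf.mono hs) (hD.smooth_apply hW' hs (hb i) (hb j)))

/-- The antisymmetric part is the commutator of two fields applied to `f` minus the bracket given by
the torsion-free connection. -/
theorem hessian_symm {D : ConnOp n M} {W : Set M} (hW : IsOpen W) (hD : IsAffineConnectionOn D W)
    {f : M → ℝ} (hf : SmoothFnOn n f W) {x : M} (hx : x ∈ W) (u v : Tan n x) :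
    hessian D f x u v = hessian D f x v u := by
  have : hessian D f x = (hessian D f x).flip := by
    have hW' := mem_source_inter_open (n := n) hW x
    have hx' : x ∈ W ∩ (chartAt (EuclideanHalfSpace (n + 1)) x).source := ⟨hx, mem_chart_source _ x⟩
    have he := (isSmoothFrameOn_coordFrame (n := n) x).mono
      (W' := W ∩ (chartAt (EuclideanHalfSpace (n + 1)) x).source) inter_subset_right
    refine LinearMap.ext_basis (coordFrame x x) (coordFrame x x) fun j k => ?_
    rw [LinearMap.BilinForm.flip_apply, hessian_coordFrame, hessian_coordFrame]
    have h1 := differential_mlieBracket hW' (he j) (he k) (hf.mono inter_subset_left) hx'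
    rw [← hD.torsion hW' inter_subset_left (he j) (he k) hx', map_sub] at h1
    linarith
  conv_lhs => rw [this]
  rfl

end SchoutenHessian

/-! ### Densities -/

section Densities

variable {n : ℕ} {M : Type*} [TopologicalSpace M] [ChartedSpace (EuclideanHalfSpace (n + 1)) M]
  [IsManifold (𝓡∂ (n + 1)) ∞ M]

theorem hasDerivAt_abs_rpow (p : ℝ) {t : ℝ} (ht : t ≠ 0) :
    HasDerivAt (fun s : ℝ => |s| ^ p) (|t| ^ p * (p * t⁻¹)) t := by
  have h1 : HasDerivAt (fun s : ℝ => Real.exp (Real.log s * p))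
      (Real.exp (Real.log t * p) * (t⁻¹ * p)) t := ((Real.hasDerivAt_log ht).mul_const p).exp
  have e : ∀ s : ℝ, s ≠ 0 → |s| ^ p = Real.exp (Real.log s * p) := fun s hs => by
    rw [Real.rpow_def_of_pos (abs_pos.2 hs), Real.log_abs]
  rw [e t ht, mul_comm p]
  refine h1.congr_of_eventuallyEq ?_
  filter_upwards [isOpen_ne.mem_nhds ht] with s hs using e s hs

theorem contDiffOn_abs_rpow (p : ℝ) : ContDiffOn ℝ ∞ (fun s : ℝ => |s| ^ p) {0}ᶜ := by
  refine ContDiffOn.congr (f := fun s : ℝ => Real.exp (Real.log s * p)) ?_ (fun s hs => ?_)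
  · exact Real.contDiff_exp.comp_contDiffOn ((Real.contDiffOn_log).mul contDiffOn_const)
  · rw [Real.rpow_def_of_pos (abs_pos.2 hs), Real.log_abs]

theorem differential_prod {ι : Type*} [DecidableEq ι] (s : Finset ι) {f : ι → M → ℝ} {x : M}
    (hf : ∀ i ∈ s, DiffFnAt n (f i) x) (v : Tan n x) :
    DiffFnAt n (fun y => ∏ i ∈ s, f i y) x ∧
    differential (fun y => ∏ i ∈ s, f i y) x v
      = ∑ i ∈ s, (∏ j ∈ s.erase i, f j x) * differential (f i) x v := by
  induction s using Finset.induction_on with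
  | empty => simpa [differential_const] using mdifferentiableAt_const
  | insert a s ha ih =>
    obtain ⟨h1, h2⟩ := ih (fun i hi => hf i (Finset.mem_insert_of_mem hi))
    have h3 := hf a (Finset.mem_insert_self a s)
    simp only [Finset.prod_insert ha]
    refine ⟨h3.mul h1, ?_⟩
    rw [differential_mul h3 h1, h2, Finset.sum_insert ha, Finset.erase_insert ha, add_comm,
      Finset.mul_sum]
    congr 1
    refine Finset.sum_congr rfl fun i hi => ?_
    have hne : a ≠ i := fun h => ha (h ▸ hi)
    rw [Finset.erase_insert_of_ne hne, Finset.prod_insert (fun h => ha (Finset.mem_of_mem_erase h))]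
    ring

/-- Jacobi's formula. -/
theorem differential_det {ι : Type*} [Fintype ι] [DecidableEq ι] {A : M → Matrix ι ι ℝ} {x : M}
    (hA : ∀ i j, DiffFnAt n (fun y => A y i j) x) (v : Tan n x) :
    DiffFnAt n (fun y => (A y).det) x ∧ differential (fun y => (A y).det) x v
      = ∑ j, ∑ i, (A x).adjugate j i * differential (fun y => A y i j) x v := by
  have hp := fun σ : Equiv.Perm ι => differential_prod (n := n) Finset.univ
    (f := fun i y => A y (σ i) i) (fun i _ => hA (σ i) i) v
  have hs := differential_sum (n := n) (Finset.univ : Finset (Equiv.Perm ι))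
    (f := fun σ y => ((Equiv.Perm.sign σ : ℤ) : ℝ) * ∏ i, A y (σ i) i)
    (fun σ _ => mdifferentiableAt_const.mul (hp σ).1) v
  simp only [Matrix.det_apply']
  refine ⟨hs.1, hs.2.trans ?_⟩
  -- The inner sum is, by Cramer's rule, the determinant with column `j` replaced by its derivative;
  -- these are the terms of the product rule for the Leibniz expansion.
  have e1 : ∀ j, ∑ i, (A x).adjugate j i * differential (fun y => A y i j) x v
      = ((A x).updateCol j (fun i => differential (fun y => A y i j) x v)).det := by
    intro j
    rw [← Matrix.cramer_apply, Matrix.cramer_eq_adjugate_mulVec]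
    rfl
  simp only [e1, Matrix.det_apply']
  rw [Finset.sum_comm]
  refine Finset.sum_congr rfl fun σ _ => ?_
  rw [differential_const_mul _ (hp σ).1, (hp σ).2, Finset.mul_sum]
  refine Finset.sum_congr rfl fun j _ => ?_
  congr 1
  rw [← Finset.mul_prod_erase _ _ (Finset.mem_univ j), mul_comm]
  congr 1
  · simp
  · refine Finset.prod_congr rfl fun i hi => ?_
    rw [Matrix.updateCol_ne (Finset.ne_of_mem_erase hi)]

theorem Dens.apply_eq {w : ℝ} {x : M} (τ : Dens n w x) (b b' : Frame n x) :
    τ.1 b' = |b.det b'| ^ (-w / (n + 2)) * τ.1 b := τ.2 b b'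

theorem Dens.mk_apply_self {x : M} (w : ℝ) (b : Frame n x) (c : ℝ) :
    (Dens.mk w b c).1 b = c := by
  simp [Dens.mk, Module.Basis.det_self]

theorem Dens.ext_frame {w : ℝ} {x : M} {τ τ' : Dens n w x} (b : Frame n x)
    (h : τ.1 b = τ'.1 b) : τ = τ' := by
  refine Subtype.ext (funext fun b' => ?_)
  rw [Dens.apply_eq τ b b', Dens.apply_eq τ' b b', h]

theorem Dens.ne_zero_iff {w : ℝ} {x : M} {τ : Dens n w x} (b : Frame n x) :
    τ ≠ 0 ↔ τ.1 b ≠ 0 := by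
  refine not_congr ⟨fun h => by rw [h]; rfl, fun h => Dens.ext_frame b (by rw [h]; rfl)⟩

theorem frame_det_ne_zero {x : M} (b b' : Frame n x) : b.det b' ≠ 0 :=
  (b.isUnit_det b').ne_zero

theorem smoothFnOn_abs_det_rpow {W : Set M} {e b : ∀ x : M, Frame n x} (he : IsSmoothFrameOn e W)
    (hb : IsSmoothFrameOn b W) (p : ℝ) : SmoothFnOn n (fun y => |(e y).det (b y)| ^ p) W := by
  refine SmoothFnOn.comp_contDiffOn (f := fun y => (e y).det (b y)) ?_ (contDiffOn_abs_rpow p)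
    (fun y _ => frame_det_ne_zero _ _)
  simp only [Module.Basis.det_apply]
  exact smoothFnOn_det fun i j => SmoothVectorOn.repr (hb j) he i

/-- Smoothness of a density may be checked in one smooth frame near each point. -/
theorem smoothDensOn_of_locally {w : ℝ} {τ : ∀ x : M, Dens n w x} {W : Set M}
    (h : ∀ x ∈ W, ∃ V, IsOpen V ∧ x ∈ V ∧ ∃ e : ∀ x : M, Frame n x, IsSmoothFrameOn e V ∧
      SmoothFnOn n (fun y => (τ y).1 (e y)) V) : SmoothDensOn τ W := by
  intro W' hs hW' b hb
  refine contMDiffOn_of_locally_contMDiffOn fun x hx => ?_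
  obtain ⟨V, hV, hxV, e, he, hτ⟩ := h x (hs hx)
  refine ⟨V, hV, hxV, ?_⟩
  refine ContMDiffOn.congr (f := fun y => |(e y).det (b y)| ^ (-w / (n + 2)) * (τ y).1 (e y)) ?_
    (fun y _ => Dens.apply_eq _ _ _)
  exact (smoothFnOn_abs_det_rpow (he.mono inter_subset_right) (hb.mono inter_subset_left) _).mul
    (hτ.mono inter_subset_right)

/-- The trace of the connection form of `D` in the frame `b`, applied to `v`. -/
noncomputable def frameTrace (D : ConnOp n M) (b : ∀ x : M, Frame n x) (x : M) (v : Tan n x) : ℝ :=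
  ∑ i, (b x).repr (D (fun y => b y i) x v) i

theorem covDens_apply (D : ConnOp n M) {w : ℝ} (τ : ∀ x : M, Dens n w x) (x : M) (v : Tan n x) :
    covDens D τ x v = differential (fun y => (τ y).1 (coordFrame x y)) x v
      + w / (n + 2) * (τ x).1 (coordFrame x x) * frameTrace D (coordFrame x) x v := by
  simp [covDens, frameTrace]

/-- A change of frame adds the trace of `A⁻¹ dA` to the trace of the connection form, and by
Jacobi's formula this is the logarithmic derivative of the determinant. -/
theorem frameTrace_change {D : ConnOp n M} {W : Set M} (hD : IsAffineConnectionOn D W) {x : M}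
    (hx : x ∈ W) {e b : ∀ x : M, Frame n x} (he : ∀ i, DiffVectorAt (fun y => e y i) x)
    (hA : ∀ i j, DiffFnAt n (fun y => (e y).repr (b y j) i) x) (v : Tan n x) :
    DiffFnAt n (fun y => (e y).det (b y)) x ∧
    frameTrace D b x v = frameTrace D e x v
      + ((e x).det (b x))⁻¹ * differential (fun y => (e y).det (b y)) x v := by
  have hdet := differential_det (n := n) (A := fun y => (e y).toMatrix (b y)) hA v
  simp only [Module.Basis.det_apply]
  refine ⟨hdet.1, ?_⟩
  rw [hdet.2]
  have hexp : ∀ j, (fun y => b y j) = fun y => ∑ i, (e y).repr (b y j) i • e y i := fun j =>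
    funext fun y => ((e y).sum_repr (b y j)).symm
  have h1 : ∀ j, D (fun y => b y j) x v = (∑ i, (e x).repr (b x j) i • D (fun y => e y i) x v)
      + ∑ i, differential (fun y => (e y).repr (b y j) i) x v • e x i := by
    intro j
    rw [hexp j, hD.sum_smul_apply hx (fun i => hA i j) he, Finset.sum_add_distrib]
  simp only [frameTrace, h1, map_add, Finsupp.add_apply, Finset.sum_add_distrib]
  rw [sum_repr_trace (e x) (b x)]
  congr 1
  rw [Finset.mul_sum]
  refine Finset.sum_congr rfl fun j _ => ?_
  rw [Finset.mul_sum]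
  simp only [map_sum, map_smul, Finsupp.coe_finsetSum, Finset.sum_apply, Finsupp.smul_apply,
    smul_eq_mul]
  refine Finset.sum_congr rfl fun i _ => ?_
  have hinv : (b x).toMatrix (e x) = ((e x).toMatrix (b x))⁻¹ :=
    (Matrix.inv_eq_left_inv ((b x).toMatrix_mul_toMatrix_flip (e x))).symm
  have h2 : (b x).repr (e x i) j = ((e x).toMatrix (b x))⁻¹ j i := by
    rw [← hinv]
    rfl
  rw [h2, Matrix.inv_def, Ring.inverse_eq_inv', Matrix.smul_apply, smul_eq_mul]
  simp only [Module.Basis.toMatrix_apply]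
  ring

/-- The covariant derivative of a density, computed in different frames. -/
theorem covDens_frame_change {D : ConnOp n M} {W : Set M} (hD : IsAffineConnectionOn D W) {x : M}
    (hx : x ∈ W) {e b : ∀ x : M, Frame n x} {V : Set M} (hV : IsOpen V) (hxV : x ∈ V)
    (he : IsSmoothFrameOn e V) (hb : IsSmoothFrameOn b V) {w : ℝ} {τ : ∀ x : M, Dens n w x}
    (hτ : DiffFnAt n (fun y => (τ y).1 (e y)) x) (v : Tan n x) :
    differential (fun y => (τ y).1 (b y)) x v
        + w / (n + 2) * (τ x).1 (b x) * frameTrace D b x v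
      = |(e x).det (b x)| ^ (-w / (n + 2)) * (differential (fun y => (τ y).1 (e y)) x v
        + w / (n + 2) * (τ x).1 (e x) * frameTrace D e x v) := by
  obtain ⟨h1, h2⟩ := frameTrace_change hD hx (e := e) (b := b)
    (fun i => SmoothVectorOn.diffAt (he i) hV hxV)
    (fun i j => SmoothFnOn.diffFnAt (SmoothVectorOn.repr (hb j) he i) hV hxV) v
  have h0 := frame_det_ne_zero (e x) (b x)
  have e1 : (fun y => (τ y).1 (b y))
      = fun y => |(e y).det (b y)| ^ (-w / (n + 2)) * (τ y).1 (e y) :=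
    funext fun y => Dens.apply_eq _ _ _
  -- Differentiating the factor `|det| ^ (-w / (n + 2))` gives `-w / (n + 2)` times the logarithmic
  -- derivative of `det`, which cancels the change in the frame trace.
  rw [e1, differential_mul (SmoothFnOn.diffFnAt (smoothFnOn_abs_det_rpow he hb _) hV hxV) hτ,
    differential_comp (f := fun y => (e y).det (b y)) (φ := fun s : ℝ => |s| ^ (-w / (n + 2)))
      (hasDerivAt_abs_rpow _ h0) h1, Dens.apply_eq (τ x) (e x) (b x), h2]
  ring

theorem SmoothDensOn.smoothFnOn_coordFrame {w : ℝ} {τ : ∀ x : M, Dens n w x} {W : Set M}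
    (hW : IsOpen W) (hτ : SmoothDensOn τ W) (x : M) :
    SmoothFnOn n (fun y => (τ y).1 (coordFrame x y))
      (W ∩ (chartAt (EuclideanHalfSpace (n + 1)) x).source) :=
  hτ _ inter_subset_left (mem_source_inter_open hW x) _
    ((isSmoothFrameOn_coordFrame (n := n) x).mono inter_subset_right)

theorem SmoothDensOn.diffFnAt_coordFrame {w : ℝ} {τ : ∀ x : M, Dens n w x} {W : Set M}
    (hW : IsOpen W) (hτ : SmoothDensOn τ W) {x : M} (hx : x ∈ W) :
    DiffFnAt n (fun y => (τ y).1 (coordFrame x y)) x :=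
  SmoothFnOn.diffFnAt (hτ.smoothFnOn_coordFrame hW x) (mem_source_inter_open hW x)
    ⟨hx, mem_chart_source _ x⟩

/-- `covDens` is evaluated in the preferred chart at the point itself. Its vanishing can be tested
in a fixed chart, because the two expressions differ by a non-zero power of a determinant; this
permits continuity arguments in `x`. -/
theorem covDens_eq_zero_iff {D : ConnOp n M} {W : Set M} (hW : IsOpen W)
    (hD : IsAffineConnectionOn D W) {w : ℝ} {τ : ∀ x : M, Dens n w x} (hτ : SmoothDensOn τ W)
    {x₀ x : M} (hx : x ∈ W) (hx₀ : x ∈ (chartAt (EuclideanHalfSpace (n + 1)) x₀).source)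
    (v : Tan n x) :
    covDens D τ x v = 0 ↔ differential (fun y => (τ y).1 (coordFrame x₀ y)) x v
      + w / (n + 2) * (τ x).1 (coordFrame x₀ x) * frameTrace D (coordFrame x₀) x v = 0 := by
  rw [covDens_frame_change hD hx (e := coordFrame x) (b := coordFrame x₀)
    (V := (chartAt (EuclideanHalfSpace (n + 1)) x).source ∩
      (chartAt (EuclideanHalfSpace (n + 1)) x₀).source)
    ((chartAt _ x).open_source.inter (chartAt _ x₀).open_source) ⟨mem_chart_source _ x, hx₀⟩
    ((isSmoothFrameOn_coordFrame (n := n) x).mono inter_subset_left)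
    ((isSmoothFrameOn_coordFrame (n := n) x₀).mono inter_subset_right)
    (hτ.diffFnAt_coordFrame hW hx) v, ← covDens_apply]
  have : |(coordFrame (n := n) x x).det (coordFrame x₀ x)| ^ (-w / (n + 2)) ≠ 0 :=
    (Real.rpow_pos_of_pos (abs_pos.2 (frame_det_ne_zero _ _)) _).ne'
  simp [this]

/-- The connection trace grows by `(n + 2) Υ`, and the weight enters through `w / (n + 2)`. -/
theorem covDens_of_projRelAt {D D' : ConnOp n M} {x : M} {Υ : Module.Dual ℝ (Tan n x)}
    (h : ProjRelAt D D' x Υ) {w : ℝ} (τ : ∀ x : M, Dens n w x) (v : Tan n x) :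
    covDens D' τ x v = covDens D τ x v + w * (τ x).1 (coordFrame x x) * Υ v := by
  have ht := h.trace (b := coordFrame x)
    (fun k => diffVectorAt_coordFrame (n := n) (mem_chart_source _ x) k) v
  have hn : ((n : ℝ) + 2) ≠ 0 := by positivity
  simp only [map_sub, Finsupp.sub_apply, Finset.sum_sub_distrib] at ht
  have ht' : frameTrace D' (coordFrame x) x v
      = (n + 2) * Υ v + frameTrace D (coordFrame x) x v := sub_eq_iff_eq_add.1 ht
  rw [covDens_apply, covDens_apply, ht']
  field_simp
  ring

theorem covDens_smul (D : ConnOp n M) {w : ℝ} {τ : ∀ x : M, Dens n w x} {f : M → ℝ} {x : M}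
    (hf : DiffFnAt n f x) (hτ : DiffFnAt n (fun y => (τ y).1 (coordFrame x y)) x) (v : Tan n x) :
    covDens D (fun y => f y • τ y) x v
      = f x * covDens D τ x v + differential f x v * (τ x).1 (coordFrame x x) := by
  have e : (fun y => (f y • τ y).1 (coordFrame x y)) = fun y => f y * (τ y).1 (coordFrame x y) :=
    rfl
  rw [covDens_apply, covDens_apply, e, differential_mul hf hτ]
  change _ + w / (n + 2) * (f x * (τ x).1 (coordFrame x x)) * _ = _
  ring

theorem covDens_congr (D : ConnOp n M) {w : ℝ} {τ τ' : ∀ x : M, Dens n w x} {x : M}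
    (h : ∀ᶠ y in 𝓝 x, τ y = τ' y) : covDens D τ x = covDens D τ' x := by
  have e : (fun y => (τ y).1 (coordFrame x y)) =ᶠ[𝓝 x] fun y => (τ' y).1 (coordFrame x y) := by
    filter_upwards [h] with y hy
    rw [hy]
  rw [covDens, covDens, differential_congr e, h.self_of_nhds]

end Densities

/-! ### Symmetry of the Ricci tensor when a density is parallel -/

section SymmetricRicci

variable {n : ℕ} {M : Type*} [TopologicalSpace M] [ChartedSpace (EuclideanHalfSpace (n + 1)) M]
  [IsManifold (𝓡∂ (n + 1)) ∞ M]

/-- The second covariant derivatives of a frame in terms of its connection coefficients. -/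
theorem trace_second_derivative {D : ConnOp n M} {W : Set M} (hW : IsOpen W)
    (hD : IsAffineConnectionOn D W) {e : ∀ x : M, Frame n x} (he : IsSmoothFrameOn e W) {x : M}
    (hx : x ∈ W) (j k : Fin (n + 1)) :
    ∑ l, (e x).repr (D (fun y => D (fun z => e z l) y (e y k)) x (e x j)) l
      = differential (fun y => frameTrace D e y (e y k)) x (e x j)
        + ∑ l, ∑ m, (e x).repr (D (fun z => e z l) x (e x k)) m
          * (e x).repr (D (fun z => e z m) x (e x j)) l := by
  have hc := fun l m => SmoothVectorOn.repr (hD.smooth_apply hW subset_rfl (he k) (he l)) he m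
  have h1 : ∀ l, D (fun y => D (fun z => e z l) y (e y k)) x (e x j)
      = ∑ m, ((e x).repr (D (fun z => e z l) x (e x k)) m • D (fun z => e z m) x (e x j)
        + differential (fun y => (e y).repr (D (fun z => e z l) y (e y k)) m) x (e x j) • e x m) := by
    intro l
    have hexp : (fun y => D (fun z => e z l) y (e y k))
        = fun y => ∑ m, (e y).repr (D (fun z => e z l) y (e y k)) m • e y m :=
      funext fun y => ((e y).sum_repr _).symm
    rw [hexp]
    exact hD.sum_smul_apply hx (fun m => SmoothFnOn.diffFnAt (hc l m) hW hx)
      (fun m => SmoothVectorOn.diffAt (he m) hW hx) _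
  have h2 : differential (fun y => frameTrace D e y (e y k)) x (e x j)
      = ∑ l, differential (fun y => (e y).repr (D (fun z => e z l) y (e y k)) l) x (e x j) :=
    (differential_sum (n := n) Finset.univ
      (f := fun l y => (e y).repr (D (fun z => e z l) y (e y k)) l)
      (fun l _ => SmoothFnOn.diffFnAt (hc l l) hW hx) _).2
  rw [h2, ← Finset.sum_add_distrib]
  refine Finset.sum_congr rfl fun l _ => ?_
  rw [h1]
  simp only [map_sum, map_add, map_smul, Finsupp.coe_finsetSum, Finset.sum_apply,
    Finsupp.add_apply, Finsupp.smul_apply, smul_eq_mul, Finset.sum_add_distrib,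
    Module.Basis.repr_self, Finsupp.single_apply, mul_ite, mul_one, mul_zero,
    Finset.sum_ite_eq', Finset.mem_univ, if_true]
  ring

/-- A connection which preserves a nowhere vanishing density has symmetric Ricci tensor. -/
theorem ricciComp_symm_of_parallel {D : ConnOp n M} {W : Set M} (hW : IsOpen W)
    (hD : IsAffineConnectionOn D W) {w : ℝ} (hw : w ≠ 0) {τ : ∀ x : M, Dens n w x}
    (hτ : IsParallelScaleOn D τ W) {x : M} (hx : x ∈ W) (j k : Fin (n + 1)) :
    ricciComp D x j k = ricciComp D x k j := by
  have hn : ((n : ℝ) + 2) ≠ 0 := by positivity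
  have hW' := mem_source_inter_open (n := n) hW x
  set W' := W ∩ (chartAt (EuclideanHalfSpace (n + 1)) x).source with hdef
  have hx' : x ∈ W' := ⟨hx, mem_chart_source _ x⟩
  have hs : W' ⊆ W := inter_subset_left
  have he := (isSmoothFrameOn_coordFrame (n := n) x).mono (W' := W') inter_subset_right
  have hD' := hD.mono hs
  let F : M → ℝ := fun y => (τ y).1 (coordFrame x y)
  have hF : SmoothFnOn n F W' := hτ.1.smoothFnOn_coordFrame hW x
  have hF0 : ∀ y ∈ W', F y ≠ 0 := fun y hy => (Dens.ne_zero_iff _).1 (hτ.2 y (hs hy)).1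
  -- The parallel equation `dF + w/(n+2) F θ = 0` for the coordinate value `F` of τ says that the
  -- connection trace `θ` is exact, with primitive `G`.
  let G : M → ℝ := fun y => -((n + 2) / w) * Real.log (F y)
  have hG : SmoothFnOn n G W' := contMDiffOn_const.mul
    (SmoothFnOn.comp_contDiffOn hF (Real.contDiffOn_log) hF0)
  have hGθ : ∀ y ∈ W', ∀ i, frameTrace D (coordFrame x) y (coordFrame x y i)
      = differential G y (coordFrame x y i) := by
    intro y hy i
    have hFy := SmoothFnOn.diffFnAt hF hW' hy
    have hlog : DiffFnAt n (fun y => Real.log (F y)) y := SmoothFnOn.diffFnAt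
      (SmoothFnOn.comp_contDiffOn hF (Real.contDiffOn_log) hF0) hW' hy
    have h1 := (covDens_eq_zero_iff hW hD hτ.1 (hs hy) hy.2 (coordFrame x y i)).1
      (by rw [(hτ.2 y (hs hy)).2]; rfl)
    rw [differential_const_mul _ hlog,
      differential_comp (Real.hasDerivAt_log (hF0 y hy)) hFy]
    have h0 := hF0 y hy
    have h1' : differential F y (coordFrame x y i)
      = -(w / (n + 2) * F y * frameTrace D (coordFrame x) y (coordFrame x y i)) :=
      eq_neg_of_add_eq_zero_left h1
    rw [h1']
    field_simp
  have hbr : ∀ a c : Fin (n + 1), ∀ y ∈ W',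
      D (fun z => coordFrame x z a) y (coordFrame x y c)
        = D (fun z => coordFrame x z c) y (coordFrame x y a) := by
    intro a c y hy
    have h1 := hD.torsion hW' hs (he c) (he a) hy
    rw [mlieBracket_coordFrame hy.2] at h1
    exact sub_eq_zero.1 h1
  have hsecond : ∀ a c d : Fin (n + 1),
      D (fun y => D (fun z => coordFrame x z a) y (coordFrame x y c)) x (coordFrame x x d)
        = D (fun y => D (fun z => coordFrame x z c) y (coordFrame x y a)) x (coordFrame x x d) := by
    intro a c d
    exact congrArg (fun L : Tan n x →L[ℝ] Tan n x => L (coordFrame x x d))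
      (hD.congr hW hx ((hD.smooth_apply hW' hs (he c) (he a)).diffAt hW' hx')
      (by filter_upwards [hW'.mem_nhds hx'] with y hy using hbr a c y hy))
  have hcurv : ∀ a c d : Fin (n + 1), curvature D (fun y => coordFrame x y a)
      (fun y => coordFrame x y c) (fun y => coordFrame x y d) x
      = D (fun y => D (fun z => coordFrame x z d) y (coordFrame x y c)) x (coordFrame x x a)
        - D (fun y => D (fun z => coordFrame x z d) y (coordFrame x y a)) x (coordFrame x x c) := by
    intro a c d
    rw [curvature, mlieBracket_coordFrame hx'.2, map_zero, sub_zero]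
  -- The trace of the curvature is `dθ`, since the terms quadratic in the connection coefficients
  -- cancel, and `d(dG) = 0`.
  have htr : ∑ l, (coordFrame x x).repr (curvature D (fun y => coordFrame x y j)
      (fun y => coordFrame x y k) (fun y => coordFrame x y l) x) l = 0 := by
    simp only [hcurv, map_sub, Finsupp.sub_apply, Finset.sum_sub_distrib]
    rw [trace_second_derivative hW' hD' he hx' j k, trace_second_derivative hW' hD' he hx' k j]
    have hd : ∀ a c : Fin (n + 1), differential (n := n) (fun y => frameTrace D (coordFrame x) y (coordFrame x y a)) x
        (coordFrame x x c)
        = differential (fun y => differential G y (coordFrame x y a)) x (coordFrame x x c) := by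
      intro a c
      rw [differential_congr (n := n) (f := fun y => frameTrace D (coordFrame x) y (coordFrame x y a))
        (by filter_upwards [hW'.mem_nhds hx'] with y hy using hGθ y hy a)]
    have h1 := differential_mlieBracket hW' (he j) (he k) hG hx'
    rw [mlieBracket_coordFrame hx'.2, map_zero] at h1
    rw [hd k j, hd j k, Finset.sum_comm (f := fun l m =>
      (coordFrame x x).repr (D (fun z => coordFrame x z l) x (coordFrame x x j)) m
          * (coordFrame x x).repr (D (fun z => coordFrame x z m) x (coordFrame x x k)) l)]
    have h2 : ∀ l m, (coordFrame x x).repr (D (fun z => coordFrame x z m) x (coordFrame x x j)) l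
          * (coordFrame x x).repr (D (fun z => coordFrame x z l) x (coordFrame x x k)) m
        = (coordFrame x x).repr (D (fun z => coordFrame x z l) x (coordFrame x x k)) m
          * (coordFrame x x).repr (D (fun z => coordFrame x z m) x (coordFrame x x j)) l :=
      fun l m => mul_comm _ _
    simp only [h2]
    linarith
  rw [← sub_eq_zero, ricciComp, ricciComp, ← Finset.sum_sub_distrib]
  -- This is the first Bianchi identity for commuting coordinate fields; traced over `i`, it
  -- identifies the antisymmetric part of Ricci with minus the curvature trace.
  have hfin : ∀ i, (coordFrame x x).repr (curvature D (fun y => coordFrame x y i)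
        (fun y => coordFrame x y j) (fun y => coordFrame x y k) x) i
      - (coordFrame x x).repr (curvature D (fun y => coordFrame x y i)
        (fun y => coordFrame x y k) (fun y => coordFrame x y j) x) i
      = -(coordFrame x x).repr (curvature D (fun y => coordFrame x y j)
        (fun y => coordFrame x y k) (fun y => coordFrame x y i) x) i := by
    intro i
    simp only [hcurv, map_sub, Finsupp.sub_apply]
    rw [hsecond k j i, hsecond k i j, hsecond j i k]
    ring
  simp only [hfin, Finset.sum_neg_distrib, htr, neg_zero]

theorem schouten_symm_of_parallel {D : ConnOp n M} {W : Set M} (hW : IsOpen W)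
    (hD : IsAffineConnectionOn D W) {w : ℝ} (hw : w ≠ 0) {τ : ∀ x : M, Dens n w x}
    (hτ : IsParallelScaleOn D τ W) {x : M} (hx : x ∈ W) (u v : Tan n x) :
    schouten D x u v = schouten D x v u := by
  have : ricciForm D x = (ricciForm D x).flip := by
    refine LinearMap.ext_basis (coordFrame x x) (coordFrame x x) fun j k => ?_
    rw [LinearMap.BilinForm.flip_apply, ricciForm_coordFrame, ricciForm_coordFrame]
    exact ricciComp_symm_of_parallel hW hD hw hτ hx j k
  have h : ∀ u v, ricciForm D x u v = ricciForm D x v u := fun u v => by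
    conv_lhs => rw [this]
    rfl
  rw [schouten_apply, schouten_apply, h u v]

end SymmetricRicci

/-! ### Construction of connections -/

section Construction

variable {n : ℕ} {M : Type*} [TopologicalSpace M] [ChartedSpace (EuclideanHalfSpace (n + 1)) M]
  [IsManifold (𝓡∂ (n + 1)) ∞ M]

/-- A field of endomorphisms which maps smooth vector fields to smooth vector fields is smooth. -/
theorem contMDiffOn_hom_of_apply {W : Set M} (hW : IsOpen W)
    {s : ∀ x : M, Tan n x →L[ℝ] Tan n x}
    (h : ∀ W' ⊆ W, IsOpen W' → ∀ X : ∀ x : M, Tan n x, SmoothVectorOn X W' →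
      SmoothVectorOn (fun y => s y (X y)) W') :
    ContMDiffOn (𝓡∂ (n + 1)) ((𝓡∂ (n + 1)).prod
      𝓘(ℝ, EuclideanSpace ℝ (Fin (n + 1)) →L[ℝ] EuclideanSpace ℝ (Fin (n + 1)))) ∞
      (fun x => TotalSpace.mk' (EuclideanSpace ℝ (Fin (n + 1)) →L[ℝ]
        EuclideanSpace ℝ (Fin (n + 1)))
        (E := fun x => TangentSpace (𝓡∂ (n + 1)) x →L[ℝ] TangentSpace (𝓡∂ (n + 1)) x) x (s x)) W := by
  intro x₀ hx₀
  rw [contMDiffWithinAt_hom_bundle]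
  refine ⟨contMDiffWithinAt_id, ?_⟩
  have hW' := mem_source_inter_open (n := n) hW x₀
  have hx₀' : x₀ ∈ W ∩ (chartAt (EuclideanHalfSpace (n + 1)) x₀).source :=
    ⟨hx₀, mem_chart_source _ x₀⟩
  have he := (isSmoothFrameOn_coordFrame (n := n) x₀).mono
    (W' := W ∩ (chartAt (EuclideanHalfSpace (n + 1)) x₀).source) inter_subset_right
  -- The elementary matrices: in the trivialization the field is a combination of these with the
  -- smooth frame components as coefficients.
  let C : Fin (n + 1) → Fin (n + 1) →
      EuclideanSpace ℝ (Fin (n + 1)) →L[ℝ] EuclideanSpace ℝ (Fin (n + 1)) := fun i l =>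
    (EuclideanSpace.proj i).smulRight (EuclideanSpace.single l (1 : ℝ))
  have hsm : ContMDiffOn (𝓡∂ (n + 1))
      𝓘(ℝ, EuclideanSpace ℝ (Fin (n + 1)) →L[ℝ] EuclideanSpace ℝ (Fin (n + 1))) ∞
      (fun y => ∑ i, ∑ l, (coordFrame x₀ y).repr (s y (coordFrame x₀ y i)) l • C i l)
      (W ∩ (chartAt (EuclideanHalfSpace (n + 1)) x₀).source) :=
    contMDiffOn_finsetSum fun i _ => contMDiffOn_finsetSum fun l _ =>
      ContMDiffOn.smul (SmoothVectorOn.repr (h _ inter_subset_left hW' _ (he i)) he l)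
        contMDiffOn_const
  refine ContMDiffAt.contMDiffWithinAt ((hsm.contMDiffAt (hW'.mem_nhds hx₀')).congr_of_eventuallyEq ?_)
  filter_upwards [hW'.mem_nhds hx₀'] with y hy
  have hy' := mem_chart_source_of_mem hy.2
  rw [ContinuousLinearMap.inCoordinates_eq hy' hy']
  have hsymm : ∀ z : EuclideanSpace ℝ (Fin (n + 1)),
      ((trivializationAt (EuclideanSpace ℝ (Fin (n + 1)))
        (TangentSpace (𝓡∂ (n + 1)) : M → Type _) x₀).continuousLinearEquivAt ℝ y hy').symm z
        = ∑ i, z i • coordFrame x₀ y i := by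
    intro z
    have hz : z = ∑ i, z i • (EuclideanSpace.basisFun (Fin (n + 1)) ℝ).toBasis i := by
      conv_lhs => rw [← (EuclideanSpace.basisFun (Fin (n + 1)) ℝ).toBasis.sum_repr z]
      simp
    conv_lhs => rw [hz]
    rw [map_sum]
    refine Finset.sum_congr rfl fun i _ => ?_
    rw [map_smul, coordFrame_apply hy.2]
    simp [Trivialization.basisAt]
  refine ContinuousLinearMap.ext fun z => PiLp.ext fun m => ?_
  have h1 : (coordFrame x₀ y).repr (s y (∑ i, z i • coordFrame x₀ y i)) m
      = ∑ i, z i * (coordFrame x₀ y).repr (s y (coordFrame x₀ y i)) m := by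
    simp only [map_sum, map_smul, Finsupp.coe_finsetSum, Finset.sum_apply, Finsupp.smul_apply,
      smul_eq_mul]
  rw [← hsymm z, coordFrame_repr hy.2] at h1
  refine h1.trans ?_
  simp [C, Finset.sum_apply, Pi.single_apply, mul_comm]

theorem continuous_of_tan {x : M} (L : Tan n x →ₗ[ℝ] Tan n x) : Continuous L := by
  have h : ∀ L : EuclideanSpace ℝ (Fin (n + 1)) →ₗ[ℝ] EuclideanSpace ℝ (Fin (n + 1)),
    Continuous L := fun L => L.continuous_of_finiteDimensional
  exact h L

/-- The connection `D + Υ`. -/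
noncomputable def addForm (D : ConnOp n M) (Υ : ∀ x : M, Module.Dual ℝ (Tan n x)) : ConnOp n M :=
  fun X x => D X x
    + (⟨(Υ x).smulRight (X x), continuous_of_tan _⟩ : Tan n x →L[ℝ] Tan n x)
    + Υ x (X x) • ContinuousLinearMap.id ℝ (Tan n x)

theorem addForm_apply (D : ConnOp n M) (Υ : ∀ x : M, Module.Dual ℝ (Tan n x))
    (X : ∀ x : M, Tan n x) (x : M) (v : Tan n x) :
    addForm D Υ X x v = D X x v + Υ x v • X x + Υ x (X x) • v := rfl

theorem projRelAt_addForm (D : ConnOp n M) (Υ : ∀ x : M, Module.Dual ℝ (Tan n x)) (x : M) :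
    ProjRelAt D (addForm D Υ) x (Υ x) := fun _ _ _ => rfl

theorem IsAffineConnectionOn.addForm {D : ConnOp n M} {W : Set M}
    (hD : IsAffineConnectionOn D W) {Υ : ∀ x : M, Module.Dual ℝ (Tan n x)}
    (hΥ : SmoothFormOn Υ W) : IsAffineConnectionOn (addForm D Υ) W where
  isCov :=
    { add := by
        intro X Y x hX hY hx
        refine ContinuousLinearMap.ext fun v => ?_
        have h1 := hD.add_apply hx hX hY v
        change ProjCompact.addForm D Υ (fun y => X y + Y y) x v
          = ProjCompact.addForm D Υ X x v + ProjCompact.addForm D Υ Y x v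
        simp only [addForm_apply, h1, map_add]
        module
      leibniz := by
        intro X f x hX hf hx
        refine ContinuousLinearMap.ext fun v => ?_
        have h1 := hD.smul_apply hx hf hX v
        change ProjCompact.addForm D Υ (fun y => f y • X y) x v
          = f x • ProjCompact.addForm D Υ X x v + differential f x v • X x
        simp only [addForm_apply, h1, map_smul, smul_eq_mul]
        module }
  smooth := fun W' hs hW' => by
    refine ⟨fun {X} hX => contMDiffOn_hom_of_apply hW' fun V hV hVo Y hY => ?_⟩
    have hX' : SmoothVectorOn X V := ContMDiffOn.mono (by rwa [ENat.coe_top_add_one] at hX) hV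
    exact ((hD.smooth_apply hVo (hV.trans hs) hY hX').add
      (SmoothVectorOn.smul (hΥ V (hV.trans hs) hVo _ hY) hX')).add
      (SmoothVectorOn.smul (hΥ V (hV.trans hs) hVo _ hX') hY)
  torsionFree := fun x hx X Y hX hY => by
    rw [← hD.torsionFree x hx X Y hX hY]
    simp only [addForm_apply]
    abel

/-- Being a smooth torsion-free connection is a local property. -/
theorem isAffineConnectionOn_of_locally {D : ConnOp n M} {W : Set M}
    (h : ∀ x ∈ W, ∃ V : Set M, IsOpen V ∧ x ∈ V ∧ ∃ D' : ConnOp n M, IsAffineConnectionOn D' V ∧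
      ∀ y ∈ V, ProjRelAt D D' y 0) : IsAffineConnectionOn D W := by
  have key : ∀ {V : Set M} {D' : ConnOp n M}, (∀ y ∈ V, ProjRelAt D D' y 0) → ∀ y ∈ V,
      ∀ X : ∀ x : M, Tan n x, DiffVectorAt X y → D X y = D' X y := by
    intro V D' h y hy X hX
    refine ContinuousLinearMap.ext fun v => ?_
    have := h y hy X hX v
    simpa using this.symm
  refine ⟨⟨?_, ?_⟩, ?_, ?_⟩
  · intro X Y x hX hY hx
    obtain ⟨V, hV, hxV, D', hD', hr⟩ := h x hx
    rw [key hr x hxV X hX, key hr x hxV Y hY,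
      key hr x hxV (X + Y) (mdifferentiableAt_add_section hX hY)]
    exact hD'.isCov.add hX hY hxV
  · intro X f x hX hf hx
    obtain ⟨V, hV, hxV, D', hD', hr⟩ := h x hx
    rw [key hr x hxV X hX, key hr x hxV (f • X) (MDifferentiableAt.smul_section hf hX)]
    exact hD'.isCov.leibniz hX hf hxV
  · intro W' hs hW'
    refine ⟨fun {X} hX => contMDiffOn_hom_of_apply hW' fun W'' hW'' hW''o Y hY => ?_⟩
    have hX' : SmoothVectorOn X W'' := ContMDiffOn.mono (by rwa [ENat.coe_top_add_one] at hX) hW''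
    refine smoothVectorOn_of_locally fun x hx => ?_
    obtain ⟨V, hV, hxV, D', hD', hr⟩ := h x (hs (hW'' hx))
    refine ⟨V, hV, hxV, (hD'.smooth_apply (hW''o.inter hV) inter_subset_right
      (hY.mono inter_subset_left) (hX'.mono inter_subset_left)).congr fun y hy => ?_⟩
    rw [key hr y hy.2 X (hX'.diffAt hW''o hy.1)]
  · intro x hx X Y hX hY
    obtain ⟨V, hV, hxV, D', hD', hr⟩ := h x hx
    rw [key hr x hxV X hX, key hr x hxV Y hY]
    exact hD'.torsionFree x hxV X Y hX hY

end Construction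

/-! ### Projective compactness: the extended connection and the extended density -/

section Extension

variable {n : ℕ} {M : Type*} [TopologicalSpace M] [ChartedSpace (EuclideanHalfSpace (n + 1)) M]
  [IsManifold (𝓡∂ (n + 1)) ∞ M]

theorem smoothFormOn_smul_differential {W : Set M} {f g : M → ℝ} (hf : SmoothFnOn n f W)
    (hg : SmoothFnOn n g W) : SmoothFormOn (fun y => f y • differential (n := n) g y) W :=
  fun _ hs hW' _ hX => ContMDiffOn.mul (hf.mono hs) (SmoothFnOn.differential hW' (hg.mono hs) hX)

/-- Smooth connections which agree in the interior agree up to the boundary. -/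
theorem projRelAt_zero_of_interior {D E : ConnOp n M} {W : Set M} (hW : IsOpen W)
    (hD : IsAffineConnectionOn D W) (hE : IsAffineConnectionOn E W)
    (h : ∀ y ∈ W ∩ (𝓡∂ (n + 1)).interior M, ProjRelAt D E y 0) {x : M} (hx : x ∈ W) :
    ProjRelAt D E x 0 := by
  obtain ⟨Υ, hΥ, hrel⟩ := exists_smoothForm_projRelAt hW hD hE (fun y hy => ⟨0, h y hy⟩)
  have hW' := mem_source_inter_open (n := n) hW x
  have he := (isSmoothFrameOn_coordFrame (n := n) x).mono
    (W' := W ∩ (chartAt (EuclideanHalfSpace (n + 1)) x).source) inter_subset_right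
  have : Υ x = 0 := by
    refine (coordFrame x x).ext fun i => ?_
    refine eqOn_of_eqOn_interior (n := n) hW' (f := fun y => Υ y (coordFrame x y i))
      (g := fun _ => 0) (hΥ _ inter_subset_left hW' _ (he i)).continuousOn continuousOn_const ?_
      ⟨hx, mem_chart_source _ x⟩
    intro y hy
    rw [(hrel y hy.1.1).unique (h y ⟨hy.1.1, hy.2⟩)]
    rfl
  exact this ▸ hrel x hx

theorem IsLocalDefiningFunction.ne_zero {ρ : M → ℝ} {U : Set M}
    (hρ : IsLocalDefiningFunction n ρ U) {x : M} (hx : x ∈ U)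
    (hi : x ∈ (𝓡∂ (n + 1)).interior M) : ρ x ≠ 0 := by
  intro h
  have := (hρ.zero_iff x hx).1 h
  rw [← ModelWithCorners.compl_interior] at this
  exact this hi

/-- Compactness supplies extensions only locally and for some other defining function. The ratio
lemma converts them to ρ, and they glue because smooth connections that agree in the interior agree
at the boundary. -/
theorem exists_isExtension {nabla : ConnOp n M}
    (hconn : IsAffineConnectionOn nabla ((𝓡∂ (n + 1)).interior M))
    (hcompact : IsProjectivelyCompact nabla 2) {ρ : M → ℝ} {U : Set M}
    (hρ : IsLocalDefiningFunction n ρ U) : ∃ D : ConnOp n M, IsExtension nabla 2 ρ U D := by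
  classical
  have hloc : ∀ x ∈ U, x ∈ (𝓡∂ (n + 1)).boundary M → ∃ (W : Set M) (E : ConnOp n M),
      IsOpen W ∧ x ∈ W ∧ W ⊆ U ∧ IsAffineConnectionOn E W ∧
      ∀ y ∈ W ∩ (𝓡∂ (n + 1)).interior M,
        ProjRelAt nabla E y ((2 * ρ y)⁻¹ • differential ρ y) := by
    intro x hx hb
    obtain ⟨U', ρ', hxU', hρ', D', hD'⟩ := hcompact x hb
    obtain ⟨W, hW, hxW, hWU, u, hu, hu0, hratio⟩ := hρ.exists_ratio hρ' hx hxU' hb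
    have h2u : SmoothFnOn n (fun y => (2 * u y)⁻¹) W := SmoothFnOn.inv
      (contMDiffOn_const.mul hu) (fun y hy => mul_ne_zero two_ne_zero (hu0 y hy).ne')
    -- From `ρ = u ρ'` one gets `dρ/(2ρ) = dρ'/(2ρ') + du/(2u)`, and the last term is smooth up to
    -- the boundary.
    refine ⟨W, addForm D' (fun y => (2 * u y)⁻¹ • differential u y), hW, hxW,
      fun y hy => (hWU hy).1, (hD'.1.mono fun y hy => (hWU hy).2).addForm
        (smoothFormOn_smul_differential h2u hu), fun y hy => ?_⟩
    have h1 := (hD'.2 y ⟨(hWU hy.1).2, hy.2⟩).trans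
      (projRelAt_addForm D' (fun y => (2 * u y)⁻¹ • differential u y) y)
    have huy := (hu0 y hy.1).ne'
    have hρ'y := hρ'.ne_zero (hWU hy.1).2 hy.2
    have hd : differential (n := n) ρ y = u y • differential ρ' y + ρ' y • differential u y := by
      have e : ρ =ᶠ[𝓝 y] fun z => u z * ρ' z := by
        filter_upwards [hW.mem_nhds hy.1] with z hz using hratio z hz
      rw [differential_congr e]
      refine LinearMap.ext fun v => ?_
      exact differential_mul (SmoothFnOn.diffFnAt hu hW hy.1)
        (SmoothFnOn.diffFnAt hρ'.smooth hρ'.isOpen (hWU hy.1).2) v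
    rw [hd, hratio y hy.1]
    convert h1 using 1
    rw [smul_add, smul_smul, smul_smul]
    congr 2 <;> field_simp
  choose! Wb Eb hWb hxWb hWbU hEb hrelb using hloc
  -- At each boundary point the local extension chosen for that very point is used. Near a boundary
  -- point `x` this agrees with the single connection `Eb x`, so `D` is smooth.
  let D : ConnOp n M := fun X x => if x ∈ (𝓡∂ (n + 1)).interior M then
    addForm nabla (fun y => (2 * ρ y)⁻¹ • differential ρ y) X x else Eb x X x
  have hDint : ∀ y ∈ U ∩ (𝓡∂ (n + 1)).interior M,
      ProjRelAt nabla D y ((2 * ρ y)⁻¹ • differential ρ y) := by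
    intro y hy X hX v
    simp only [D, if_pos hy.2]
    rfl
  refine ⟨D, isAffineConnectionOn_of_locally fun x hx => ?_, hDint⟩
  by_cases hi : x ∈ (𝓡∂ (n + 1)).interior M
  · have hUi : IsOpen (U ∩ (𝓡∂ (n + 1)).interior M) := hρ.isOpen.inter isOpen_interiorPoints
    refine ⟨U ∩ (𝓡∂ (n + 1)).interior M, hUi, ⟨hx, hi⟩,
      addForm nabla (fun y => (2 * ρ y)⁻¹ • differential ρ y),
      (hconn.mono inter_subset_right).addForm ?_, fun y hy => ?_⟩
    · exact smoothFormOn_smul_differential (SmoothFnOn.inv (contMDiffOn_const.mul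
        (hρ.smooth.mono inter_subset_left)) (fun y hy => mul_ne_zero two_ne_zero
        (hρ.ne_zero hy.1 hy.2))) (hρ.smooth.mono inter_subset_left)
    · intro X hX v
      simp only [D, if_pos hy.2]
      simp
  · have hb := mem_boundary_of_not_interior hi
    refine ⟨Wb x, hWb x hx hb, hxWb x hx hb, Eb x, hEb x hx hb, fun y hy => ?_⟩
    have hyU := hWbU x hx hb hy
    by_cases hyi : y ∈ (𝓡∂ (n + 1)).interior M
    · have := (hDint y ⟨hyU, hyi⟩).symm.trans (hrelb x hx hb y ⟨hy, hyi⟩)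
      rwa [neg_add_cancel] at this
    · have hyb := mem_boundary_of_not_interior hyi
      have h1 := projRelAt_zero_of_interior ((hWb x hx hb).inter (hWb y hyU hyb))
        ((hEb y hyU hyb).mono inter_subset_right) ((hEb x hx hb).mono inter_subset_left)
        (fun z hz => by
          have := (hrelb y hyU hyb z ⟨hz.1.2, hz.2⟩).symm.trans (hrelb x hx hb z ⟨hz.1.1, hz.2⟩)
          rwa [neg_add_cancel] at this) (x := y) ⟨hy, hxWb y hyU hyb⟩
      intro X hX v
      simp only [D, if_neg hyi]
      exact h1 X hX v

/-- The quotient `τ / ρ` is parallel for the extended connection in the interior. -/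
theorem covDens_quotient_eq_zero {nabla D : ConnOp n M} {τ : ∀ x : M, Dens n 2 x}
    (hτ : IsParallelScaleOn nabla τ ((𝓡∂ (n + 1)).interior M)) {ρ : M → ℝ} {U : Set M}
    (hρ : IsLocalDefiningFunction n ρ U) (hD : IsExtension nabla 2 ρ U D) {y : M} (hy : y ∈ U)
    (hi : y ∈ (𝓡∂ (n + 1)).interior M) (v : Tan n y) :
    covDens D (fun z => (ρ z)⁻¹ • τ z) y v = 0 := by
  have hρy := hρ.ne_zero hy hi
  have hρd := SmoothFnOn.diffFnAt hρ.smooth hρ.isOpen hy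
  have hinv : SmoothFnOn n (fun z => (ρ z)⁻¹) (U ∩ (𝓡∂ (n + 1)).interior M) :=
    SmoothFnOn.inv (hρ.smooth.mono inter_subset_left) (fun z hz => hρ.ne_zero hz.1 hz.2)
  -- The derivative of `1/ρ` contributes `-dρ/ρ²`, and the projective change contributes `2 ·
  -- dρ/(2ρ) · 1/ρ`: weight 2 and order 2 cancel exactly.
  rw [covDens_smul D (hinv.diffFnAt (hρ.isOpen.inter isOpen_interiorPoints) ⟨hy, hi⟩)
    (hτ.1.diffFnAt_coordFrame isOpen_interiorPoints hi),
    covDens_of_projRelAt (hD.2 y ⟨hy, hi⟩), (hτ.2 y hi).2,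
    differential_comp (φ := fun s : ℝ => s⁻¹) (hasDerivAt_inv hρy) hρd]
  simp only [LinearMap.zero_apply, LinearMap.smul_apply, smul_eq_mul]
  field_simp
  ring

/-- In a coordinate frame `τ/ρ` has logarithmic derivative `-2/(n+2)` times the connection trace of
`D`, which is smooth up to the boundary. Local extensions are unique by density of the interior,
hence glue, and the parallel equation persists by continuity. -/
theorem exists_extended_density {nabla D : ConnOp n M} {τ : ∀ x : M, Dens n 2 x}
    (hτ : IsParallelScaleOn nabla τ ((𝓡∂ (n + 1)).interior M))
    (hτ₀ : ∀ x ∈ (𝓡∂ (n + 1)).boundary M, τ x = 0) {ρ : M → ℝ} {U : Set M}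
    (hρ : IsLocalDefiningFunction n ρ U) (hD : IsExtension nabla 2 ρ U D) :
    ∃ τhat : ∀ x : M, Dens n 2 x, IsParallelScaleOn D τhat U ∧ ∀ x ∈ U, τ x = ρ x • τhat x := by
  classical
  have hUi : IsOpen (U ∩ (𝓡∂ (n + 1)).interior M) := hρ.isOpen.inter isOpen_interiorPoints
  have hsm : SmoothDensOn (fun z => (ρ z)⁻¹ • τ z) (U ∩ (𝓡∂ (n + 1)).interior M) := by
    intro W' hs hW' b hb
    exact ContMDiffOn.mul (SmoothFnOn.inv (hρ.smooth.mono (hs.trans inter_subset_left))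
      (fun z hz => hρ.ne_zero (hs hz).1 (hs hz).2))
      (hτ.1 W' (hs.trans inter_subset_right) hW' b hb)
  have hne : ∀ z ∈ U ∩ (𝓡∂ (n + 1)).interior M, (ρ z)⁻¹ • τ z ≠ 0 := fun z hz =>
    smul_ne_zero (inv_ne_zero (hρ.ne_zero hz.1 hz.2)) (hτ.2 z hz.2).1
  have hloc : ∀ x ∈ U, ∃ (W : Set M) (g : M → ℝ), IsOpen W ∧ x ∈ W ∧
      W ⊆ U ∩ (chartAt (EuclideanHalfSpace (n + 1)) x).source ∧ SmoothFnOn n g W ∧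
      (∀ y ∈ W, g y ≠ 0) ∧ ∀ y ∈ W ∩ (𝓡∂ (n + 1)).interior M,
        g y = ((ρ y)⁻¹ • τ y).1 (coordFrame x y) := by
    intro x hx
    have hW := mem_source_inter_open (n := n) hρ.isOpen x
    set W := U ∩ (chartAt (EuclideanHalfSpace (n + 1)) x).source with hWdef
    have he := (isSmoothFrameOn_coordFrame (n := n) x).mono (W' := W) inter_subset_right
    have hsub : W ∩ (𝓡∂ (n + 1)).interior M ⊆ U ∩ (𝓡∂ (n + 1)).interior M :=
      fun y hy => ⟨hy.1.1, hy.2⟩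
    obtain ⟨W₁, h1, h2, h3, g, h4, h5, h6⟩ := exists_smooth_extension_of_logDeriv (n := n) hW
      (x₀ := x) ⟨hx, mem_chart_source _ x⟩ (f := fun y => ((ρ y)⁻¹ • τ y).1 (coordFrame x y))
      (hsm _ hsub (hW.inter isOpen_interiorPoints) _ (he.mono inter_subset_left))
      (fun y hy => (Dens.ne_zero_iff _).1 (hne y (hsub hy)))
      (α := fun i y => -(2 / ((n : ℝ) + 2)) * frameTrace D (coordFrame x) y (coordFrame x y i))
      (fun i => contMDiffOn_const.mul (smoothFnOn_sum fun k _ => SmoothVectorOn.repr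
        (hD.1.smooth_apply hW inter_subset_left (he i) (he k)) he k))
      (fun y hy i => by
        have h7 := (covDens_eq_zero_iff hUi (hD.1.mono inter_subset_left) hsm (x₀ := x)
          (hsub hy) hy.1.2 (coordFrame x y i)).1
          (covDens_quotient_eq_zero hτ hρ hD hy.1.1 hy.2 _)
        rw [eq_neg_of_add_eq_zero_left h7]
        ring)
    exact ⟨W₁, g, h1, h2, h3.trans inter_subset_left, h4, h5, h6⟩
  choose! Wb g hWb hxWb hWbU hg hg0 hgτ using hloc
  -- A boundary value comes from the local extension chosen at that point; `hval` shows that every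
  -- local extension computes the same density in its own frame.
  let τhat : ∀ x : M, Dens n 2 x := fun x => if x ∈ (𝓡∂ (n + 1)).interior M then (ρ x)⁻¹ • τ x
    else Dens.mk 2 (coordFrame x x) (g x x)
  have hint : ∀ x ∈ (𝓡∂ (n + 1)).interior M, τhat x = (ρ x)⁻¹ • τ x := fun x hx => if_pos hx
  have hbd : ∀ x ∉ (𝓡∂ (n + 1)).interior M, τhat x = Dens.mk 2 (coordFrame x x) (g x x) :=
    fun x hx => if_neg hx
  have hval : ∀ x ∈ U, ∀ y ∈ Wb x, (τhat y).1 (coordFrame x y) = g x y := by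
    intro x hx y hy
    by_cases hyi : y ∈ (𝓡∂ (n + 1)).interior M
    · rw [hint y hyi, hgτ x hx y ⟨hy, hyi⟩]
    · have hyU := (hWbU x hx hy).1
      rw [hbd y hyi]
      have hex := (isSmoothFrameOn_coordFrame (n := n) x).mono
        (W' := Wb x ∩ Wb y) (fun z hz => (hWbU x hx hz.1).2)
      have hey := (isSmoothFrameOn_coordFrame (n := n) y).mono
        (W' := Wb x ∩ Wb y) (fun z hz => (hWbU y hyU hz.2).2)
      refine eqOn_of_eqOn_interior (n := n) ((hWb x hx).inter (hWb y hyU))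
        (f := fun z => |(coordFrame (n := n) y z).det (coordFrame x z)| ^ (-2 / ((n : ℝ) + 2))
          * g y z) (g := g x) ?_ ((hg x hx).continuousOn.mono inter_subset_left) ?_
        ⟨hy, hxWb y hyU⟩
      · exact ContMDiffOn.continuousOn (ContMDiffOn.mul (smoothFnOn_abs_det_rpow hey hex _)
          ((hg y hyU).mono inter_subset_right))
      · intro z hz
        rw [hgτ x hx z ⟨hz.1.1, hz.2⟩, hgτ y hyU z ⟨hz.1.2, hz.2⟩]
        exact (Dens.apply_eq _ _ _).symm
  have hsmooth : SmoothDensOn τhat U := smoothDensOn_of_locally fun x hx =>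
    ⟨Wb x, hWb x hx, hxWb x hx, coordFrame x,
      (isSmoothFrameOn_coordFrame (n := n) x).mono fun z hz => (hWbU x hx hz).2,
      (hg x hx).congr fun y hy => hval x hx y hy⟩
  refine ⟨τhat, ⟨hsmooth, fun x hx => ⟨?_, ?_⟩⟩, fun x hx => ?_⟩
  · rw [Dens.ne_zero_iff (coordFrame x x), hval x hx x (hxWb x hx)]
    exact hg0 x hx x (hxWb x hx)
  · refine (coordFrame x x).ext fun i => ?_
    have hW := mem_source_inter_open (n := n) hρ.isOpen x
    have he := (isSmoothFrameOn_coordFrame (n := n) x).mono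
      (W' := U ∩ (chartAt (EuclideanHalfSpace (n + 1)) x).source) inter_subset_right
    have hF := hsmooth.smoothFnOn_coordFrame hρ.isOpen x
    rw [covDens_apply]
    refine eqOn_of_eqOn_interior (n := n) hW
      (f := fun y => differential (fun z => (τhat z).1 (coordFrame x z)) y (coordFrame x y i)
        + 2 / (n + 2) * (τhat y).1 (coordFrame x y)
          * frameTrace D (coordFrame x) y (coordFrame x y i))
      (g := fun _ => 0) ?_ continuousOn_const ?_ ⟨hx, mem_chart_source _ x⟩
    · exact ContMDiffOn.continuousOn (ContMDiffOn.add (SmoothFnOn.differential hW hF (he i))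
        (ContMDiffOn.mul (contMDiffOn_const.mul hF) (smoothFnOn_sum fun k _ => SmoothVectorOn.repr
        (hD.1.smooth_apply hW inter_subset_left (he i) (he k)) he k)))
    · intro y hy
      refine (covDens_eq_zero_iff hρ.isOpen hD.1 hsmooth hy.1.1 hy.1.2 (coordFrame x y i)).1 ?_
      rw [covDens_congr D (τ' := fun z => (ρ z)⁻¹ • τ z)
        (by filter_upwards [isOpen_interiorPoints.mem_nhds hy.2] with z hz using hint z hz)]
      exact covDens_quotient_eq_zero hτ hρ hD hy.1.1 hy.2 _
  · by_cases hi : x ∈ (𝓡∂ (n + 1)).interior M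
    · rw [hint x hi, smul_smul, mul_inv_cancel₀ (hρ.ne_zero hx hi), one_smul]
    · have hb := mem_boundary_of_not_interior hi
      rw [hτ₀ x hb, (hρ.zero_iff x hx).2 hb, zero_smul]

end Extension

/-! ### Linear algebra of slots -/

section LinearAlgebra

variable {V : Type*} [AddCommGroup V] [Module ℝ V]

theorem slotForm_apply (a : ℝ) (m : Module.Dual ℝ V) (p : LinearMap.BilinForm ℝ V)
    (s t : V × ℝ) : slotForm a m p s t
      = a * s.2 * t.2 + s.2 * m t.1 + t.2 * m s.1 + p s.1 t.1 := rfl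

theorem slotForm_symm {a : ℝ} {m : Module.Dual ℝ V} {p : LinearMap.BilinForm ℝ V}
    (hp : ∀ u v, p u v = p v u) (s t : V × ℝ) : slotForm a m p s t = slotForm a m p t s := by
  rw [slotForm_apply, slotForm_apply, hp]
  ring

theorem nondegenerate_of_symm {B : LinearMap.BilinForm ℝ V} (hB : ∀ u v, B u v = B v u)
    (h : ∀ u, (∀ v, B u v = 0) → u = 0) : B.Nondegenerate :=
  ⟨h, fun v hv => h v fun u => by rw [hB]; exact hv u⟩

theorem bijective_of_nondegenerate [FiniteDimensional ℝ V] {B : LinearMap.BilinForm ℝ V}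
    (hB : B.Nondegenerate) : Function.Bijective (B : V →ₗ[ℝ] Module.Dual ℝ V) := by
  have hinj : Function.Injective (B : V →ₗ[ℝ] Module.Dual ℝ V) := by
    rw [injective_iff_map_eq_zero]
    intro v hv
    exact hB.1 v fun w => by rw [hv]; rfl
  exact ⟨hinj, (LinearMap.injective_iff_surjective_of_finrank_eq_finrank
    Subspace.dual_finrank_eq.symm).1 hinj⟩

theorem apply_sharp [FiniteDimensional ℝ V] {B : LinearMap.BilinForm ℝ V}
    (hB : B.Nondegenerate) (α : Module.Dual ℝ V) : B (sharp B α) = α := by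
  have h := bijective_of_nondegenerate hB
  rw [sharp, dif_pos h]
  exact (LinearEquiv.ofBijective (B : V →ₗ[ℝ] Module.Dual ℝ V) h).apply_symm_apply α

theorem sharp_eq_of_apply [FiniteDimensional ℝ V] {B : LinearMap.BilinForm ℝ V}
    (hB : B.Nondegenerate) {α : Module.Dual ℝ V} {v : V} (h : ∀ w, B v w = α w) :
    sharp B α = v :=
  (bijective_of_nondegenerate hB).1 ((apply_sharp hB α).trans (LinearMap.ext h).symm)

theorem inverseForm_apply (B : LinearMap.BilinForm ℝ V) (α β : Module.Dual ℝ V) :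
    inverseForm B α β = α (sharp B β) := rfl

theorem apply_sharp_comm [FiniteDimensional ℝ V] {B : LinearMap.BilinForm ℝ V}
    (hB : B.Nondegenerate) (hs : ∀ u v, B u v = B v u) (α β : Module.Dual ℝ V) :
    α (sharp B β) = β (sharp B α) := by
  conv_lhs => rw [← apply_sharp hB α]
  rw [hs, apply_sharp hB β]

theorem nondegenerate_smul_compl₁₂_iff {W : Type*} [AddCommGroup W] [Module ℝ W]
    {B : LinearMap.BilinForm ℝ V} {L : W →ₗ[ℝ] V} (hL : Function.Bijective L) {c : ℝ}
    (hc : c ≠ 0) : (c • B.compl₁₂ L L : LinearMap.BilinForm ℝ W).Nondegenerate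
      ↔ B.Nondegenerate := by
  have e : ∀ u v, (c • B.compl₁₂ L L : LinearMap.BilinForm ℝ W) u v = c * B (L u) (L v) :=
    fun u v => rfl
  constructor
  · rintro ⟨h1, h2⟩
    refine ⟨fun u hu => ?_, fun v hv => ?_⟩
    · obtain ⟨u, rfl⟩ := hL.2 u
      rw [h1 u fun v => by rw [e, hu, mul_zero], map_zero]
    · obtain ⟨v, rfl⟩ := hL.2 v
      rw [h2 v fun u => by rw [e, hv, mul_zero], map_zero]
  · rintro ⟨h1, h2⟩
    refine ⟨fun u hu => hL.1 ?_, fun v hv => hL.1 ?_⟩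
    · rw [map_zero]
      refine h1 _ fun v => ?_
      obtain ⟨v, rfl⟩ := hL.2 v
      have := hu v
      rw [e] at this
      exact (mul_eq_zero.1 this).resolve_left hc
    · rw [map_zero]
      refine h2 _ fun u => ?_
      obtain ⟨u, rfl⟩ := hL.2 u
      have := hv u
      rw [e] at this
      exact (mul_eq_zero.1 this).resolve_left hc

/-- The slots of the inverse of a slot form: the bivector `Z`. -/
noncomputable def slotZ (F : LinearMap.BilinForm ℝ (V × ℝ)) :
    LinearMap.BilinForm ℝ (Module.Dual ℝ V) :=
  (inverseForm F).compl₁₂ (LinearMap.fst ℝ V ℝ).dualMap (LinearMap.fst ℝ V ℝ).dualMap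

theorem slotZ_apply (F : LinearMap.BilinForm ℝ (V × ℝ)) (α β : Module.Dual ℝ V) :
    slotZ F α β = α (sharp F (β ∘ₗ LinearMap.fst ℝ V ℝ)).1 := rfl

/-- The slots of the inverse of a slot form: half the middle slot. -/
noncomputable def slotT (F : LinearMap.BilinForm ℝ (V × ℝ)) : V :=
  (1 / 2 : ℝ) • (sharp F (LinearMap.snd ℝ V ℝ)).1

/-- The slots of the inverse of a slot form: the scalar slot. -/
noncomputable def slotPsi (F : LinearMap.BilinForm ℝ (V × ℝ)) : ℝ :=
  (sharp F (LinearMap.snd ℝ V ℝ)).2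

/-- A slot form which becomes diagonal after a change of splitting. -/
theorem slotForm_complete_square {ρ : ℝ} (hρ : ρ ≠ 0) {dρ : Module.Dual ℝ V}
    {P h : LinearMap.BilinForm ℝ V}
    (hh : ∀ u v, h u v = ρ * P u v + 1 / (4 * ρ) * (dρ u * dρ v)) (s t : V × ℝ) :
    slotForm ρ ((1 / 2 : ℝ) • dρ) h s t
      = ρ * (s.2 + dρ s.1 / (2 * ρ)) * (t.2 + dρ t.1 / (2 * ρ)) + ρ * P s.1 t.1 := by
  rw [slotForm_apply, hh]
  simp only [LinearMap.smul_apply, smul_eq_mul]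
  field_simp
  ring

/-- A vector `u` in the radical of `P` lifts to `(u, -dρ(u)/(2ρ))`, for which the square term
vanishes; the lift then lies in the radical of the slot form. -/
theorem nondegenerate_of_slotForm {ρ : ℝ} (hρ : ρ ≠ 0) {dρ : Module.Dual ℝ V}
    {P h : LinearMap.BilinForm ℝ V} (hP : ∀ u v, P u v = P v u)
    (hh : ∀ u v, h u v = ρ * P u v + 1 / (4 * ρ) * (dρ u * dρ v))
    (hF : (slotForm ρ ((1 / 2 : ℝ) • dρ) h).Nondegenerate) : P.Nondegenerate := by
  refine nondegenerate_of_symm hP fun u hu => ?_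
  have := hF.1 (u, -(dρ u / (2 * ρ))) fun t => by
    rw [slotForm_complete_square hρ hh, hu]
    simp
  exact congrArg Prod.fst this

/-- The slot form at a boundary point. -/
theorem nondegenerate_slotForm_zero {m : Module.Dual ℝ V} (hm : m ≠ 0)
    {p : LinearMap.BilinForm ℝ V} (hp : ∀ u v, p u v = p v u)
    (h : (p.restrict (LinearMap.ker m)).Nondegenerate) : (slotForm 0 m p).Nondegenerate := by
  refine nondegenerate_of_symm (slotForm_symm hp) ?_
  rintro ⟨ν, σ⟩ hs
  -- Pairing with `(0, 1)` puts `ν` in `ker m`, pairing with vectors of `ker m` then forces `ν = 0`,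
  -- and a vector outside `ker m` finally detects `σ`.
  have h1 : m ν = 0 := by
    have := hs (0, 1)
    rw [slotForm_apply] at this
    simpa using this
  have h2 : ν = 0 := by
    have := h.1 ⟨ν, h1⟩ fun w => by
      have h3 := hs (w.1, 0)
      rw [slotForm_apply] at h3
      have hw : m w.1 = 0 := w.2
      simpa [hw] using h3
    exact congrArg Subtype.val this
  subst h2
  obtain ⟨v, hv⟩ : ∃ v, m v ≠ 0 := by
    by_contra hcon
    push Not at hcon
    exact hm (LinearMap.ext hcon)
  have h4 := hs (v, 0)
  rw [slotForm_apply] at h4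
  have h5 : σ = 0 := by simpa [hv] using h4
  rw [h5]
  rfl

variable [FiniteDimensional ℝ V]

/-- Expand bilinearly. The two mixed terms agree because the inverse of a symmetric form is
symmetric; the factor 2 undoes the normalization of `slotT`. -/
theorem inverseForm_slots {F : LinearMap.BilinForm ℝ (V × ℝ)} (hF : F.Nondegenerate)
    (hs : ∀ u v, F u v = F v u) (β₁ β₂ : ℝ) (μ₁ μ₂ : Module.Dual ℝ V) :
    inverseForm F (β₁ • LinearMap.snd ℝ V ℝ + μ₁ ∘ₗ LinearMap.fst ℝ V ℝ)
        (β₂ • LinearMap.snd ℝ V ℝ + μ₂ ∘ₗ LinearMap.fst ℝ V ℝ)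
      = slotZ F μ₁ μ₂ + (β₂ * μ₁ ((2 : ℝ) • slotT F) + β₁ * μ₂ ((2 : ℝ) • slotT F))
        + slotPsi F * β₁ * β₂ := by
  have h1 : (2 : ℝ) • slotT F = (sharp F (LinearMap.snd ℝ V ℝ)).1 := by
    rw [slotT, smul_smul]
    norm_num
  have h2 : (sharp F (μ₂ ∘ₗ LinearMap.fst ℝ V ℝ)).2 = μ₂ (sharp F (LinearMap.snd ℝ V ℝ)).1 :=
    apply_sharp_comm hF hs (LinearMap.snd ℝ V ℝ) (μ₂ ∘ₗ LinearMap.fst ℝ V ℝ)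
  rw [inverseForm_apply, h1, slotZ_apply, slotPsi]
  simp only [map_add, map_smul, LinearMap.add_apply, LinearMap.smul_apply, LinearMap.snd_apply,
    LinearMap.comp_apply, LinearMap.fst_apply, smul_eq_mul, h2]
  ring

variable {a : ℝ} {m : Module.Dual ℝ V} {p : LinearMap.BilinForm ℝ V}

/-- This is F(F⁻¹(`snd`)) = `snd`, evaluated on `(ν, σ)`. Setting `ν = 0` or `σ = 0` gives the first
two of the three identities. -/
theorem slotForm_sharp_snd (hF : (slotForm a m p).Nondegenerate) (ν : V) (σ : ℝ) :
    a * slotPsi (slotForm a m p) * σ + slotPsi (slotForm a m p) * m ν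
      + 2 * σ * m (slotT (slotForm a m p)) + 2 * p (slotT (slotForm a m p)) ν = σ := by
  have h := congrArg (fun L : Module.Dual ℝ (V × ℝ) => L (ν, σ))
    (apply_sharp hF (LinearMap.snd ℝ V ℝ))
  simp only [slotForm_apply, LinearMap.snd_apply] at h
  rw [slotPsi, slotT]
  simp only [map_smul, LinearMap.smul_apply, smul_eq_mul]
  linarith

theorem slotT_apply (hF : (slotForm a m p).Nondegenerate) :
    2 * m (slotT (slotForm a m p)) = 1 - a * slotPsi (slotForm a m p) := by
  have h := slotForm_sharp_snd hF 0 1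
  simp only [map_zero] at h
  linarith

theorem slotT_contract (hF : (slotForm a m p).Nondegenerate) (v : V) :
    p (slotT (slotForm a m p)) v = -(1 / 2) * slotPsi (slotForm a m p) * m v := by
  have h := slotForm_sharp_snd hF v 0
  linarith

theorem slotZ_contract (hF : (slotForm a m p).Nondegenerate) (hp : ∀ u v, p u v = p v u)
    (α : Module.Dual ℝ V) (v : V) :
    slotZ (slotForm a m p) α (p.flip v) + α (slotT (slotForm a m p)) * (2 * m v) = α v := by
  -- The covector on the left is the image of `(v, 0)` under the form, so the inverse returns `(v,
  -- 0)`; its first component is the third identity.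
  have h : sharp (slotForm a m p) (m v • LinearMap.snd ℝ V ℝ + p.flip v ∘ₗ LinearMap.fst ℝ V ℝ)
      = (v, 0) := by
    refine sharp_eq_of_apply hF fun w => ?_
    rw [slotForm_apply]
    simp only [LinearMap.add_apply, LinearMap.smul_apply, LinearMap.snd_apply,
      LinearMap.comp_apply, LinearMap.fst_apply, LinearMap.BilinForm.flip_apply, smul_eq_mul,
      hp v w.1]
    ring
  rw [map_add, map_smul] at h
  have h1 := congrArg (fun s : V × ℝ => α s.1) h
  simp only [Prod.fst_add, Prod.smul_fst, map_add, map_smul, smul_eq_mul] at h1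
  rw [slotZ_apply, slotT, map_smul, smul_eq_mul, ← h1]
  ring

/-- In the completed square the preimage of a covector on `V` has vanishing shifted scalar
coordinate, so only `ρ P` has to be inverted. -/
theorem slotZ_eq {ρ : ℝ} (hρ : ρ ≠ 0) {dρ : Module.Dual ℝ V}
    {P h : LinearMap.BilinForm ℝ V} (hP : P.Nondegenerate)
    (hh : ∀ u v, h u v = ρ * P u v + 1 / (4 * ρ) * (dρ u * dρ v))
    (hF : (slotForm ρ ((1 / 2 : ℝ) • dρ) h).Nondegenerate) :
    slotZ (slotForm ρ ((1 / 2 : ℝ) • dρ) h) = ρ⁻¹ • inverseForm P := by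
  refine LinearMap.ext fun α => LinearMap.ext fun β => ?_
  have : sharp (slotForm ρ ((1 / 2 : ℝ) • dρ) h) (β ∘ₗ LinearMap.fst ℝ V ℝ)
      = (ρ⁻¹ • sharp P β, -(dρ (ρ⁻¹ • sharp P β) / (2 * ρ))) := by
    refine sharp_eq_of_apply hF fun w => ?_
    rw [slotForm_complete_square hρ hh]
    simp only [neg_add_cancel, mul_zero, zero_mul, zero_add, map_smul, LinearMap.smul_apply,
      apply_sharp hP, smul_eq_mul, LinearMap.comp_apply, LinearMap.fst_apply]
    field_simp
  rw [slotZ_apply, this]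
  simp [inverseForm_apply]

theorem slotT_eq {ρ : ℝ} (hρ : ρ ≠ 0) {dρ : Module.Dual ℝ V}
    {P h : LinearMap.BilinForm ℝ V} (hP : P.Nondegenerate)
    (hh : ∀ u v, h u v = ρ * P u v + 1 / (4 * ρ) * (dρ u * dρ v))
    (hF : (slotForm ρ ((1 / 2 : ℝ) • dρ) h).Nondegenerate) :
    slotT (slotForm ρ ((1 / 2 : ℝ) • dρ) h) = -(1 / (4 * ρ ^ 2)) • sharp P dρ := by
  -- The shifted scalar coordinate is now `1/ρ`. The vector part must cancel the resulting `dρ/(2ρ)`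
  -- against `ρ P`, which gives `-1/(2ρ²)`, halved in `slotT`.
  have : sharp (slotForm ρ ((1 / 2 : ℝ) • dρ) h) (LinearMap.snd ℝ V ℝ)
      = (-(1 / (2 * ρ ^ 2)) • sharp P dρ,
        ρ⁻¹ - dρ (-(1 / (2 * ρ ^ 2)) • sharp P dρ) / (2 * ρ)) := by
    refine sharp_eq_of_apply hF fun w => ?_
    rw [slotForm_complete_square hρ hh]
    simp only [sub_add_cancel, map_smul, LinearMap.smul_apply, apply_sharp hP, smul_eq_mul,
      LinearMap.snd_apply]
    field_simp
    ring
  rw [slotT, this, smul_smul]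
  congr 1
  field_simp
  norm_num

end LinearAlgebra

/-! ### Tractors -/

section Tractors

variable {n : ℕ} {M : Type*} [TopologicalSpace M] [ChartedSpace (EuclideanHalfSpace (n + 1)) M]
  [IsManifold (𝓡∂ (n + 1)) ∞ M]

theorem finiteDimensional_tan (x : M) : FiniteDimensional ℝ (Tan n x) :=
  (coordFrame (n := n) x x).finiteDimensional_of_finite

/-- Two connections in the projective class are related by a one-form, smooth near `x`. -/
theorem InProjClass.exists_smoothForm {nabla D D' : ConnOp n M} {x : M}
    (hD : InProjClass nabla x D) (hD' : InProjClass nabla x D') :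
    ∃ W : Set M, IsOpen W ∧ x ∈ W ∧ IsAffineConnectionOn D W ∧ IsAffineConnectionOn D' W ∧
      ∃ Υ : ∀ x : M, Module.Dual ℝ (Tan n x), SmoothFormOn Υ W ∧
        ∀ y ∈ W, ProjRelAt D D' y (Υ y) := by
  obtain ⟨W₁, h1, h2, h3, h4⟩ := hD
  obtain ⟨W₂, k1, k2, k3, k4⟩ := hD'
  refine ⟨W₁ ∩ W₂, h1.inter k1, ⟨h2, k2⟩, h3.mono inter_subset_left, k3.mono inter_subset_right,
    exists_smoothForm_projRelAt (h1.inter k1) (h3.mono inter_subset_left)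
      (k3.mono inter_subset_right) fun y hy => ?_⟩
  obtain ⟨Υ₁, hΥ₁⟩ := h4 y ⟨hy.1.1, hy.2⟩
  obtain ⟨Υ₂, hΥ₂⟩ := k4 y ⟨hy.1.2, hy.2⟩
  exact ⟨_, hΥ₁.symm.trans hΥ₂⟩

theorem Splitting.exists_projRelAt {nabla : ConnOp n M} {x : M} (D D' : Splitting nabla x) :
    ∃ Υ : Module.Dual ℝ (Tan n x), ProjRelAt D.1 D'.1 x Υ := by
  obtain ⟨W, _, hx, _, _, Υ, _, h⟩ := D.2.exists_smoothForm D'.2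
  exact ⟨Υ x, h x hx⟩

theorem Tractor.split_change {nabla : ConnOp n M} {x : M} {D D' : Splitting nabla x}
    {Υ : Module.Dual ℝ (Tan n x)} (h : ProjRelAt D.1 D'.1 x Υ) (b : Frame n x)
    (s : Tractor nabla x) : Tractor.split D' b s
      = ((Tractor.split D b s).1, (Tractor.split D b s).2 - Υ (Tractor.split D b s).1) :=
  s.2.2 D D' Υ h b

theorem Tractor.split_frame {nabla : ConnOp n M} {x : M} (D : Splitting nabla x)
    (b b' : Frame n x) (s : Tractor nabla x) :
    Tractor.split D b' s = |b.det b'| ^ (1 / ((n : ℝ) + 2)) • Tractor.split D b s :=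
  s.2.1 D b b'

/-- One splitting and one frame determine a tractor, as any two connections in the class differ by a
unique one-form. Conversely, the prescribed values are consistent because these forms add up and
determinants multiply. -/
theorem Tractor.split_bijective {nabla : ConnOp n M} {x : M} (D : Splitting nabla x)
    (b : Frame n x) : Function.Bijective (Tractor.split D b) := by
  constructor
  · rw [injective_iff_map_eq_zero]
    intro s hs
    refine Subtype.ext (funext fun D' => funext fun b' => ?_)
    obtain ⟨Υ, hΥ⟩ := D.exists_projRelAt D'
    have h1 := Tractor.split_frame D b b' s
    rw [hs, smul_zero] at h1
    have h2 := Tractor.split_change hΥ b' s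
    rw [h1] at h2
    refine h2.trans ?_
    simp
  · intro q
    choose Υ hΥ using fun D' => D.exists_projRelAt D'
    refine ⟨⟨fun D' b' => |b.det b'| ^ (1 / ((n : ℝ) + 2)) • (q.1, q.2 - Υ D' q.1), ?_, ?_⟩, ?_⟩
    · intro D' b₁ b₂
      beta_reduce
      rw [abs_det_mul b b₁ b₂, Real.mul_rpow (abs_nonneg _) (abs_nonneg _), mul_smul]
    · intro D₁ D₂ Υ' h b'
      have : Υ D₂ = Υ D₁ + Υ' := (hΥ D₂).unique ((hΥ D₁).trans h)
      beta_reduce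
      rw [this]
      refine Prod.ext rfl ?_
      simp only [Prod.smul_snd, Prod.smul_fst, smul_eq_mul, map_smul, LinearMap.add_apply]
      ring
    · have h0 : Υ D = 0 := (hΥ D).unique (ProjRelAt.refl _ _)
      change |b.det b| ^ (1 / ((n : ℝ) + 2)) • (q.1, q.2 - Υ D q.1) = q
      rw [h0, Module.Basis.det_self]
      simp

/-! ### The tractor metric in the splitting of the extended connection -/

/-- The trailing slot `½ D_a D_b ρ + ρ P_{ab}` of the tractor metric. -/
noncomputable def trailingSlot (D : ConnOp n M) (ρ : M → ℝ) (x : M) :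
    LinearMap.BilinForm ℝ (Tan n x) :=
  (1 / 2 : ℝ) • hessian D ρ x + ρ x • schouten D x

/-- The bilinear form with slots `ρ`, `½ dρ` and `½ D_a D_b ρ + ρ P_{ab}`. -/
noncomputable def metricForm (D : ConnOp n M) (ρ : M → ℝ) (x : M) :
    LinearMap.BilinForm ℝ (Tan n x × ℝ) :=
  slotForm (ρ x) ((1 / 2 : ℝ) • differential ρ x) (trailingSlot D ρ x)

theorem trailingSlot_apply (D : ConnOp n M) (ρ : M → ℝ) (x : M) (u v : Tan n x) :
    trailingSlot D ρ x u v = 1 / 2 * hessian D ρ x u v + ρ x * schouten D x u v := rfl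

theorem hessDens_coordFrame (D : ConnOp n M) {w : ℝ} (τ : ∀ x : M, Dens n w x) (x : M)
    (j k : Fin (n + 1)) : hessDens D τ x (coordFrame x x j) (coordFrame x x k)
      = covDens D (covDensField D τ (fun y => coordFrame x y k)) x (coordFrame x x j)
        - covDens D τ x (D (fun y => coordFrame x y k) x (coordFrame x x j)) := by
  rw [hessDens, Matrix.toLinearMap₂_apply_basis]
  rfl

variable {D₀ D : ConnOp n M} {W : Set M} {Υ : ∀ x : M, Module.Dual ℝ (Tan n x)} {ρ : M → ℝ}
  {τ τhat : ∀ x : M, Dens n 2 x}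

theorem covDens_eq_of_projRelAt (hW : IsOpen W) (hρ : SmoothFnOn n ρ W)
    (h : ∀ y ∈ W, ProjRelAt D₀ D y (Υ y)) (hτhat : IsParallelScaleOn D₀ τhat W)
    (hτ : ∀ y ∈ W, τ y = ρ y • τhat y) {x : M} (hx : x ∈ W) (v : Tan n x) :
    covDens D τ x v
      = (differential ρ x v + 2 * ρ x * Υ x v) * (τhat x).1 (coordFrame x x) := by
  rw [covDens_congr D (τ' := fun y => ρ y • τhat y)
    (by filter_upwards [hW.mem_nhds hx] with y hy using hτ y hy),
    covDens_smul D (SmoothFnOn.diffFnAt hρ hW hx) (hτhat.1.diffFnAt_coordFrame hW hx),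
    covDens_of_projRelAt (h x hx), (hτhat.2 x hx).2]
  simp only [LinearMap.zero_apply]
  ring

/-- Differentiate `ρ τ̂` twice with `τ̂` parallel for `D₀`. The derivatives of `Υ` cancel against
those in the Schouten tensor, leaving an algebraic expression in `Υ`. It serves twice: for any `D`
in the class, to make L(τ) independent of the splitting, and for ∇ itself, to compute the trailing
slot in the interior. -/
theorem hessDens_eq_of_projRelAt (hn : 1 ≤ n) (hW : IsOpen W) (hD₀ : IsAffineConnectionOn D₀ W)
    (hD : IsAffineConnectionOn D W) (hρ : SmoothFnOn n ρ W) (hΥ : SmoothFormOn Υ W)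
    (h : ∀ y ∈ W, ProjRelAt D₀ D y (Υ y)) (hτhat : IsParallelScaleOn D₀ τhat W)
    (hτ : ∀ y ∈ W, τ y = ρ y • τhat y) {x : M} (hx : x ∈ W) (u v : Tan n x) :
    1 / 2 * hessDens D τ x u v + (τ x).1 (coordFrame x x) * schouten D x u v
      = (τhat x).1 (coordFrame x x) * (trailingSlot D₀ ρ x u v
        + 1 / 2 * (Υ x u * differential ρ x v + differential ρ x u * Υ x v)
        + ρ x * (Υ x u * Υ x v)) := by
  have hmain : (1 / 2 : ℝ) • hessDens D τ x + (τ x).1 (coordFrame x x) • schouten D x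
      = (τhat x).1 (coordFrame x x) • (trailingSlot D₀ ρ x
        + (1 / 2 : ℝ) • ((LinearMap.mul ℝ ℝ).compl₁₂ (Υ x) (differential ρ x)
          + (LinearMap.mul ℝ ℝ).compl₁₂ (differential ρ x) (Υ x))
        + ρ x • (LinearMap.mul ℝ ℝ).compl₁₂ (Υ x) (Υ x)) := by
    refine LinearMap.ext_basis (coordFrame x x) (coordFrame x x) fun j k => ?_
    have hW' := mem_source_inter_open (n := n) hW x
    set W' := W ∩ (chartAt (EuclideanHalfSpace (n + 1)) x).source with hdef
    have hs : W' ⊆ W := inter_subset_left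
    have hx' : x ∈ W' := ⟨hx, mem_chart_source _ x⟩
    have he := (isSmoothFrameOn_coordFrame (n := n) x).mono (W' := W') inter_subset_right
    have hρd := SmoothFnOn.diffFnAt hρ hW hx
    have hτx : (τ x).1 (coordFrame x x) = ρ x * (τhat x).1 (coordFrame x x) := by
      rw [hτ x hx]
      rfl
    have s1 : SmoothFnOn n (fun y => differential ρ y (coordFrame x y k)) W' :=
      SmoothFnOn.differential hW' (hρ.mono hs) (he k)
    have s2 : SmoothFnOn n (fun y => Υ y (coordFrame x y k)) W' := hΥ W' hs hW' _ (he k)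
    have d1 := s1.diffFnAt hW' hx'
    have d2 := s2.diffFnAt hW' hx'
    have d3 : DiffFnAt n (fun y => ρ y * Υ y (coordFrame x y k)) x := MDifferentiableAt.mul hρd d2
    have d4 : DiffFnAt n (fun y => 2 * (ρ y * Υ y (coordFrame x y k))) x :=
      MDifferentiableAt.mul mdifferentiableAt_const d3
    have hfield : ∀ᶠ y in 𝓝 x, covDensField D τ (fun y => coordFrame x y k) y
        = (differential ρ y (coordFrame x y k) + 2 * (ρ y * Υ y (coordFrame x y k))) • τhat y := by
      filter_upwards [hW.mem_nhds hx] with y hy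
      refine Dens.ext_frame (coordFrame y y) ?_
      rw [covDensField, Dens.mk_apply_self, covDens_eq_of_projRelAt hW hρ h hτhat hτ hy, mul_assoc 2]
      rfl
    have hcov : covDens D (covDensField D τ (fun y => coordFrame x y k)) x (coordFrame x x j)
        = (differential ρ x (coordFrame x x k) + 2 * (ρ x * Υ x (coordFrame x x k)))
            * (2 * (τhat x).1 (coordFrame x x) * Υ x (coordFrame x x j))
          + (differential (fun y => differential ρ y (coordFrame x y k)) x (coordFrame x x j)
            + 2 * (ρ x * differential (fun y => Υ y (coordFrame x y k)) x (coordFrame x x j)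
              + Υ x (coordFrame x x k) * differential ρ x (coordFrame x x j)))
            * (τhat x).1 (coordFrame x x) := by
      have d5 : DiffFnAt n (fun y => differential ρ y (coordFrame x y k)
          + 2 * (ρ y * Υ y (coordFrame x y k))) x := MDifferentiableAt.add d1 d4
      rw [covDens_congr D hfield, covDens_smul D d5
        (hτhat.1.diffFnAt_coordFrame hW hx), covDens_of_projRelAt (h x hx), (hτhat.2 x hx).2,
        differential_add d1 d4, differential_const_mul 2 d3, differential_mul hρd d2]
      simp only [LinearMap.zero_apply, zero_add]
    have hDe := h x hx (fun y => coordFrame x y k)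
      (diffVectorAt_coordFrame (n := n) (mem_chart_source _ x) k) (coordFrame x x j)
    simp only [LinearMap.add_apply, LinearMap.smul_apply, smul_eq_mul, LinearMap.compl₁₂_apply,
      LinearMap.mul_apply']
    rw [hessDens_coordFrame, hcov, covDens_eq_of_projRelAt hW hρ h hτhat hτ hx, hDe, hτx,
      schouten_of_projRelAt hn hW hD₀ hD hΥ h hx, trailingSlot_apply, hessian_coordFrame]
    simp only [rhoForm, map_add, map_smul, smul_eq_mul]
    ring
  exact congrArg (fun B : LinearMap.BilinForm ℝ (Tan n x) => B u v) hmain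

/-- In the splitting of any connection in the class, the tractor form defined by `τ` is given by
the same form. -/
theorem slotForm_eq_metricForm (hn : 1 ≤ n) (hW : IsOpen W) (hD₀ : IsAffineConnectionOn D₀ W)
    (hD : IsAffineConnectionOn D W) (hρ : SmoothFnOn n ρ W) (hΥ : SmoothFormOn Υ W)
    (h : ∀ y ∈ W, ProjRelAt D₀ D y (Υ y)) (hτhat : IsParallelScaleOn D₀ τhat W)
    (hτ : ∀ y ∈ W, τ y = ρ y • τhat y) {x : M} (hx : x ∈ W) (s t : Tan n x × ℝ) :
    slotForm ((τ x).1 (coordFrame x x)) ((1 / 2 : ℝ) • covDens D τ x)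
      ((1 / 2 : ℝ) • hessDens D τ x + (τ x).1 (coordFrame x x) • schouten D x)
      (s.1, s.2 - Υ x s.1) (t.1, t.2 - Υ x t.1)
      = (τhat x).1 (coordFrame x x) * metricForm D₀ ρ x s t := by
  have hτx : (τ x).1 (coordFrame x x) = ρ x * (τhat x).1 (coordFrame x x) := by
    rw [hτ x hx]
    rfl
  have h1 := hessDens_eq_of_projRelAt hn hW hD₀ hD hρ hΥ h hτhat hτ hx s.1 t.1
  rw [slotForm_apply, metricForm, slotForm_apply]
  simp only [LinearMap.add_apply, LinearMap.smul_apply, smul_eq_mul]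
  rw [h1, covDens_eq_of_projRelAt hW hρ h hτhat hτ hx, covDens_eq_of_projRelAt hW hρ h hτhat hτ hx,
    hτx]
  ring

end Tractors

/-! ### The tractor metric: independence of the splitting and non-degeneracy -/

section Metric

variable {n : ℕ} {M : Type*} [TopologicalSpace M] [ChartedSpace (EuclideanHalfSpace (n + 1)) M]
  [IsManifold (𝓡∂ (n + 1)) ∞ M]

theorem IsParallelScaleOn.mono {D : ConnOp n M} {w : ℝ} {τ : ∀ x : M, Dens n w x} {W W' : Set M}
    (h : IsParallelScaleOn D τ W) (hs : W' ⊆ W) : IsParallelScaleOn D τ W' :=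
  ⟨fun V hV => h.1 V (hV.trans hs), fun x hx => h.2 x (hs hx)⟩

theorem SmoothFormOn.mono {Υ : ∀ x : M, Module.Dual ℝ (Tan n x)} {W W' : Set M}
    (h : SmoothFormOn Υ W) (hs : W' ⊆ W) : SmoothFormOn Υ W' :=
  fun V hV => h V (hV.trans hs)

variable {nabla D₀ : ConnOp n M} {U : Set M} {ρ : M → ℝ} {τ τhat : ∀ x : M, Dens n 2 x}

/-- The right-hand side does not involve `D`, which is why L(τ) is well defined. -/
theorem splittingOp_eq (hn : 1 ≤ n) (hρ : IsLocalDefiningFunction n ρ U)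
    (hD₀ : IsExtension nabla 2 ρ U D₀) (hτhat : IsParallelScaleOn D₀ τhat U)
    (hτ : ∀ x ∈ U, τ x = ρ x • τhat x) {x : M} (hx : x ∈ U) (D : Splitting nabla x) :
    splittingOp D τ = (τhat x).1 (coordFrame x x) • (metricForm D₀ ρ x).compl₁₂
      (Tractor.split ⟨D₀, hD₀.inProjClass hρ.isOpen hx⟩ (coordFrame x x))
      (Tractor.split ⟨D₀, hD₀.inProjClass hρ.isOpen hx⟩ (coordFrame x x)) := by
  obtain ⟨W, hW, hxW, h0, h1, Υ, hΥ, hrel⟩ :=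
    (hD₀.inProjClass hρ.isOpen hx).exists_smoothForm D.2
  have hs : W ∩ U ⊆ W := inter_subset_left
  have hs' : W ∩ U ⊆ U := inter_subset_right
  refine LinearMap.ext fun s => LinearMap.ext fun t => ?_
  have key := slotForm_eq_metricForm hn (hW.inter hρ.isOpen) (h0.mono hs) (h1.mono hs)
    (hρ.smooth.mono hs') (hΥ.mono hs) (fun y hy => hrel y hy.1) (hτhat.mono hs')
    (fun y hy => hτ y hy.2) ⟨hxW, hx⟩
    (Tractor.split ⟨D₀, hD₀.inProjClass hρ.isOpen hx⟩ (coordFrame x x) s)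
    (Tractor.split ⟨D₀, hD₀.inProjClass hρ.isOpen hx⟩ (coordFrame x x) t)
  have hrelx : ProjRelAt (⟨D₀, hD₀.inProjClass hρ.isOpen hx⟩ : Splitting nabla x).1 D.1 x (Υ x) :=
    hrel x hxW
  rw [← Tractor.split_change hrelx, ← Tractor.split_change hrelx] at key
  exact key

theorem splittingOp_eq_tractorMetric (hn : 1 ≤ n) (hρ : IsLocalDefiningFunction n ρ U)
    (hD₀ : IsExtension nabla 2 ρ U D₀) (hτhat : IsParallelScaleOn D₀ τhat U)
    (hτ : ∀ x ∈ U, τ x = ρ x • τhat x) {x : M} (hx : x ∈ U) (D : Splitting nabla x) :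
    splittingOp D τ = tractorMetric nabla τ x := by
  have hne : Nonempty (Splitting nabla x) := ⟨D⟩
  rw [tractorMetric, dif_pos hne, splittingOp_eq hn hρ hD₀ hτhat hτ hx,
    splittingOp_eq hn hρ hD₀ hτhat hτ hx]

/-- The tractor metric in the splitting of the extended connection. -/
theorem tractorMetric_eq (hn : 1 ≤ n) (hρ : IsLocalDefiningFunction n ρ U)
    (hD₀ : IsExtension nabla 2 ρ U D₀) (hτhat : IsParallelScaleOn D₀ τhat U)
    (hτ : ∀ x ∈ U, τ x = ρ x • τhat x) {x : M} (hx : x ∈ U) (b : Frame n x) :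
    tractorMetric nabla τ x = (τhat x).1 b • (metricForm D₀ ρ x).compl₁₂
      (Tractor.split ⟨D₀, hD₀.inProjClass hρ.isOpen hx⟩ b)
      (Tractor.split ⟨D₀, hD₀.inProjClass hρ.isOpen hx⟩ b) := by
  rw [← splittingOp_eq_tractorMetric hn hρ hD₀ hτhat hτ hx
    ⟨D₀, hD₀.inProjClass hρ.isOpen hx⟩, splittingOp_eq hn hρ hD₀ hτhat hτ hx]
  refine LinearMap.ext fun s => LinearMap.ext fun t => ?_
  simp only [LinearMap.smul_apply, LinearMap.compl₁₂_apply, smul_eq_mul]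
  rw [Tractor.split_frame _ b (coordFrame x x) s, Tractor.split_frame _ b (coordFrame x x) t,
    Dens.apply_eq (τhat x) b (coordFrame x x)]
  simp only [map_smul, LinearMap.smul_apply, smul_eq_mul]
  have hpos : 0 < |b.det (coordFrame x x)| := abs_pos.2 (frame_det_ne_zero _ _)
  -- Weight 2 of τ̂ balances the two tractor arguments, each scaling with exponent `1/(n+2)`.
  have hk : |b.det (coordFrame x x)| ^ (-2 / ((n : ℝ) + 2))
      * (|b.det (coordFrame x x)| ^ (1 / ((n : ℝ) + 2))
        * |b.det (coordFrame x x)| ^ (1 / ((n : ℝ) + 2))) = 1 := by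
    rw [← Real.rpow_add hpos, ← Real.rpow_add hpos]
    convert Real.rpow_zero _ using 2
    ring
  linear_combination (((τhat x).1 b) * metricForm D₀ ρ x
    (Tractor.split ⟨D₀, hD₀.inProjClass hρ.isOpen hx⟩ b s)
    (Tractor.split ⟨D₀, hD₀.inProjClass hρ.isOpen hx⟩ b t)) * hk

theorem mem_nondegLocus_iff (hn : 1 ≤ n) (hρ : IsLocalDefiningFunction n ρ U)
    (hD₀ : IsExtension nabla 2 ρ U D₀) (hτhat : IsParallelScaleOn D₀ τhat U)
    (hτ : ∀ x ∈ U, τ x = ρ x • τhat x) {x : M} :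
    x ∈ nondegLocus nabla τ U ↔ x ∈ U ∧ (metricForm D₀ ρ x).Nondegenerate := by
  refine and_congr_right fun hx => ?_
  rw [tractorMetric_eq hn hρ hD₀ hτhat hτ hx (coordFrame x x)]
  exact nondegenerate_smul_compl₁₂_iff (Tractor.split_bijective _ _)
    ((Dens.ne_zero_iff _).1 (hτhat.2 x hx).1)

theorem trailingSlot_symm (hρ : IsLocalDefiningFunction n ρ U)
    (hD₀ : IsAffineConnectionOn D₀ U) (hτhat : IsParallelScaleOn D₀ τhat U) {x : M}
    (hx : x ∈ U) (u v : Tan n x) : trailingSlot D₀ ρ x u v = trailingSlot D₀ ρ x v u := by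
  rw [trailingSlot_apply, trailingSlot_apply, hessian_symm hρ.isOpen hD₀ hρ.smooth hx,
    schouten_symm_of_parallel hρ.isOpen hD₀ two_ne_zero hτhat hx]

theorem metricForm_symm (hρ : IsLocalDefiningFunction n ρ U)
    (hD₀ : IsAffineConnectionOn D₀ U) (hτhat : IsParallelScaleOn D₀ τhat U) {x : M}
    (hx : x ∈ U) (s t : Tan n x × ℝ) : metricForm D₀ ρ x s t = metricForm D₀ ρ x t s :=
  slotForm_symm (trailingSlot_symm hρ hD₀ hτhat hx) s t

theorem hessDens_eq_zero_of_parallel {D : ConnOp n M} {W : Set M} (hW : IsOpen W)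
    {w : ℝ} {τ : ∀ x : M, Dens n w x} (hτ : IsParallelScaleOn D τ W) {x : M} (hx : x ∈ W) :
    hessDens D τ x = 0 := by
  refine LinearMap.ext_basis (coordFrame x x) (coordFrame x x) fun j k => ?_
  have h0 : ∀ᶠ y in 𝓝 x, covDensField D τ (fun y => coordFrame x y k) y = (0 : ℝ) • τ y := by
    filter_upwards [hW.mem_nhds hx] with y hy
    refine Dens.ext_frame (coordFrame y y) ?_
    rw [covDensField, Dens.mk_apply_self, (hτ.2 y hy).2, zero_smul]
    rfl
  rw [hessDens_coordFrame, covDens_congr D h0, covDens_smul D (f := fun _ => (0 : ℝ))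
    mdifferentiableAt_const (hτ.1.diffFnAt_coordFrame hW hx), (hτ.2 x hx).2, differential_const]
  simp

/-- Apply the projective change formula from `D₀` to ∇ with `Υ = -dρ/(2ρ)`. For ∇ the Hessian of τ
vanishes, so only τ times the Schouten tensor is left; dividing by τ̂ and collecting the terms in
`dρ ⊗ dρ` gives the coefficient `1/(4ρ)`. -/
theorem trailingSlot_interior (hn : 1 ≤ n)
    (hconn : IsAffineConnectionOn nabla ((𝓡∂ (n + 1)).interior M))
    (hτpar : IsParallelScaleOn nabla τ ((𝓡∂ (n + 1)).interior M))
    (hρ : IsLocalDefiningFunction n ρ U) (hD₀ : IsExtension nabla 2 ρ U D₀)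
    (hτhat : IsParallelScaleOn D₀ τhat U) (hτ : ∀ x ∈ U, τ x = ρ x • τhat x) {x : M}
    (hx : x ∈ U) (hi : x ∈ (𝓡∂ (n + 1)).interior M) (u v : Tan n x) :
    trailingSlot D₀ ρ x u v = ρ x * schouten nabla x u v
      + 1 / (4 * ρ x) * (differential ρ x u * differential ρ x v) := by
  have hW : IsOpen (U ∩ (𝓡∂ (n + 1)).interior M) := hρ.isOpen.inter isOpen_interiorPoints
  have hs : U ∩ (𝓡∂ (n + 1)).interior M ⊆ U := inter_subset_left
  have hs' : U ∩ (𝓡∂ (n + 1)).interior M ⊆ (𝓡∂ (n + 1)).interior M := inter_subset_right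
  have hsm : SmoothFnOn n (fun y => -(2 * ρ y)⁻¹) (U ∩ (𝓡∂ (n + 1)).interior M) :=
    ContMDiffOn.neg (SmoothFnOn.inv (contMDiffOn_const.mul (hρ.smooth.mono hs))
      (fun y hy => mul_ne_zero two_ne_zero (hρ.ne_zero hy.1 hy.2)))
  have key := hessDens_eq_of_projRelAt hn hW (hD₀.1.mono hs) (hconn.mono hs')
    (hρ.smooth.mono hs) (smoothFormOn_smul_differential hsm (hρ.smooth.mono hs))
    (fun y hy => by
      have e : -(2 * ρ y)⁻¹ • differential (n := n) ρ y = -((2 * ρ y)⁻¹ • differential ρ y) := by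
        ext v
        simp
      exact e ▸ (hD₀.2 y hy).symm) (hτhat.mono hs) (fun y hy => hτ y hy.1) ⟨hx, hi⟩ u v
  have hτx : (τ x).1 (coordFrame x x) = ρ x * (τhat x).1 (coordFrame x x) := by
    rw [hτ x hx]
    rfl
  have hρx := hρ.ne_zero hx hi
  have h0 : (τhat x).1 (coordFrame x x) ≠ 0 := (Dens.ne_zero_iff _).1 (hτhat.2 x hx).1
  rw [hessDens_eq_zero_of_parallel isOpen_interiorPoints hτpar hi, hτx] at key
  simp only [LinearMap.zero_apply, mul_zero, zero_add, LinearMap.smul_apply, smul_eq_mul] at key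
  have key2 : ρ x * schouten nabla x u v = trailingSlot D₀ ρ x u v
      + 1 / 2 * (-(2 * ρ x)⁻¹ * differential ρ x u * differential ρ x v
        + differential ρ x u * (-(2 * ρ x)⁻¹ * differential ρ x v))
      + ρ x * (-(2 * ρ x)⁻¹ * differential ρ x u * (-(2 * ρ x)⁻¹ * differential ρ x v)) := by
    refine mul_left_cancel₀ h0 ?_
    rw [← key]
    ring
  rw [key2]
  field_simp
  ring

/-- At ρ = 0 the Schouten term drops out, and the trailing slot is half of `D₀ dρ`; its restriction
to the kernel of `dρ` is non-degenerate by assumption. -/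
theorem metricForm_nondegenerate_of_boundary (hnondeg : HasNondegenerateBoundary nabla)
    (hρ : IsLocalDefiningFunction n ρ U) (hD₀ : IsExtension nabla 2 ρ U D₀)
    (hτhat : IsParallelScaleOn D₀ τhat U) {x : M} (hx : x ∈ U)
    (hb : x ∈ (𝓡∂ (n + 1)).boundary M) : (metricForm D₀ ρ x).Nondegenerate := by
  have h0 : ρ x = 0 := (hρ.zero_iff x hx).2 hb
  have h1 := hnondeg x hb U ρ hx hρ D₀ (hD₀.inProjClass hρ.isOpen hx)
  have hker : LinearMap.ker ((1 / 2 : ℝ) • differential (n := n) ρ x)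
      = LinearMap.ker (differential ρ x) := LinearMap.ker_smul _ _ (by norm_num)
  rw [metricForm, h0]
  refine nondegenerate_slotForm_zero (smul_ne_zero (by norm_num) (hρ.differential_ne x hx hb))
    (trailingSlot_symm hρ hD₀.1 hτhat hx) ?_
  rw [hker]
  have e : ∀ u v, (trailingSlot D₀ ρ x).restrict (LinearMap.ker (differential ρ x)) u v
      = 1 / 2 * (hessian D₀ ρ x).restrict (LinearMap.ker (differential ρ x)) u v := by
    intro u v
    change trailingSlot D₀ ρ x u.1 v.1 = 1 / 2 * hessian D₀ ρ x u.1 v.1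
    rw [trailingSlot_apply, h0, zero_mul, add_zero]
  refine ⟨fun u hu => h1.1 u fun v => ?_, fun v hv => h1.2 v fun u => ?_⟩
  · have := hu v
    rw [e] at this
    linarith
  · have := hv u
    rw [e] at this
    linarith

end Metric

/-! ### Smoothness of the inverse -/

/-- The components of the inverse are given by the inverse matrix. The index order `j i` reflects
that `sharp` inverts the form in its first argument. -/
theorem repr_sharp {V ι : Type*} [AddCommGroup V] [Module ℝ V] [Fintype ι] [DecidableEq ι]
    (c : Module.Basis ι ℝ V) {B : LinearMap.BilinForm ℝ V} (hB : B.Nondegenerate)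
    (ℓ : Module.Dual ℝ V) (i : ι) :
    c.repr (sharp B ℓ) i = ∑ j, ℓ (c j) * (LinearMap.toMatrix₂ c c B)⁻¹ j i := by
  have := c.finiteDimensional_of_finite
  have hdet : IsUnit (LinearMap.toMatrix₂ c c B).det :=
    isUnit_iff_ne_zero.2 ((LinearMap.separatingLeft_iff_det_ne_zero c).1 hB.1)
  have h : sharp B ℓ = ∑ i, (∑ j, ℓ (c j) * (LinearMap.toMatrix₂ c c B)⁻¹ j i) • c i := by
    refine sharp_eq_of_apply hB fun w => ?_
    have : B (∑ i, (∑ j, ℓ (c j) * (LinearMap.toMatrix₂ c c B)⁻¹ j i) • c i) = ℓ := by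
      refine c.ext fun k => ?_
      have e : ∀ i, B (c i) (c k) = LinearMap.toMatrix₂ c c B i k := fun i =>
        (LinearMap.toMatrix₂_apply c c B i k).symm
      simp only [map_sum, map_smul, LinearMap.coe_sum, Finset.sum_apply, LinearMap.smul_apply,
        smul_eq_mul, e, Finset.sum_mul]
      rw [Finset.sum_comm]
      simp only [mul_assoc, ← Finset.mul_sum, ← Matrix.mul_apply, Matrix.nonsing_inv_mul _ hdet,
        Matrix.one_apply, mul_ite, mul_one, mul_zero, Finset.sum_ite_eq', Finset.mem_univ, if_true]
    rw [this]
  rw [h, c.repr_sum_self]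

section Smoothness

variable {n : ℕ} {M : Type*} [TopologicalSpace M] [ChartedSpace (EuclideanHalfSpace (n + 1)) M]
  [IsManifold (𝓡∂ (n + 1)) ∞ M]

/-- The basis of `T_x M ⊕ ℝ` defined by a basis of the tangent space. -/
noncomputable def extendedFrame {x : M} (b : Frame n x) :
    Module.Basis (Fin (n + 1) ⊕ Unit) ℝ (Tan n x × ℝ) :=
  b.prod (Module.Basis.singleton Unit ℝ)

theorem extendedFrame_inl {x : M} (b : Frame n x) (i : Fin (n + 1)) :
    extendedFrame b (Sum.inl i) = (b i, 0) := by
  simp [extendedFrame]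

theorem extendedFrame_inr {x : M} (b : Frame n x) (i : Unit) :
    extendedFrame b (Sum.inr i) = (0, 1) := by
  simp [extendedFrame]

theorem extendedFrame_repr_inl {x : M} (b : Frame n x) (s : Tan n x × ℝ) (i : Fin (n + 1)) :
    (extendedFrame b).repr s (Sum.inl i) = b.repr s.1 i := by
  simp [extendedFrame]

theorem extendedFrame_repr_inr {x : M} (b : Frame n x) (s : Tan n x × ℝ) (i : Unit) :
    (extendedFrame b).repr s (Sum.inr i) = s.2 := by
  simp [extendedFrame]

variable {D₀ : ConnOp n M} {U : Set M} {ρ : M → ℝ}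

theorem smoothBilinOn_trailingSlot (hU : IsOpen U) (hρ : SmoothFnOn n ρ U)
    (hD₀ : IsAffineConnectionOn D₀ U) : SmoothBilinOn (trailingSlot D₀ ρ) U :=
  fun W' hs hW' b hb i j => ContMDiffOn.add
    (contMDiffOn_const.mul (smoothBilinOn_hessian hD₀ hρ W' hs hW' b hb i j))
    (ContMDiffOn.mul (hρ.mono hs) (hD₀.smoothBilinOn_schouten hU W' hs hW' b hb i j))

theorem smoothFnOn_metricForm (hU : IsOpen U) (hρ : SmoothFnOn n ρ U)
    (hD₀ : IsAffineConnectionOn D₀ U) {W' : Set M} (hs : W' ⊆ U) (hW' : IsOpen W')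
    {b : ∀ x : M, Frame n x} (hb : IsSmoothFrameOn b W') (i j : Fin (n + 1) ⊕ Unit) :
    SmoothFnOn n (fun y => LinearMap.toMatrix₂ (extendedFrame (b y)) (extendedFrame (b y))
      (metricForm D₀ ρ y) i j) W' := by
  have hd : ∀ i, SmoothFnOn n (fun y => 1 / 2 * differential ρ y (b y i)) W' := fun i =>
    contMDiffOn_const.mul (SmoothFnOn.differential hW' (hρ.mono hs) (hb i))
  simp only [LinearMap.toMatrix₂_apply, metricForm, slotForm_apply]
  rcases i with i | i <;> rcases j with j | j
  · simpa [extendedFrame_inl] using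
      smoothBilinOn_trailingSlot hU hρ hD₀ W' hs hW' b hb i j
  · simpa [extendedFrame_inl, extendedFrame_inr] using hd i
  · simpa [extendedFrame_inl, extendedFrame_inr] using hd j
  · simpa [extendedFrame_inr] using ContMDiffOn.mono hρ hs

theorem metricForm_nondegenerate_iff {x : M} (b : Frame n x) :
    (metricForm D₀ ρ x).Nondegenerate ↔ (LinearMap.toMatrix₂ (extendedFrame b) (extendedFrame b)
      (metricForm D₀ ρ x)).det ≠ 0 :=
  ⟨fun h => (LinearMap.separatingLeft_iff_det_ne_zero _).1 h.1, fun h =>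
    ⟨(LinearMap.separatingLeft_iff_det_ne_zero _).2 h,
      (LinearMap.separatingRight_iff_det_ne_zero _).2 h⟩⟩

theorem isOpen_nondegenerate (hU : IsOpen U) (hρ : SmoothFnOn n ρ U)
    (hD₀ : IsAffineConnectionOn D₀ U) :
    IsOpen {x | x ∈ U ∧ (metricForm D₀ ρ x).Nondegenerate} := by
  rw [isOpen_iff_mem_nhds]
  rintro x ⟨hx, hnd⟩
  have hW := mem_source_inter_open (n := n) hU x
  have hxW : x ∈ U ∩ (chartAt (EuclideanHalfSpace (n + 1)) x).source := ⟨hx, mem_chart_source _ x⟩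
  have he := (isSmoothFrameOn_coordFrame (n := n) x).mono
    (W' := U ∩ (chartAt (EuclideanHalfSpace (n + 1)) x).source) inter_subset_right
  have hdet := smoothFnOn_det (smoothFnOn_metricForm hU hρ hD₀ inter_subset_left hW he)
  have hc := ContinuousOn.continuousAt (ContMDiffOn.continuousOn hdet) (hW.mem_nhds hxW)
  filter_upwards [hW.mem_nhds hxW,
    hc.eventually_ne ((metricForm_nondegenerate_iff _).1 hnd)] with y hy hy0
  exact ⟨hy.1, (metricForm_nondegenerate_iff _).2 hy0⟩

theorem smoothFnOn_repr_sharp (hU : IsOpen U) (hρ : SmoothFnOn n ρ U)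
    (hD₀ : IsAffineConnectionOn D₀ U) {W' : Set M} (hs : W' ⊆ U) (hW' : IsOpen W')
    (hnd : ∀ y ∈ W', (metricForm D₀ ρ y).Nondegenerate)
    {b : ∀ x : M, Frame n x} (hb : IsSmoothFrameOn b W')
    {ℓ : ∀ y : M, Module.Dual ℝ (Tan n y × ℝ)}
    (hℓ : ∀ j, SmoothFnOn n (fun y => ℓ y (extendedFrame (b y) j)) W')
    (i : Fin (n + 1) ⊕ Unit) :
    SmoothFnOn n (fun y => (extendedFrame (b y)).repr (sharp (metricForm D₀ ρ y) (ℓ y)) i) W' := by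
  refine ContMDiffOn.congr (f := fun y => ∑ j, ℓ y (extendedFrame (b y) j)
    * (LinearMap.toMatrix₂ (extendedFrame (b y)) (extendedFrame (b y)) (metricForm D₀ ρ y))⁻¹ j i)
    ?_ (fun y hy => repr_sharp _ (hnd y hy) _ _)
  exact smoothFnOn_sum fun j _ => ContMDiffOn.mul (hℓ j) (smoothFnOn_matrix_inv
    (smoothFnOn_metricForm hU hρ hD₀ hs hW' hb)
    (fun y hy => (metricForm_nondegenerate_iff _).1 (hnd y hy)) j i)

theorem smoothFnOn_repr_sharp_snd (hU : IsOpen U) (hρ : SmoothFnOn n ρ U)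
    (hD₀ : IsAffineConnectionOn D₀ U) {W' : Set M} (hs : W' ⊆ U) (hW' : IsOpen W')
    (hnd : ∀ y ∈ W', (metricForm D₀ ρ y).Nondegenerate)
    {b : ∀ x : M, Frame n x} (hb : IsSmoothFrameOn b W') (i : Fin (n + 1) ⊕ Unit) :
    SmoothFnOn n (fun y => (extendedFrame (b y)).repr
      (sharp (metricForm D₀ ρ y) (LinearMap.snd ℝ (Tan n y) ℝ)) i) W' := by
  refine smoothFnOn_repr_sharp hU hρ hD₀ hs hW' hnd hb (fun j => ?_) i
  rcases j with j | j
  · simpa [extendedFrame_inl] using contMDiffOn_const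
  · simpa [extendedFrame_inr] using contMDiffOn_const

theorem smoothVectorOn_slotT (hU : IsOpen U) (hρ : SmoothFnOn n ρ U)
    (hD₀ : IsAffineConnectionOn D₀ U) {V : Set M} (hs : V ⊆ U) (hV : IsOpen V)
    (hnd : ∀ y ∈ V, (metricForm D₀ ρ y).Nondegenerate) :
    SmoothVectorOn (fun x => slotT (metricForm D₀ ρ x)) V := by
  refine smoothVectorOn_of_locally fun x hx =>
    ⟨(chartAt (EuclideanHalfSpace (n + 1)) x).source, (chartAt _ x).open_source,
      mem_chart_source _ x, ?_⟩
  have he := (isSmoothFrameOn_coordFrame (n := n) x).mono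
    (W' := V ∩ (chartAt (EuclideanHalfSpace (n + 1)) x).source) inter_subset_right
  refine smoothVectorOn_of_repr he fun i => ?_
  refine ContMDiffOn.congr (f := fun y => 1 / 2 * (extendedFrame (coordFrame x y)).repr
    (sharp (metricForm D₀ ρ y) (LinearMap.snd ℝ (Tan n y) ℝ)) (Sum.inl i)) ?_ (fun y _ => ?_)
  · exact contMDiffOn_const.mul (smoothFnOn_repr_sharp_snd hU hρ hD₀
      (inter_subset_left.trans hs) (mem_source_inter_open hV x) (fun y hy => hnd y hy.1) he _)
  · rw [extendedFrame_repr_inl, slotT, map_smul, Finsupp.smul_apply, smul_eq_mul]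

theorem smoothFnOn_slotPsi (hU : IsOpen U) (hρ : SmoothFnOn n ρ U)
    (hD₀ : IsAffineConnectionOn D₀ U) {V : Set M} (hs : V ⊆ U) (hV : IsOpen V)
    (hnd : ∀ y ∈ V, (metricForm D₀ ρ y).Nondegenerate) :
    SmoothFnOn n (fun x => slotPsi (metricForm D₀ ρ x)) V := by
  refine contMDiffOn_of_locally_contMDiffOn fun x hx =>
    ⟨(chartAt (EuclideanHalfSpace (n + 1)) x).source, (chartAt _ x).open_source,
      mem_chart_source _ x, ?_⟩
  have he := (isSmoothFrameOn_coordFrame (n := n) x).mono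
    (W' := V ∩ (chartAt (EuclideanHalfSpace (n + 1)) x).source) inter_subset_right
  refine ContMDiffOn.congr (smoothFnOn_repr_sharp_snd hU hρ hD₀ (inter_subset_left.trans hs)
    (mem_source_inter_open hV x) (fun y hy => hnd y hy.1) he (Sum.inr ())) (fun y _ => ?_)
  rw [extendedFrame_repr_inr, slotPsi]

theorem smoothBivectorOn_slotZ (hU : IsOpen U) (hρ : SmoothFnOn n ρ U)
    (hD₀ : IsAffineConnectionOn D₀ U) {V : Set M} (hs : V ⊆ U)
    (hnd : ∀ y ∈ V, (metricForm D₀ ρ y).Nondegenerate) :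
    SmoothBivectorOn (fun x => slotZ (metricForm D₀ ρ x)) V := by
  intro W' hW'V hW' b hb i j
  refine ContMDiffOn.congr (smoothFnOn_repr_sharp hU hρ hD₀ (hW'V.trans hs) hW'
    (fun y hy => hnd y (hW'V hy)) hb
    (ℓ := fun y => (b y).coord j ∘ₗ LinearMap.fst ℝ (Tan n y) ℝ) (fun k => ?_) (Sum.inl i))
    (fun y _ => ?_)
  · rcases k with k | k
    · simpa [extendedFrame_inl, Finsupp.single_apply] using contMDiffOn_const
    · simpa [extendedFrame_inr] using contMDiffOn_const
  · rw [extendedFrame_repr_inl, slotZ_apply]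
    rfl

/-- The slots of the inverse of the tractor metric in the splitting of the extended connection. -/
theorem hasSlots_inverse_tractorMetric {nabla : ConnOp n M} {τ τhat : ∀ x : M, Dens n 2 x}
    (hn : 1 ≤ n) (hρ : IsLocalDefiningFunction n ρ U)
    (hD₀ : IsExtension nabla 2 ρ U D₀) (hτhat : IsParallelScaleOn D₀ τhat U)
    (hτ : ∀ x ∈ U, τ x = ρ x • τhat x) {x : M} (hx : x ∈ U)
    (hF : (metricForm D₀ ρ x).Nondegenerate) (b : Frame n x) :
    HasSlots (inverseForm (tractorMetric nabla τ x)) ⟨D₀, hD₀.inProjClass hρ.isOpen hx⟩ b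
      (((τhat x).1 b)⁻¹ • slotZ (metricForm D₀ ρ x))
      ((2 * ((τhat x).1 b)⁻¹) • slotT (metricForm D₀ ρ x))
      (((τhat x).1 b)⁻¹ * slotPsi (metricForm D₀ ρ x)) := by
  have hc : (τhat x).1 b ≠ 0 := (Dens.ne_zero_iff _).1 (hτhat.2 x hx).1
  have := finiteDimensional_tan (n := n) x
  set S : Splitting nabla x := ⟨D₀, hD₀.inProjClass hρ.isOpen hx⟩ with hS
  have hbij := Tractor.split_bijective S b
  have hT := tractorMetric_eq hn hρ hD₀ hτhat hτ hx b
  have hfin : FiniteDimensional ℝ (Tractor nabla x) :=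
    (LinearEquiv.ofBijective _ hbij).symm.finiteDimensional
  have hnd : (tractorMetric nabla τ x).Nondegenerate := by
    rw [hT]
    exact (nondegenerate_smul_compl₁₂_iff hbij hc).2 hF
  -- The splitting carries L(τ) to τ̂ times the scalar form, so it carries the inverse of L(τ) to
  -- τ̂⁻¹ times the inverse of that form.
  have key : ∀ ℓ : Module.Dual ℝ (Tan n x × ℝ),
      Tractor.split S b (sharp (tractorMetric nabla τ x) (ℓ ∘ₗ Tractor.split S b))
        = ((τhat x).1 b)⁻¹ • sharp (metricForm D₀ ρ x) ℓ := by
    intro ℓ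
    obtain ⟨s, hs⟩ := hbij.2 (((τhat x).1 b)⁻¹ • sharp (metricForm D₀ ρ x) ℓ)
    have : sharp (tractorMetric nabla τ x) (ℓ ∘ₗ Tractor.split S b) = s := by
      refine sharp_eq_of_apply hnd fun t => ?_
      rw [hT]
      simp only [LinearMap.smul_apply, LinearMap.compl₁₂_apply, LinearMap.comp_apply]
      rw [← hS, hs, map_smul, apply_sharp hF]
      simp [hc]
    rw [this, hs]
  intro β₁ β₂ μ₁ μ₂
  have h1 := inverseForm_slots hF (metricForm_symm hρ hD₀.1 hτhat hx) β₁ β₂ μ₁ μ₂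
  rw [inverseForm_apply] at h1
  rw [inverseForm_apply]
  simp only [cotractor]
  rw [LinearMap.comp_apply, key, map_smul, h1]
  simp only [LinearMap.smul_apply, map_smul, smul_eq_mul]
  ring

end Smoothness

end ProjCompact

/-! ### The main theorem -/

theorem proposition4p2 {n : ℕ} (hn : 1 ≤ n)
    {M : Type*} [TopologicalSpace M] [T2Space M] [SecondCountableTopology M]
    [ChartedSpace (EuclideanHalfSpace (n + 1)) M] [IsManifold (𝓡∂ (n + 1)) ∞ M]
    (nabla : ConnOp n M)
    (hconn : IsAffineConnectionOn nabla ((𝓡∂ (n + 1)).interior M))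
    (hspecial : IsSpecial nabla)
    (hcompact : IsProjectivelyCompact nabla 2)
    (hnondeg : HasNondegenerateBoundary nabla)
    -- the density of weight 2 on the interior that is parallel for `∇`, extended by zero
    (τ : ∀ x : M, Dens n 2 x)
    (hτ : IsParallelScaleOn nabla τ ((𝓡∂ (n + 1)).interior M))
    (hτ₀ : ∀ x ∈ (𝓡∂ (n + 1)).boundary M, τ x = 0)
    (ρ : M → ℝ) (U : Set M) (hρ : IsLocalDefiningFunction n ρ U) :
    -- `∇ + dρ/(2ρ)` extends smoothly to `U`
    (∃ D : ConnOp n M, IsExtension nabla 2 ρ U D) ∧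
    -- `L(τ)` can be computed in the splitting of any connection in the projective class
    (∀ x ∈ U, ∀ D : Splitting nabla x, splittingOp D τ = tractorMetric nabla τ x) ∧
    -- `L(τ)` is non-degenerate near the boundary
    IsOpen (nondegLocus nabla τ U) ∧
    U ∩ (𝓡∂ (n + 1)).boundary M ⊆ nondegLocus nabla τ U ∧
    (∀ x ∈ nondegLocus nabla τ U ∩ (𝓡∂ (n + 1)).interior M, (schouten nabla x).Nondegenerate) ∧
    -- the slots of the inverse and the identities between them
    (∀ (D : ConnOp n M) (hD : IsExtension nabla 2 ρ U D),
      ∃ (τhat : ∀ x : M, Dens n 2 x) (t : ∀ x : M, Tan n x) (ψ : M → ℝ)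
        (Z : ∀ x : M, LinearMap.BilinForm ℝ (Module.Dual ℝ (Tan n x)))
        (h : ∀ x : M, LinearMap.BilinForm ℝ (Tan n x)),
        SmoothDensOn τhat U ∧ (∀ x ∈ U, τhat x ≠ 0 ∧ τ x = ρ x • τhat x) ∧
        SmoothVectorOn t (nondegLocus nabla τ U) ∧
        ContMDiffOn (𝓡∂ (n + 1)) 𝓘(ℝ, ℝ) ∞ ψ (nondegLocus nabla τ U) ∧
        SmoothBivectorOn Z (nondegLocus nabla τ U) ∧
        SmoothBilinOn h (nondegLocus nabla τ U) ∧
        (∀ x ∈ nondegLocus nabla τ U ∩ (𝓡∂ (n + 1)).interior M,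
          Z x = (ρ x)⁻¹ • inverseForm (schouten nabla x) ∧
          t x = -(1 / (4 * ρ x ^ 2)) • sharp (schouten nabla x) (differential ρ x) ∧
          (∀ u v : Tan n x, h x u v = ρ x * schouten nabla x u v
            + 1 / (4 * ρ x) * (differential ρ x u * differential ρ x v))) ∧
        (∀ (x : M) (hx : x ∈ nondegLocus nabla τ U) (b : Frame n x),
          HasSlots (inverseForm (tractorMetric nabla τ x))
            ⟨D, hD.inProjClass hρ.isOpen hx.1⟩ b
            (((τhat x).1 b)⁻¹ • Z x) ((2 * ((τhat x).1 b)⁻¹) • t x)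
            (((τhat x).1 b)⁻¹ * ψ x)) ∧
        (∀ x ∈ nondegLocus nabla τ U,
          differential ρ x (t x) = 1 - ρ x * ψ x ∧
          (∀ v : Tan n x, h x (t x) v = -(1 / 4) * ψ x * differential ρ x v) ∧
          (∀ (α : Module.Dual ℝ (Tan n x)) (v : Tan n x),
            Z x α ((h x).flip v) + α (t x) * differential ρ x v = α v))) ∧
    -- in particular, the following tensor fields extend smoothly
    (∃ Z : ∀ x : M, LinearMap.BilinForm ℝ (Module.Dual ℝ (Tan n x)),
      SmoothBivectorOn Z (nondegLocus nabla τ U) ∧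
      ∀ x ∈ nondegLocus nabla τ U ∩ (𝓡∂ (n + 1)).interior M,
        Z x = (ρ x)⁻¹ • inverseForm (schouten nabla x)) ∧
    (∃ X : ∀ x : M, Tan n x,
      SmoothVectorOn X (nondegLocus nabla τ U) ∧
      ∀ x ∈ nondegLocus nabla τ U ∩ (𝓡∂ (n + 1)).interior M,
        X x = (ρ x ^ 2)⁻¹ • sharp (schouten nabla x) (differential ρ x)) := by
  have hnd : ∀ {D : ConnOp n M} {τhat : ∀ x : M, Dens n 2 x}, IsExtension nabla 2 ρ U D →
      IsParallelScaleOn D τhat U → (∀ x ∈ U, τ x = ρ x • τhat x) →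
      ∀ x, x ∈ nondegLocus nabla τ U ↔ x ∈ U ∧ (metricForm D ρ x).Nondegenerate :=
    fun hD hτhat hτe x => mem_nondegLocus_iff hn hρ hD hτhat hτe
  obtain ⟨D₀, hD₀⟩ := exists_isExtension hconn hcompact hρ
  obtain ⟨τ₀, hτ₁, hτ₂⟩ := exists_extended_density hτ hτ₀ hρ hD₀
  have hmem := hnd hD₀ hτ₁ hτ₂
  have hset : nondegLocus nabla τ U = {x | x ∈ U ∧ (metricForm D₀ ρ x).Nondegenerate} :=
    Set.ext hmem
  have hopen : IsOpen (nondegLocus nabla τ U) :=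
    hset ▸ isOpen_nondegenerate hρ.isOpen hρ.smooth hD₀.1
  have hsub : nondegLocus nabla τ U ⊆ U := fun x hx => hx.1
  have hschouten : ∀ x ∈ nondegLocus nabla τ U ∩ (𝓡∂ (n + 1)).interior M,
      (schouten nabla x).Nondegenerate := fun x hx =>
    nondegenerate_of_slotForm (hρ.ne_zero hx.1.1 hx.2)
      (schouten_symm_of_parallel isOpen_interiorPoints hconn two_ne_zero hτ hx.2)
      (trailingSlot_interior hn hconn hτ hρ hD₀ hτ₁ hτ₂ hx.1.1 hx.2) ((hmem x).1 hx.1).2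
  have hZ : ∀ {D : ConnOp n M} {τhat : ∀ x : M, Dens n 2 x}, IsExtension nabla 2 ρ U D →
      IsParallelScaleOn D τhat U → (∀ x ∈ U, τ x = ρ x • τhat x) →
      ∀ x ∈ nondegLocus nabla τ U ∩ (𝓡∂ (n + 1)).interior M,
        slotZ (metricForm D ρ x) = (ρ x)⁻¹ • inverseForm (schouten nabla x) ∧
        slotT (metricForm D ρ x)
          = -(1 / (4 * ρ x ^ 2)) • sharp (schouten nabla x) (differential ρ x) := by
    intro D τhat hD hτhat hτe x hx
    have := finiteDimensional_tan (n := n) x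
    have hh := trailingSlot_interior hn hconn hτ hρ hD hτhat hτe hx.1.1 hx.2
    have hF := ((hnd hD hτhat hτe x).1 hx.1).2
    exact ⟨slotZ_eq (hρ.ne_zero hx.1.1 hx.2) (hschouten x hx) hh hF,
      slotT_eq (hρ.ne_zero hx.1.1 hx.2) (hschouten x hx) hh hF⟩
  refine ⟨⟨D₀, hD₀⟩, fun x hx D => splittingOp_eq_tractorMetric hn hρ hD₀ hτ₁ hτ₂ hx D, hopen,
    fun x hx => (hmem x).2 ⟨hx.1, metricForm_nondegenerate_of_boundary hnondeg hρ hD₀ hτ₁ hx.1 hx.2⟩,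
    hschouten, ?_, ?_, ?_⟩
  · intro D hD
    -- The extension `D` is arbitrary here, so τ̂ is built anew for it; the non-degeneracy locus
    -- does not depend on this choice.
    obtain ⟨τhat, hτhat, hτe⟩ := exists_extended_density hτ hτ₀ hρ hD
    have hF : ∀ x ∈ nondegLocus nabla τ U, (metricForm D ρ x).Nondegenerate :=
      fun x hx => ((hnd hD hτhat hτe x).1 hx).2
    refine ⟨τhat, fun x => slotT (metricForm D ρ x), fun x => slotPsi (metricForm D ρ x),
      fun x => slotZ (metricForm D ρ x), trailingSlot D ρ, hτhat.1,
      fun x hx => ⟨(hτhat.2 x hx).1, hτe x hx⟩,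
      smoothVectorOn_slotT hρ.isOpen hρ.smooth hD.1 hsub hopen hF,
      smoothFnOn_slotPsi hρ.isOpen hρ.smooth hD.1 hsub hopen hF,
      smoothBivectorOn_slotZ hρ.isOpen hρ.smooth hD.1 hsub hF,
      fun W' hW' => smoothBilinOn_trailingSlot hρ.isOpen hρ.smooth hD.1 W' (hW'.trans hsub),
      fun x hx => ⟨(hZ hD hτhat hτe x hx).1, (hZ hD hτhat hτe x hx).2,
        trailingSlot_interior hn hconn hτ hρ hD hτhat hτe hx.1.1 hx.2⟩,
      fun x hx b => hasSlots_inverse_tractorMetric hn hρ hD hτhat hτe hx.1 (hF x hx) b,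
      fun x hx => ?_⟩
    have := finiteDimensional_tan (n := n) x
    have h1 := slotT_apply (hF x hx)
    have h2 := slotT_contract (hF x hx)
    have h3 := slotZ_contract (hF x hx) (trailingSlot_symm hρ hD.1 hτhat hx.1)
    simp only [LinearMap.smul_apply, smul_eq_mul] at h1 h2 h3
    refine ⟨?_, fun v => ?_, fun α v => ?_⟩
    · simp only [metricForm]
      linarith
    · simp only [metricForm]
      rw [h2]
      ring
    · simp only [metricForm]
      rw [← h3 α v]
      ring
  · exact ⟨fun x => slotZ (metricForm D₀ ρ x),
      smoothBivectorOn_slotZ hρ.isOpen hρ.smooth hD₀.1 hsub fun x hx => ((hmem x).1 hx).2,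
      fun x hx => (hZ hD₀ hτ₁ hτ₂ x hx).1⟩
  -- The factor `-4` cancels the `-1/4` in `t`, leaving `ρ⁻²` times the raised `dρ`.
  · refine ⟨fun x => (-4 : ℝ) • slotT (metricForm D₀ ρ x), SmoothVectorOn.smul contMDiffOn_const
      (smoothVectorOn_slotT hρ.isOpen hρ.smooth hD₀.1 hsub hopen fun x hx => ((hmem x).1 hx).2),
      fun x hx => ?_⟩
    have hρx := hρ.ne_zero hx.1.1 hx.2
    beta_reduce
    rw [(hZ hD₀ hτ₁ hτ₂ x hx).2, smul_smul]
    congr 1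
    field_simp
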